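/- **Conventions.** Let $(\mathcal V,\otimes,I)$ be a cocomplete (locally small) monoidal category whose tensor product preserves colimits in each variable. For a set $S$, a $\mathcal V$-quiver on $S$ is a family $(Q(a,b))_{a,b\in S}$ of objects of $\mathcal V$; the category $\mathrm{Quiv}_S(\mathcal V)$ of these is monoidal with $(Q\otimes_S P)(a,b)=\coprod_{c\in S}Q(a,c)\otimes P(c,b)$ and with unit the quiver that is $I$ at $(a,a)$ and initial at $(a,b)$ for $a\neq b$. Let $\mathbf\Delta_f$ be the category of the posets $[n]=\{0<\dots<n\}$, $n\ge 0$, and order morphisms preserving both endpoints, monoidal under $[m]+[n]=[m+n]$ (gluing the last point of $[m]$ to the first point of $[n]$). A *templicial object* of $\mathcal V$ is a pair $(X,S)$ of a set $S$ and a colax monoidal functor $X:\mathbf\Delta_f^{op}\to \mathrm{Quiv}_S(\mathcal V)$, with comultiplication $\mu$ and counit $\epsilon$, such that $\epsilon$ is invertible. A morphism $(X,S)\to(Y,T)$ is a map $f:S\to T$ together with a monoidal natural transformation $f_!X\to Y$, where $f_!$ is left adjoint to the pullback $f^*$ of quivers; equivalently, morphisms $X_n(a,b)\to Y_n(f(a),f(b))$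 that are natural in $[n]$ and compatible with $\mu$ and $\epsilon$. A *templicial module* over a commutative ring $k$ is a templicial object of $\mathrm{Mod}(k)$. A simplicial set $Y$ is regarded as a templicial set $\tilde Y$ (templicial object of $\mathrm{Set}$) with base $Y_0$, where $\tilde Y_n(a,b)$ is the set of $n$-simplices with first vertex $a$ and last vertex $b$, and $\mu_{p,q}$ sends a $(p+q)$-simplex to the pair of its initial $p$-dimensional face and its final $q$-dimensional face. Let $F:\mathrm{Set}\to\mathcal V$, $F(A)=\coprod_{a\in A}I$, which is strong monoidal, and let $F_S:\mathrm{Quiv}_S(\mathrm{Set})\to \mathrm{Quiv}_S(\mathcal V)$ be given by applying $F$ entrywise; it is strong monoidal, with structure isomorphism $\nu:F_S(Q\otimes_S P)\to F_S(Q)\otimes_S F_S(P)$. The *free templicial object functor* $\tilde F$, from simplicial sets to templicial objects of $\mathcal V$, sends $Y$ to $(F_{Y_0}\circ\tilde Y,\,Y_0)$. A *nonassociative Frobenius (naF) structure* on a colax monoidal functor $H$ with comultiplication $\mu$ and invertible counit $\epsilon$ is a natural transformation $Z_{A,B}:H(A)\otimes H(B)\to H(A\otimes B)$, which is unital with respect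 to the unit $\epsilon^{-1}:I\to H(I)$, such that for all $A,B,C$ (suppressing associativity isomorphisms) $$(\mathrm{id}\otimes Z_{B,C})\circ(\mu_{A,B}\otimes \mathrm{id})=\mu_{A,B\otimes C}\circ Z_{A\otimes B,C},\qquad (Z_{A,B}\otimes \mathrm{id})\circ(\mathrm{id}\otimes\mu_{B,C})=\mu_{A\otimes B,C}\circ Z_{A,B\otimes C}.$$ No associativity of $Z$ is required. A naF-structure on a simplicial set $Y$ is one on $\tilde Y$. A templicial object $X$ of $\mathcal V$ is a *$\mathcal V$-quasi-category* if for all $0<i<n$ every morphism $\tilde F(\Lambda^n_i)\to X$ extends along $\tilde F(\Lambda^n_i)\to\tilde F(\Delta^n)$ to a morphism $\tilde F(\Delta^n)\to X$. For $\mathcal V=\mathrm{Mod}(k)$ it is called a *linear quasi-category*. **Statement.** (a) Every quasi-category $X$ has a naF-structure. (b) For every $\mathcal V$ as above, the functor $\tilde F$ preserves naF-structures: if $Z$ is a naF-structure on a simplicial set $X$, then the morphisms $$F_{X_0}(\tilde X_p)\otimes F_{X_0}(\tilde X_q)\xrightarrow{\ \nu^{-1}\ }F_{X_0}(\tilde X_p\otimes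 \tilde X_q)\xrightarrow{\ F_{X_0}(Z^{p,q})\ }F_{X_0}(\tilde X_{p+q})\qquad(p,q\ge 0)$$ form the multiplication of a naF-structure on $\tilde F(X)$. (c) Let $k$ be a commutative ring. Every templicial $k$-module that has a naF-structure is a linear quasi-category. (d) Consequently, for every commutative ring $k$ and every quasi-category $X$, the free templicial $k$-module $\tilde F(X)$ is a linear quasi-category. -/

import Mathlib

open CategoryTheory Limits MonoidalCategory
universe w w' u

/-- The category of finite intervals: objects are the posets `[n] = {0, …, n}`, morphisms are the
order morphisms that preserve both endpoints. -/
structure FinInt where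
  len : ℕ

namespace FinInt

@[ext]
structure Hom (m n : FinInt) where
  toOrderHom : Fin (m.len + 1) →o Fin (n.len + 1)
  map_zero : toOrderHom 0 = 0
  map_last : toOrderHom (Fin.last m.len) = Fin.last n.len

instance : Category FinInt where
  Hom := Hom
  id _ := ⟨OrderHom.id, rfl, rfl⟩
  comp f g := ⟨g.toOrderHom.comp f.toOrderHom, by simp [f.map_zero, g.map_zero],
    by simp [f.map_last, g.map_last]⟩

lemma hom_ext {m n : FinInt} {f g : m ⟶ n}
    (h : ∀ i, (f.toOrderHom i : ℕ) = g.toOrderHom i) : f = g :=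
  Hom.ext (OrderHom.ext _ _ (funext fun i => Fin.ext (h i)))

@[simp] lemma id_apply (m : FinInt) (i : Fin (m.len + 1)) : Hom.toOrderHom (𝟙 m) i = i := rfl

@[simp] lemma comp_apply {l m n : FinInt} (f : l ⟶ m) (g : m ⟶ n) (i : Fin (l.len + 1)) :
    (f ≫ g).toOrderHom i = g.toOrderHom (f.toOrderHom i) := rfl

/-- The inclusion of finite intervals into the simplex category. -/
def toSimplex : FinInt ⥤ SimplexCategory where
  obj n := SimplexCategory.mk n.len
  map f := SimplexCategory.Hom.mk f.toOrderHom

/-- The underlying function of `f + g`: the map `f` on `{0, …, m}`, followed by the shifted map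
`g` on `{m, …, m + n}`. -/
def addFun {m m' n n' : FinInt} (f : m ⟶ m') (g : n ⟶ n') (i : Fin (m.len + n.len + 1)) : ℕ :=
  if h : (i : ℕ) ≤ m.len then f.toOrderHom ⟨i, Nat.lt_succ_of_le h⟩
  else m'.len + g.toOrderHom ⟨i - m.len, by have := i.2; omega⟩

lemma addFun_lt {m m' n n' : FinInt} (f : m ⟶ m') (g : n ⟶ n') (i : Fin (m.len + n.len + 1)) :
    addFun f g i < m'.len + n'.len + 1 := by
  unfold addFun
  split_ifs with h
  · have := (f.toOrderHom ⟨i, Nat.lt_succ_of_le h⟩).2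
    omega
  · have := (g.toOrderHom ⟨i - m.len, by have := i.2; omega⟩).2
    omega

lemma addFun_mono {m m' n n' : FinInt} (f : m ⟶ m') (g : n ⟶ n')
    {i j : Fin (m.len + n.len + 1)} (hij : i ≤ j) : addFun f g i ≤ addFun f g j := by
  have hij' : (i : ℕ) ≤ j := hij
  unfold addFun
  split_ifs with h1 h2
  · exact f.toOrderHom.monotone (show (⟨i, _⟩ : Fin _) ≤ ⟨j, _⟩ from hij')
  · have := (f.toOrderHom ⟨i, Nat.lt_succ_of_le h1⟩).2
    omega
  · omega
  · exact Nat.add_le_add_left (g.toOrderHom.monotone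
      (show (⟨i - m.len, _⟩ : Fin _) ≤ ⟨j - m.len, _⟩ from Nat.sub_le_sub_right hij' _)) _

lemma apply_eq_zero {m n : FinInt} (f : m ⟶ n) {i : Fin (m.len + 1)} (h : (i : ℕ) = 0) :
    (f.toOrderHom i : ℕ) = 0 := by
  rw [show i = 0 from Fin.ext h, f.map_zero]; rfl

lemma apply_eq_last {m n : FinInt} (f : m ⟶ n) {i : Fin (m.len + 1)} (h : (i : ℕ) = m.len) :
    (f.toOrderHom i : ℕ) = n.len := by
  rw [show i = Fin.last _ from Fin.ext h, f.map_last]; rfl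

lemma apply_congr {m n : FinInt} (f : m ⟶ n) {i j : Fin (m.len + 1)} (h : (i : ℕ) = j) :
    (f.toOrderHom i : ℕ) = f.toOrderHom j := by
  rw [Fin.ext h]

/-- The sum `f + g : [m + n] ⟶ [m' + n']` of two morphisms of finite intervals. -/
def addHom {m m' n n' : FinInt} (f : m ⟶ m') (g : n ⟶ n') :
    (⟨m.len + n.len⟩ : FinInt) ⟶ ⟨m'.len + n'.len⟩ where
  toOrderHom :=
    { toFun := fun i => ⟨addFun f g i, addFun_lt f g i⟩
      monotone' := fun _ _ hij => addFun_mono f g hij }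
  map_zero := Fin.ext (by
    have h : addFun f g 0 = 0 := by
      simp only [addFun, Fin.val_zero, Nat.zero_le]
      exact apply_eq_zero f rfl
    exact h)
  map_last := Fin.ext (by
    have h : addFun f g (Fin.last _) = m'.len + n'.len := by
      unfold addFun
      split_ifs with h
      · have h0 : n.len = 0 := by simp only [Fin.val_last] at h; omega
        have h1 := apply_eq_zero g (i := Fin.last _) h0
        rw [apply_eq_last g rfl] at h1
        rw [apply_eq_last f (by simp [h0]), h1, Nat.add_zero]
      · rw [apply_eq_last g (by simp)]
    exact h)

/-- The identity map `[m] ⟶ [n]` for `m = n`. -/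
def castHom {m n : FinInt} (h : m.len = n.len) : m ⟶ n where
  toOrderHom := ⟨Fin.cast (congrArg (· + 1) h), fun _ _ hij => hij⟩
  map_zero := rfl
  map_last := Fin.ext h

@[simp] lemma castHom_apply {m n : FinInt} (h : m.len = n.len) (i : Fin (m.len + 1)) :
    ((castHom h).toOrderHom i : ℕ) = i := rfl

def castIso {m n : FinInt} (h : m.len = n.len) : m ≅ n where
  hom := castHom h
  inv := castHom h.symm
  hom_inv_id := hom_ext fun _ => rfl
  inv_hom_id := hom_ext fun _ => rfl

instance : MonoidalCategoryStruct FinInt where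
  tensorObj m n := ⟨m.len + n.len⟩
  tensorUnit := ⟨0⟩
  tensorHom f g := addHom f g
  whiskerLeft m _ _ g := addHom (𝟙 m) g
  whiskerRight f n := addHom f (𝟙 n)
  associator _ _ _ := castIso (Nat.add_assoc _ _ _)
  leftUnitor _ := castIso (Nat.zero_add _)
  rightUnitor _ := castIso (Nat.add_zero _)

@[simp] lemma tensorObj_len (m n : FinInt) : (m ⊗ n).len = m.len + n.len := rfl

@[simp] lemma tensorUnit_len : (𝟙_ FinInt).len = 0 := rfl

lemma tensorHom_apply {m m' n n' : FinInt} (f : m ⟶ m') (g : n ⟶ n') (i : Fin ((m ⊗ n).len + 1)) :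
    ((f ⊗ₘ g).toOrderHom i : ℕ) =
      if h : (i : ℕ) ≤ m.len then (f.toOrderHom ⟨i, Nat.lt_succ_of_le h⟩ : ℕ)
      else m'.len + g.toOrderHom ⟨i - m.len, by have := i.2; simp only [tensorObj_len] at this; omega⟩ :=
  rfl

@[simp] lemma associator_hom_apply (a b c : FinInt) (i : Fin (((a ⊗ b) ⊗ c).len + 1)) :
    ((α_ a b c).hom.toOrderHom i : ℕ) = i := rfl

@[simp] lemma leftUnitor_hom_apply (a : FinInt) (i : Fin ((𝟙_ FinInt ⊗ a).len + 1)) :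
    ((λ_ a).hom.toOrderHom i : ℕ) = i := rfl

@[simp] lemma rightUnitor_hom_apply (a : FinInt) (i : Fin ((a ⊗ 𝟙_ FinInt).len + 1)) :
    ((ρ_ a).hom.toOrderHom i : ℕ) = i := rfl

lemma tensorHom_comp {m m' m'' n n' n'' : FinInt} (f : m ⟶ m') (f' : m' ⟶ m'')
    (g : n ⟶ n') (g' : n' ⟶ n'') :
    (f ≫ f') ⊗ₘ (g ≫ g') = (f ⊗ₘ g) ≫ (f' ⊗ₘ g') := by
  apply hom_ext
  intro i
  rw [comp_apply, tensorHom_apply, tensorHom_apply]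
  have h1 := tensorHom_apply f g i
  by_cases h : (i : ℕ) ≤ m.len
  · simp only [h, dite_true] at h1
    have h2 : ((f ⊗ₘ g).toOrderHom i : ℕ) ≤ m'.len := by
      rw [h1]; exact Nat.le_of_lt_succ (f.toOrderHom _).2
    simp only [h, h2, dite_true, comp_apply]
    exact apply_congr f' h1.symm
  · simp only [h, dite_false] at h1
    by_cases h2 : ((f ⊗ₘ g).toOrderHom i : ℕ) ≤ m'.len
    · simp only [h, h2, dite_true, dite_false, comp_apply]
      rw [apply_eq_zero g' (by omega), apply_eq_last f' (by dsimp only; omega), Nat.add_zero]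
    · simp only [h, h2, dite_false, comp_apply]
      congr 1
      apply apply_congr g'
      dsimp only
      omega

instance : MonoidalCategory FinInt := .ofTensorHom
  (id_tensorHom_id := by
    intro m n
    apply hom_ext
    intro i
    rw [tensorHom_apply]
    split_ifs with h
    · rfl
    · simp only [id_apply]; omega)
  (id_tensorHom := fun _ _ _ _ => rfl)
  (tensorHom_id := fun _ _ => rfl)
  (tensorHom_comp_tensorHom := fun f g f' g' => (tensorHom_comp f f' g g').symm)
  (associator_naturality := by
    intro a b c a' b' c' f g h
    apply hom_ext
    intro i
    simp only [comp_apply, associator_hom_apply, tensorHom_apply, tensorObj_len]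
    by_cases h1 : (i : ℕ) ≤ a.len
    · have h2 : (i : ℕ) ≤ a.len + b.len := by omega
      simp [h1, h2]
    · by_cases h2 : (i : ℕ) ≤ a.len + b.len
      · have h3 : (i : ℕ) - a.len ≤ b.len := by omega
        simp [h1, h2, h3]
      · have h3 : ¬ (i : ℕ) - a.len ≤ b.len := by omega
        simp [h1, h2, h3, Nat.add_assoc, Nat.sub_sub])
  (leftUnitor_naturality := by
    intro a b f
    apply hom_ext
    intro i
    simp only [comp_apply, leftUnitor_hom_apply, tensorHom_apply, tensorUnit_len, Nat.zero_add]
    split_ifs with h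
    · have h' : (i : ℕ) = 0 := Nat.le_zero.mp h
      rw [apply_eq_zero f (i := (λ_ a).hom.toOrderHom i) h']
      exact h'
    · rfl)
  (rightUnitor_naturality := by
    intro a b f
    apply hom_ext
    intro i
    have h1 : (i : ℕ) ≤ a.len := Nat.le_of_lt_succ i.2
    simp only [comp_apply, rightUnitor_hom_apply, tensorHom_apply, h1, dite_true]
    rfl)
  (pentagon := by
    intro a b c d
    apply hom_ext
    intro i
    have hi := i.2
    simp only [tensorObj_len] at hi
    simp only [comp_apply, associator_hom_apply, tensorHom_apply, id_apply, tensorObj_len]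
    split_ifs <;> omega)
  (triangle := by
    intro a b
    apply hom_ext
    intro i
    simp only [comp_apply, associator_hom_apply, tensorHom_apply, id_apply, leftUnitor_hom_apply,
      rightUnitor_hom_apply, tensorObj_len, tensorUnit_len, Nat.add_zero]
    by_cases h : (i : ℕ) ≤ a.len <;> simp [h])

end FinInt

/-- The category `V` is cocomplete and its tensor product preserves colimits in each variable. -/
class TensorCocomplete (V : Type w) [Category.{u} V] [MonoidalCategory V] : Prop where
  hasColimits : HasColimits V
  preserves_left (A : V) : PreservesColimits (tensorLeft A)
  preserves_right (A : V) : PreservesColimits (tensorRight A)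

attribute [instance] TensorCocomplete.hasColimits TensorCocomplete.preserves_left
  TensorCocomplete.preserves_right

instance : TensorCocomplete (Type u) where
  hasColimits := inferInstance
  preserves_left := fun _ => inferInstance
  preserves_right := fun _ => inferInstance

instance (k : Type u) [CommRing k] : TensorCocomplete (ModuleCat.{u} k) where
  hasColimits := inferInstance
  preserves_left := fun _ => inferInstance
  preserves_right := fun _ => inferInstance

/-! ### Coproducts -/

section Coproducts

variable {C : Type w} [Category.{u} C] [HasColimits C] {D : Type w'} [Category.{u} D]
  (G : C ⥤ D) [∀ J : Type u, PreservesColimitsOfShape (Discrete J) G] {J : Type u} {A : J → C}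

/-- If `G` preserves coproducts, then a morphism out of `G (∐ A)` is given by its components. -/
noncomputable def mapSigmaDesc {T : D} (φ : ∀ i, G.obj (A i) ⟶ T) : G.obj (∐ A) ⟶ T :=
  (isColimitCofanMkObjOfIsColimit G A _ (coproductIsCoproduct A)).desc (Cofan.mk T φ)

@[simp]
lemma map_ι_mapSigmaDesc {T : D} (φ : ∀ i, G.obj (A i) ⟶ T) (i : J) :
    G.map (Sigma.ι A i) ≫ mapSigmaDesc G φ = φ i :=
  (isColimitCofanMkObjOfIsColimit G A _ (coproductIsCoproduct A)).fac _ ⟨i⟩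

@[simp]
lemma map_ι_mapSigmaDesc_assoc {T : D} (φ : ∀ i, G.obj (A i) ⟶ T) (i : J) {Z : D} (t : _ ⟶ Z) :
    G.map (Sigma.ι A i) ≫ mapSigmaDesc G φ ≫ t =
      φ i ≫ t := by
  simpa only [Category.assoc, Category.id_comp] using eq_whisker (map_ι_mapSigmaDesc G φ i) t

lemma mapSigma_hom_ext {T : D} {f g : G.obj (∐ A) ⟶ T}
    (h : ∀ i, G.map (Sigma.ι A i) ≫ f = G.map (Sigma.ι A i) ≫ g) : f = g :=
  Cofan.IsColimit.hom_ext (isColimitCofanMkObjOfIsColimit G A _ (coproductIsCoproduct A)) _ _ h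

end Coproducts

section TensorCoproducts

variable {V : Type w} [Category.{u} V] [MonoidalCategory V] [TensorCocomplete V]
  {J : Type u} {A : J → V} {B T : V}

noncomputable def sigmaTensorDesc (φ : ∀ i, A i ⊗ B ⟶ T) : (∐ A) ⊗ B ⟶ T :=
  mapSigmaDesc (tensorRight B) φ

noncomputable def tensorSigmaDesc (φ : ∀ i, B ⊗ A i ⟶ T) : B ⊗ (∐ A) ⟶ T :=
  mapSigmaDesc (tensorLeft B) φ

@[simp]
lemma ι_sigmaTensorDesc (φ : ∀ i, A i ⊗ B ⟶ T) (i : J) :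
    Sigma.ι A i ▷ B ≫ sigmaTensorDesc φ = φ i :=
  map_ι_mapSigmaDesc (tensorRight B) φ i

@[simp]
lemma ι_sigmaTensorDesc_assoc (φ : ∀ i, A i ⊗ B ⟶ T) (i : J) {Z : V} (t : _ ⟶ Z) :
    Sigma.ι A i ▷ B ≫ sigmaTensorDesc φ ≫ t =
      φ i ≫ t := by
  simpa only [Category.assoc, Category.id_comp] using eq_whisker (ι_sigmaTensorDesc φ i) t

@[simp]
lemma ι_tensorSigmaDesc (φ : ∀ i, B ⊗ A i ⟶ T) (i : J) :
    B ◁ Sigma.ι A i ≫ tensorSigmaDesc φ = φ i :=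
  map_ι_mapSigmaDesc (tensorLeft B) φ i

@[simp]
lemma ι_tensorSigmaDesc_assoc (φ : ∀ i, B ⊗ A i ⟶ T) (i : J) {Z : V} (t : _ ⟶ Z) :
    B ◁ Sigma.ι A i ≫ tensorSigmaDesc φ ≫ t =
      φ i ≫ t := by
  simpa only [Category.assoc, Category.id_comp] using eq_whisker (ι_tensorSigmaDesc φ i) t

lemma sigmaTensor_hom_ext {f g : (∐ A) ⊗ B ⟶ T}
    (h : ∀ i, Sigma.ι A i ▷ B ≫ f = Sigma.ι A i ▷ B ≫ g) : f = g :=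
  mapSigma_hom_ext (tensorRight B) h

lemma tensorSigma_hom_ext {f g : B ⊗ (∐ A) ⟶ T}
    (h : ∀ i, B ◁ Sigma.ι A i ≫ f = B ◁ Sigma.ι A i ≫ g) : f = g :=
  mapSigma_hom_ext (tensorLeft B) h

end TensorCoproducts

/-! ### Enriched quivers -/

/-- A `V`-enriched quiver on the set `S`: a family of objects of `V` indexed by `S × S`. -/
structure VQuiver (S : Type u) (V : Type w) where
  obj : S → S → V

namespace VQuiver

variable {S : Type u} {V : Type w} [Category.{u} V]

/-- A morphism of `V`-quivers: a family of morphisms of `V`. -/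
@[ext]
structure Hom (Q P : VQuiver S V) where
  app : ∀ a b, Q.obj a b ⟶ P.obj a b

instance : Category (VQuiver S V) where
  Hom := Hom
  id Q := ⟨fun _ _ => 𝟙 _⟩
  comp f g := ⟨fun a b => f.app a b ≫ g.app a b⟩

@[ext]
lemma hom_ext {Q P : VQuiver S V} {f g : Q ⟶ P} (h : ∀ a b, f.app a b = g.app a b) : f = g :=
  Hom.ext (funext fun a => funext fun b => h a b)

@[simp] lemma id_app (Q : VQuiver S V) (a b : S) : Hom.app (𝟙 Q) a b = 𝟙 _ := rfl

@[simp] lemma comp_app {Q P R : VQuiver S V} (f : Q ⟶ P) (g : P ⟶ R) (a b : S) :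
    (f ≫ g).app a b = f.app a b ≫ g.app a b := rfl

/-- An isomorphism of quivers from componentwise isomorphisms. -/
@[simps]
def mkIso {Q P : VQuiver S V} (e : ∀ a b, Q.obj a b ≅ P.obj a b) : Q ≅ P where
  hom := ⟨fun a b => (e a b).hom⟩
  inv := ⟨fun a b => (e a b).inv⟩

variable [MonoidalCategory V] [TensorCocomplete V]

/-- The tensor product of quivers, `(Q ⊗ P)(a, b) = ∐ c, Q(a, c) ⊗ P(c, b)`. -/
noncomputable abbrev tensor (Q P : VQuiver S V) : VQuiver S V :=
  ⟨fun a b => ∐ fun c => Q.obj a c ⊗ P.obj c b⟩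

/-- The unit quiver: `I(a, b)` is the coproduct of copies of `I` indexed by the proofs of `a = b`,
that is, `I` if `a = b` and the initial object otherwise. -/
noncomputable abbrev unit (S : Type u) (V : Type w) [Category.{u} V] [MonoidalCategory V]
    [TensorCocomplete V] : VQuiver S V :=
  ⟨fun a b => ∐ fun _ : ULift.{u} (PLift (a = b)) => 𝟙_ V⟩

/-- The associativity isomorphism `(Q ⊗ P) ⊗ R ≅ Q ⊗ (P ⊗ R)`, induced by the one of `V`. -/
noncomputable def assoc (Q P R : VQuiver S V) : tensor (tensor Q P) R ≅ tensor Q (tensor P R) :=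
  mkIso fun a b =>
    { hom := Sigma.desc fun c => sigmaTensorDesc fun d =>
        (α_ _ _ _).hom ≫ Q.obj a d ◁ Sigma.ι (fun c => P.obj d c ⊗ R.obj c b) c ≫
          Sigma.ι (fun d => Q.obj a d ⊗ (tensor P R).obj d b) d
      inv := Sigma.desc fun d => tensorSigmaDesc fun c =>
        (α_ _ _ _).inv ≫ Sigma.ι (fun d => Q.obj a d ⊗ P.obj d c) d ▷ R.obj c b ≫
          Sigma.ι (fun c => (tensor Q P).obj a c ⊗ R.obj c b) c
      hom_inv_id := by
        refine Sigma.hom_ext _ _ fun c => sigmaTensor_hom_ext fun d => ?_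
        simp
      inv_hom_id := by
        refine Sigma.hom_ext _ _ fun c => tensorSigma_hom_ext fun d => ?_
        simp }

/-- The left unit isomorphism `I ⊗ Q ≅ Q`, induced by the one of `V`. -/
noncomputable def leftUnit (Q : VQuiver S V) : tensor (unit S V) Q ≅ Q :=
  mkIso fun a b =>
    { hom := Sigma.desc fun c => sigmaTensorDesc fun h =>
        (λ_ _).hom ≫ eqToHom (congrArg (Q.obj · b) h.down.down.symm)
      inv := (λ_ _).inv ≫ Sigma.ι (fun _ : ULift.{u} (PLift (a = a)) => 𝟙_ V) ⟨⟨rfl⟩⟩ ▷ Q.obj a b ≫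
        Sigma.ι (fun c => (unit S V).obj a c ⊗ Q.obj c b) a
      hom_inv_id := by
        refine Sigma.hom_ext _ _ fun c => sigmaTensor_hom_ext fun h => ?_
        obtain ⟨⟨rfl⟩⟩ := h
        simp only [Sigma.ι_desc_assoc, ι_sigmaTensorDesc_assoc, eqToHom_refl, Category.comp_id,
          Iso.hom_inv_id_assoc]
      inv_hom_id := by simp }

/-- The right unit isomorphism `Q ⊗ I ≅ Q`, induced by the one of `V`. -/
noncomputable def rightUnit (Q : VQuiver S V) : tensor Q (unit S V) ≅ Q :=
  mkIso fun a b =>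
    { hom := Sigma.desc fun c => tensorSigmaDesc fun h =>
        (ρ_ _).hom ≫ eqToHom (congrArg (Q.obj a ·) h.down.down)
      inv := (ρ_ _).inv ≫ Q.obj a b ◁ Sigma.ι (fun _ : ULift.{u} (PLift (b = b)) => 𝟙_ V) ⟨⟨rfl⟩⟩ ≫
        Sigma.ι (fun c => Q.obj a c ⊗ (unit S V).obj c b) b
      hom_inv_id := by
        refine Sigma.hom_ext _ _ fun c => tensorSigma_hom_ext fun h => ?_
        obtain ⟨⟨rfl⟩⟩ := h
        simp only [Sigma.ι_desc_assoc, ι_tensorSigmaDesc_assoc, eqToHom_refl, Category.comp_id,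
          Iso.hom_inv_id_assoc]
      inv_hom_id := by simp }

noncomputable instance : MonoidalCategoryStruct (VQuiver S V) where
  tensorObj := tensor
  tensorUnit := unit S V
  tensorHom f g := ⟨fun a b => Limits.Sigma.map fun c => f.app a c ⊗ₘ g.app c b⟩
  whiskerLeft Q _ _ g := ⟨fun a b => Limits.Sigma.map fun c => Q.obj a c ◁ g.app c b⟩
  whiskerRight f P := ⟨fun a b => Limits.Sigma.map fun c => f.app a c ▷ P.obj c b⟩
  associator := assoc
  leftUnitor := leftUnit
  rightUnitor := rightUnit

/-- The inclusion of the summand with index `c` into `(Q ⊗ P)(a, b)`. -/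
noncomputable def ι (Q P : VQuiver S V) (a b c : S) :
    Q.obj a c ⊗ P.obj c b ⟶ (Q ⊗ P).obj a b :=
  Sigma.ι (fun c => Q.obj a c ⊗ P.obj c b) c

/-- The inclusion of `I` into `I(a, b)` for `a = b`. -/
noncomputable def unitι {a b : S} (h : a = b) : 𝟙_ V ⟶ (𝟙_ (VQuiver S V)).obj a b :=
  Sigma.ι (fun _ : ULift.{u} (PLift (a = b)) => 𝟙_ V) ⟨⟨h⟩⟩

/-- The morphism out of `(Q ⊗ P)(a, b)` with the given components. -/
noncomputable def desc {Q P : VQuiver S V} {a b : S} {T : V}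
    (φ : ∀ c, Q.obj a c ⊗ P.obj c b ⟶ T) : (Q ⊗ P).obj a b ⟶ T :=
  Sigma.desc φ

/-- The morphism out of `I(a, b)` with the given components. -/
noncomputable def unitDesc {a b : S} {T : V} (φ : a = b → (𝟙_ V ⟶ T)) :
    (𝟙_ (VQuiver S V)).obj a b ⟶ T :=
  Sigma.desc fun h : ULift.{u} (PLift (a = b)) => φ h.down.down

@[simp]
lemma ι_desc {Q P : VQuiver S V} {a b : S} {T : V}
    (φ : ∀ c, Q.obj a c ⊗ P.obj c b ⟶ T) (c : S) : ι Q P a b c ≫ desc φ = φ c :=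
  Sigma.ι_desc φ c

@[simp]
lemma ι_desc_assoc {Q P : VQuiver S V} {a b : S} {T : V}
    (φ : ∀ c, Q.obj a c ⊗ P.obj c b ⟶ T) (c : S) {Z : V} (t : _ ⟶ Z) :
    ι Q P a b c ≫ desc φ ≫ t =
      φ c ≫ t := by
  simpa only [Category.assoc, Category.id_comp] using eq_whisker (ι_desc φ c) t

@[simp]
lemma unitι_unitDesc {a b : S} {T : V} (φ : a = b → (𝟙_ V ⟶ T)) (h : a = b) :
    unitι h ≫ unitDesc φ = φ h :=
  Sigma.ι_desc _ _

@[simp]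
lemma unitι_unitDesc_assoc {a b : S} {T : V} (φ : a = b → (𝟙_ V ⟶ T)) (h : a = b) {Z : V} (t : _ ⟶ Z) :
    unitι h ≫ unitDesc φ ≫ t =
      φ h ≫ t := by
  simpa only [Category.assoc, Category.id_comp] using eq_whisker (unitι_unitDesc φ h) t

lemma tensor_hom_ext {Q P : VQuiver S V} {a b : S} {T : V} {f g : (Q ⊗ P).obj a b ⟶ T}
    (h : ∀ c, ι Q P a b c ≫ f = ι Q P a b c ≫ g) : f = g :=
  Sigma.hom_ext _ _ h

lemma unit_hom_ext {a b : S} {T : V} {f g : (𝟙_ (VQuiver S V)).obj a b ⟶ T}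
    (h : ∀ e : a = b, unitι e ≫ f = unitι e ≫ g) : f = g :=
  Sigma.hom_ext _ _ fun e => h e.down.down

lemma unit_tensor_hom_ext {a b : S} {B T : V} {f g : (𝟙_ (VQuiver S V)).obj a b ⊗ B ⟶ T}
    (h : ∀ e : a = b, unitι e ▷ B ≫ f = unitι e ▷ B ≫ g) : f = g :=
  sigmaTensor_hom_ext fun e => h e.down.down

lemma tensor_unit_hom_ext {a b : S} {B T : V} {f g : B ⊗ (𝟙_ (VQuiver S V)).obj a b ⟶ T}
    (h : ∀ e : a = b, B ◁ unitι e ≫ f = B ◁ unitι e ≫ g) : f = g :=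
  tensorSigma_hom_ext fun e => h e.down.down

lemma tensor_tensor_hom_ext {Q P : VQuiver S V} {a b : S} {B T : V}
    {f g : (Q ⊗ P).obj a b ⊗ B ⟶ T}
    (h : ∀ c, ι Q P a b c ▷ B ≫ f = ι Q P a b c ▷ B ≫ g) : f = g :=
  sigmaTensor_hom_ext h

@[simp]
lemma ι_tensorHom {Q Q' P P' : VQuiver S V} (f : Q ⟶ Q') (g : P ⟶ P') (a b c : S) :
    ι Q P a b c ≫ (f ⊗ₘ g).app a b = (f.app a c ⊗ₘ g.app c b) ≫ ι Q' P' a b c :=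
  Limits.Sigma.ι_map (fun c => f.app a c ⊗ₘ g.app c b) c

@[simp]
lemma ι_tensorHom_assoc {Q Q' P P' : VQuiver S V} (f : Q ⟶ Q') (g : P ⟶ P') (a b c : S) {Z : V} (t : _ ⟶ Z) :
    ι Q P a b c ≫ (f ⊗ₘ g).app a b ≫ t =
      (f.app a c ⊗ₘ g.app c b) ≫ ι Q' P' a b c ≫ t := by
  simpa only [Category.assoc, Category.id_comp] using eq_whisker (ι_tensorHom f g a b c) t

@[simp]
lemma ι_whiskerLeft (Q : VQuiver S V) {P P' : VQuiver S V} (g : P ⟶ P') (a b c : S) :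
    ι Q P a b c ≫ (Q ◁ g).app a b = Q.obj a c ◁ g.app c b ≫ ι Q P' a b c :=
  Limits.Sigma.ι_map (fun c => Q.obj a c ◁ g.app c b) c

@[simp]
lemma ι_whiskerLeft_assoc (Q : VQuiver S V) {P P' : VQuiver S V} (g : P ⟶ P') (a b c : S) {Z : V} (t : _ ⟶ Z) :
    ι Q P a b c ≫ (Q ◁ g).app a b ≫ t =
      Q.obj a c ◁ g.app c b ≫ ι Q P' a b c ≫ t := by
  simpa only [Category.assoc, Category.id_comp] using eq_whisker (ι_whiskerLeft Q g a b c) t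

@[simp]
lemma ι_whiskerRight {Q Q' : VQuiver S V} (f : Q ⟶ Q') (P : VQuiver S V) (a b c : S) :
    ι Q P a b c ≫ (f ▷ P).app a b = f.app a c ▷ P.obj c b ≫ ι Q' P a b c :=
  Limits.Sigma.ι_map (fun c => f.app a c ▷ P.obj c b) c

@[simp]
lemma ι_whiskerRight_assoc {Q Q' : VQuiver S V} (f : Q ⟶ Q') (P : VQuiver S V) (a b c : S) {Z : V} (t : _ ⟶ Z) :
    ι Q P a b c ≫ (f ▷ P).app a b ≫ t =
      f.app a c ▷ P.obj c b ≫ ι Q' P a b c ≫ t := by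
  simpa only [Category.assoc, Category.id_comp] using eq_whisker (ι_whiskerRight f P a b c) t

@[simp]
lemma ι_associator_hom (Q P R : VQuiver S V) (a b c d : S) :
    ι Q P a c d ▷ R.obj c b ≫ ι (Q ⊗ P) R a b c ≫ (α_ Q P R).hom.app a b =
      (α_ _ _ _).hom ≫ Q.obj a d ◁ ι P R d b c ≫ ι Q (P ⊗ R) a b d :=
  (whisker_eq (ι Q P a c d ▷ R.obj c b) (Sigma.ι_desc _ c)).trans (ι_sigmaTensorDesc _ d)

@[simp]
lemma ι_associator_hom_assoc (Q P R : VQuiver S V) (a b c d : S) {Z : V} (t : _ ⟶ Z) :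
    ι Q P a c d ▷ R.obj c b ≫ ι (Q ⊗ P) R a b c ≫ (α_ Q P R).hom.app a b ≫ t =
      (α_ _ _ _).hom ≫ Q.obj a d ◁ ι P R d b c ≫ ι Q (P ⊗ R) a b d ≫ t := by
  simpa only [Category.assoc, Category.id_comp] using eq_whisker (ι_associator_hom Q P R a b c d) t

@[simp]
lemma ι_associator_inv (Q P R : VQuiver S V) (a b c d : S) :
    Q.obj a d ◁ ι P R d b c ≫ ι Q (P ⊗ R) a b d ≫ (α_ Q P R).inv.app a b =
      (α_ _ _ _).inv ≫ ι Q P a c d ▷ R.obj c b ≫ ι (Q ⊗ P) R a b c :=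
  (whisker_eq (Q.obj a d ◁ ι P R d b c) (Sigma.ι_desc _ d)).trans (ι_tensorSigmaDesc _ c)

@[simp]
lemma ι_associator_inv_assoc (Q P R : VQuiver S V) (a b c d : S) {Z : V} (t : _ ⟶ Z) :
    Q.obj a d ◁ ι P R d b c ≫ ι Q (P ⊗ R) a b d ≫ (α_ Q P R).inv.app a b ≫ t =
      (α_ _ _ _).inv ≫ ι Q P a c d ▷ R.obj c b ≫ ι (Q ⊗ P) R a b c ≫ t := by
  simpa only [Category.assoc, Category.id_comp] using eq_whisker (ι_associator_inv Q P R a b c d) t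

@[simp]
lemma ι_leftUnitor_hom (Q : VQuiver S V) (a b : S) :
    unitι (V := V) rfl ▷ Q.obj a b ≫ ι (𝟙_ (VQuiver S V)) Q a b a ≫ (λ_ Q).hom.app a b =
      (λ_ _).hom :=
  ((whisker_eq (unitι (V := V) rfl ▷ Q.obj a b) (Sigma.ι_desc _ a)).trans
    (ι_sigmaTensorDesc _ (⟨⟨rfl⟩⟩ : ULift.{u} (PLift (a = a))))).trans (Category.comp_id _)

@[simp]
lemma ι_leftUnitor_hom_assoc (Q : VQuiver S V) (a b : S) {Z : V} (t : _ ⟶ Z) :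
    unitι (V := V) rfl ▷ Q.obj a b ≫ ι (𝟙_ (VQuiver S V)) Q a b a ≫ (λ_ Q).hom.app a b ≫ t =
      (λ_ _).hom ≫ t := by
  simpa only [Category.assoc, Category.id_comp] using eq_whisker (ι_leftUnitor_hom Q a b) t

@[simp]
lemma ι_rightUnitor_hom (Q : VQuiver S V) (a b : S) :
    Q.obj a b ◁ unitι (V := V) rfl ≫ ι Q (𝟙_ (VQuiver S V)) a b b ≫ (ρ_ Q).hom.app a b =
      (ρ_ _).hom :=
  ((whisker_eq (Q.obj a b ◁ unitι (V := V) rfl) (Sigma.ι_desc _ b)).trans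
    (ι_tensorSigmaDesc _ (⟨⟨rfl⟩⟩ : ULift.{u} (PLift (b = b))))).trans (Category.comp_id _)

@[simp]
lemma ι_rightUnitor_hom_assoc (Q : VQuiver S V) (a b : S) {Z : V} (t : _ ⟶ Z) :
    Q.obj a b ◁ unitι (V := V) rfl ≫ ι Q (𝟙_ (VQuiver S V)) a b b ≫ (ρ_ Q).hom.app a b ≫ t =
      (ρ_ _).hom ≫ t := by
  simpa only [Category.assoc, Category.id_comp] using eq_whisker (ι_rightUnitor_hom Q a b) t

lemma leftUnitor_inv_app (Q : VQuiver S V) (a b : S) :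
    (λ_ Q).inv.app a b =
      (λ_ _).inv ≫ unitι (V := V) rfl ▷ Q.obj a b ≫ ι (𝟙_ (VQuiver S V)) Q a b a := rfl

lemma rightUnitor_inv_app (Q : VQuiver S V) (a b : S) :
    (ρ_ Q).inv.app a b =
      (ρ_ _).inv ≫ Q.obj a b ◁ unitι (V := V) rfl ≫ ι Q (𝟙_ (VQuiver S V)) a b b := rfl

/-- The monoidal structure on the category of `V`-quivers on `S`. -/
noncomputable instance : MonoidalCategory (VQuiver S V) where
  tensorHom_def f g := by
    ext a b
    refine tensor_hom_ext fun c => ?_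
    simp [MonoidalCategory.tensorHom_def]
  id_tensorHom_id Q P := by
    ext a b
    refine tensor_hom_ext fun c => ?_
    rw [ι_tensorHom, id_app, id_app, id_app, id_tensorHom_id]
    exact (Category.id_comp _).trans (Category.comp_id _).symm
  tensorHom_comp_tensorHom f g f' g' := by
    ext a b
    refine tensor_hom_ext fun c => ?_
    simp
  whiskerLeft_id Q P := by
    ext a b
    refine tensor_hom_ext fun c => ?_
    rw [ι_whiskerLeft, id_app, id_app, MonoidalCategory.whiskerLeft_id]
    exact (Category.id_comp _).trans (Category.comp_id _).symm
  id_whiskerRight Q P := by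
    ext a b
    refine tensor_hom_ext fun c => ?_
    rw [ι_whiskerRight, id_app, id_app, MonoidalCategory.id_whiskerRight]
    exact (Category.id_comp _).trans (Category.comp_id _).symm
  associator_naturality {Q P R Q' P' R'} f g h := by
    ext a b
    refine tensor_hom_ext fun c => tensor_tensor_hom_ext fun d => ?_
    have h1 : ι Q P a c d ▷ R.obj c b ≫ ((f ⊗ₘ g).app a c ⊗ₘ h.app c b) =
        ((f.app a d ⊗ₘ g.app d c) ⊗ₘ h.app c b) ≫ ι Q' P' a c d ▷ R'.obj c b := by
      rw [← tensorHom_id, ← tensorHom_id, tensorHom_comp_tensorHom, tensorHom_comp_tensorHom,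
        ι_tensorHom, Category.id_comp, Category.comp_id]
    have h2 : Q.obj a d ◁ ι P R d b c ≫ (f.app a d ⊗ₘ (g ⊗ₘ h).app d b) =
        (f.app a d ⊗ₘ (g.app d c ⊗ₘ h.app c b)) ≫ Q'.obj a d ◁ ι P' R' d b c := by
      rw [← id_tensorHom, ← id_tensorHom, tensorHom_comp_tensorHom, tensorHom_comp_tensorHom,
        ι_tensorHom, Category.id_comp, Category.comp_id]
    simp only [comp_app, ι_tensorHom_assoc, ι_associator_hom_assoc, ι_tensorHom]
    rw [reassoc_of% h1, reassoc_of% h2, ι_associator_hom, associator_naturality_assoc]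
  leftUnitor_naturality {Q Q'} f := by
    ext a b
    refine tensor_hom_ext fun c => unit_tensor_hom_ext fun e => ?_
    subst e
    simp only [comp_app, ι_whiskerLeft_assoc, ι_leftUnitor_hom_assoc]
    rw [← whisker_exchange_assoc, ι_leftUnitor_hom, leftUnitor_naturality]
  rightUnitor_naturality {Q Q'} f := by
    ext a b
    refine tensor_hom_ext fun c => tensor_unit_hom_ext fun e => ?_
    subst e
    simp only [comp_app, ι_whiskerRight_assoc, ι_rightUnitor_hom_assoc]
    rw [whisker_exchange_assoc, ι_rightUnitor_hom, rightUnitor_naturality]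
  pentagon W X Y Z := by
    ext a b
    refine tensor_hom_ext fun c => tensor_tensor_hom_ext fun d => ?_
    refine mapSigma_hom_ext (tensorRight _ ⋙ tensorRight _) fun e => ?_
    change (ι W X a d e ▷ Y.obj d c) ▷ Z.obj c b ≫ _ = (ι W X a d e ▷ Y.obj d c) ▷ Z.obj c b ≫ _
    simp only [comp_app, ι_whiskerRight_assoc, ι_associator_hom_assoc]
    rw [← comp_whiskerRight_assoc, ← comp_whiskerRight_assoc, Category.assoc, ι_associator_hom]
    rw [associator_naturality_left_assoc, ← whisker_exchange_assoc, ι_associator_hom]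
    simp only [comp_whiskerRight_assoc, Category.assoc, whisker_assoc,
      Iso.inv_hom_id_assoc, ι_associator_hom_assoc, ι_whiskerLeft]
    rw [← whiskerLeft_comp_assoc, ← whiskerLeft_comp_assoc, Category.assoc, ι_associator_hom]
    simp
  triangle X Y := by
    ext a b
    refine tensor_hom_ext fun c => tensor_tensor_hom_ext fun d => ?_
    refine mapSigma_hom_ext (tensorLeft _ ⋙ tensorRight _) fun e => ?_
    obtain ⟨⟨rfl⟩⟩ := e
    change (X.obj a d ◁ unitι rfl) ▷ Y.obj d b ≫ _ = (X.obj a d ◁ unitι rfl) ▷ Y.obj d b ≫ _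
    simp only [comp_app, ι_whiskerRight, ι_associator_hom_assoc, ι_whiskerLeft]
    rw [← comp_whiskerRight_assoc, ← comp_whiskerRight_assoc, Category.assoc, ι_rightUnitor_hom,
      associator_naturality_middle_assoc,
      ← whiskerLeft_comp_assoc, ← whiskerLeft_comp_assoc, Category.assoc, ι_leftUnitor_hom,
      triangle_assoc]

/-! ### Change of base set -/

variable {T : Type u} {R : Type u}

/-- The pullback `f^* Q` of a quiver along a map of sets. -/
def pullback (f : S → T) : VQuiver T V ⥤ VQuiver S V where
  obj Q := ⟨fun a b => Q.obj (f a) (f b)⟩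
  map g := ⟨fun a b => g.app (f a) (f b)⟩

/-- The canonical morphism `I ⟶ f^* I`. -/
noncomputable def pullbackUnit (f : S → T) :
    𝟙_ (VQuiver S V) ⟶ (pullback f).obj (𝟙_ (VQuiver T V)) :=
  ⟨fun _ _ => unitDesc fun h => unitι (congrArg f h)⟩

/-- The canonical morphism `f^* Q ⊗ f^* P ⟶ f^* (Q ⊗ P)`. -/
noncomputable def pullbackTensor (f : S → T) (Q P : VQuiver T V) :
    (pullback f).obj Q ⊗ (pullback f).obj P ⟶ (pullback f).obj (Q ⊗ P) :=
  ⟨fun a b => desc fun c => ι Q P (f a) (f b) (f c)⟩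

@[simp]
lemma unitι_pullbackUnit (f : S → T) {a b : S} (h : a = b) :
    unitι h ≫ (pullbackUnit (V := V) f).app a b = unitι (congrArg f h) :=
  unitι_unitDesc (fun h => unitι (V := V) (congrArg f h)) h

@[simp]
lemma unitι_pullbackUnit_assoc (f : S → T) {a b : S} (h : a = b) {Z : V}
    (t : ((pullback f).obj (𝟙_ (VQuiver T V))).obj a b ⟶ Z) :
    unitι h ≫ (pullbackUnit (V := V) f).app a b ≫ t =
      CategoryStruct.comp (Y := ((pullback f).obj (𝟙_ (VQuiver T V))).obj a b)
        (unitι (congrArg f h)) t := by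
  exact (Category.assoc _ _ _).symm.trans (eq_whisker (unitι_pullbackUnit f h) t)

@[simp]
lemma ι_pullbackTensor (f : S → T) (Q P : VQuiver T V) (a b c : S) :
    ι ((pullback f).obj Q) ((pullback f).obj P) a b c ≫ (pullbackTensor f Q P).app a b =
      ι Q P (f a) (f b) (f c) :=
  ι_desc _ c

@[simp]
lemma ι_pullbackTensor_assoc (f : S → T) (Q P : VQuiver T V) (a b c : S) {Z : V}
    (t : ((pullback f).obj (Q ⊗ P)).obj a b ⟶ Z) :
    ι ((pullback f).obj Q) ((pullback f).obj P) a b c ≫ (pullbackTensor f Q P).app a b ≫ t =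
      CategoryStruct.comp (Y := ((pullback f).obj (Q ⊗ P)).obj a b)
        (ι Q P (f a) (f b) (f c)) t := by
  exact (Category.assoc _ _ _).symm.trans (eq_whisker (ι_pullbackTensor f Q P a b c) t)

/-- The lax monoidal structure of `f^*`. -/
noncomputable instance (f : S → T) : (pullback (V := V) f).LaxMonoidal where
  ε := pullbackUnit f
  μ := pullbackTensor f
  μ_natural_left g P := by
    ext a b
    refine tensor_hom_ext fun c => ?_
    simp only [comp_app, ι_whiskerRight_assoc, ι_pullbackTensor, ι_pullbackTensor_assoc]
    exact (ι_whiskerRight g P (f a) (f b) (f c)).symm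
  μ_natural_right Q g := by
    ext a b
    refine tensor_hom_ext fun c => ?_
    simp only [comp_app, ι_whiskerLeft_assoc, ι_pullbackTensor, ι_pullbackTensor_assoc]
    exact (ι_whiskerLeft Q g (f a) (f b) (f c)).symm
  associativity P Q R := by
    ext a b
    refine tensor_hom_ext fun c => tensor_tensor_hom_ext fun d => ?_
    simp only [comp_app, ι_whiskerRight_assoc, ι_pullbackTensor, ι_pullbackTensor_assoc,
      ι_associator_hom_assoc, ι_whiskerLeft_assoc]
    erw [← comp_whiskerRight_assoc]
    rw [ι_pullbackTensor]
    erw [← whiskerLeft_comp_assoc]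
    rw [ι_pullbackTensor]
    exact ι_associator_hom P Q R (f a) (f b) (f c) (f d)
  left_unitality Q := by
    ext a b
    refine tensor_hom_ext fun c => unit_tensor_hom_ext fun e => ?_
    subst e
    simp only [comp_app, ι_whiskerRight_assoc, ι_pullbackTensor_assoc]
    erw [← comp_whiskerRight_assoc]
    rw [unitι_pullbackUnit, ι_leftUnitor_hom]
    exact (ι_leftUnitor_hom Q (f a) (f b)).symm
  right_unitality Q := by
    ext a b
    refine tensor_hom_ext fun c => tensor_unit_hom_ext fun e => ?_
    subst e
    simp only [comp_app, ι_whiskerLeft_assoc, ι_pullbackTensor_assoc]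
    erw [← whiskerLeft_comp_assoc]
    rw [unitι_pullbackUnit, ι_rightUnitor_hom]
    exact (ι_rightUnitor_hom Q (f a) (f c)).symm

/-! ### Change of enriching category -/

section ChangeOfBase

variable {U : Type w'} [Category.{u} U] [MonoidalCategory U] [TensorCocomplete U]
  (H : U ⥤ V)

/-- The functor on quivers induced by a functor `H`. -/
def mapQuiver (S : Type u) : VQuiver S U ⥤ VQuiver S V where
  obj Q := ⟨fun a b => H.obj (Q.obj a b)⟩
  map g := ⟨fun a b => H.map (g.app a b)⟩

variable [H.OplaxMonoidal] [∀ J : Type u, PreservesColimitsOfShape (Discrete J) H]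

open Functor.OplaxMonoidal

/-- The counit of the colax structure of `mapQuiver H S`, induced by the counit of `H`. -/
noncomputable def mapQuiverUnit (S : Type u) :
    (mapQuiver H S).obj (𝟙_ (VQuiver S U)) ⟶ 𝟙_ (VQuiver S V) :=
  ⟨fun a b => mapSigmaDesc H fun h : ULift.{u} (PLift (a = b)) => η H ≫ unitι h.down.down⟩

/-- The comultiplication of the colax structure of `mapQuiver H S`, induced by the one of `H`. -/
noncomputable def mapQuiverTensor (Q P : VQuiver S U) :
    (mapQuiver H S).obj (Q ⊗ P) ⟶ (mapQuiver H S).obj Q ⊗ (mapQuiver H S).obj P :=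
  ⟨fun a b => mapSigmaDesc H fun c =>
    δ H (Q.obj a c) (P.obj c b) ≫ ι ((mapQuiver H S).obj Q) ((mapQuiver H S).obj P) a b c⟩

lemma map_unitι_mapQuiverUnit {a b : S} (h : a = b) :
    H.map (unitι h) ≫ (mapQuiverUnit H S).app a b = η H ≫ unitι h :=
  map_ι_mapSigmaDesc H _ (⟨⟨h⟩⟩ : ULift.{u} (PLift (a = b)))

lemma map_ι_mapQuiverTensor (Q P : VQuiver S U) (a b c : S) :
    H.map (ι Q P a b c) ≫ (mapQuiverTensor H Q P).app a b =
      δ H _ _ ≫ ι ((mapQuiver H S).obj Q) ((mapQuiver H S).obj P) a b c :=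
  map_ι_mapSigmaDesc H _ c

lemma map_ι_mapQuiverTensor_assoc (Q P : VQuiver S U) (a b c : S) {T : V}
    (t : ((mapQuiver H S).obj Q ⊗ (mapQuiver H S).obj P).obj a b ⟶ T) :
    H.map (ι Q P a b c) ≫ (mapQuiverTensor H Q P).app a b ≫ t =
      δ H _ _ ≫ ι ((mapQuiver H S).obj Q) ((mapQuiver H S).obj P) a b c ≫ t :=
  (Category.assoc _ _ _).symm.trans
    ((eq_whisker (map_ι_mapQuiverTensor H Q P a b c) t).trans (Category.assoc _ _ _))

/-- The colax monoidal structure on the functor on quivers induced by the one of `H`. -/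
noncomputable instance : (mapQuiver H S).OplaxMonoidal where
  η := mapQuiverUnit H S
  δ := mapQuiverTensor H
  δ_natural_left {Q Q'} g P := by
    ext a b
    refine mapSigma_hom_ext H fun c => ?_
    refine (map_ι_mapQuiverTensor_assoc H Q P a b c _).trans ?_
    erw [ι_whiskerRight]
    refine (δ_natural_left_assoc H (g.app a c) (P.obj c b) _).trans ?_
    have e : H.map (g.app a c ▷ P.obj c b) ≫ H.map (ι Q' P a b c) =
        H.map (ι Q P a b c) ≫ H.map ((g ▷ P).app a b) := by
      rw [← H.map_comp, ← H.map_comp, ι_whiskerRight]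
    refine (whisker_eq (H.map (g.app a c ▷ P.obj c b))
      (map_ι_mapQuiverTensor H Q' P a b c)).symm.trans ?_
    exact (Category.assoc _ _ _).symm.trans ((eq_whisker e _).trans (Category.assoc _ _ _))
  δ_natural_right {Q Q'} P g := by
    ext a b
    refine mapSigma_hom_ext H fun c => ?_
    refine (map_ι_mapQuiverTensor_assoc H P Q a b c _).trans ?_
    erw [ι_whiskerLeft]
    refine (δ_natural_right_assoc H (P.obj a c) (g.app c b) _).trans ?_
    have e : H.map (P.obj a c ◁ g.app c b) ≫ H.map (ι P Q' a b c) =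
        H.map (ι P Q a b c) ≫ H.map ((P ◁ g).app a b) := by
      rw [← H.map_comp, ← H.map_comp, ι_whiskerLeft]
    refine (whisker_eq (H.map (P.obj a c ◁ g.app c b))
      (map_ι_mapQuiverTensor H P Q' a b c)).symm.trans ?_
    exact (Category.assoc _ _ _).symm.trans ((eq_whisker e _).trans (Category.assoc _ _ _))
  oplax_associativity Q P R := by
    ext a b
    refine mapSigma_hom_ext H fun c => mapSigma_hom_ext (tensorRight _ ⋙ H) fun d => ?_
    have e1 : H.map (ι Q P a c d ▷ R.obj c b) ≫ H.map (ι (Q ⊗ P) R a b c) ≫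
        (mapQuiverTensor H (Q ⊗ P) R).app a b ≫
          (mapQuiverTensor H Q P ▷ (mapQuiver H S).obj R).app a b ≫
            (α_ ((mapQuiver H S).obj Q) ((mapQuiver H S).obj P) ((mapQuiver H S).obj R)).hom.app a b
        = δ H (Q.obj a d ⊗ P.obj d c) (R.obj c b) ≫ δ H (Q.obj a d) (P.obj d c) ▷ H.obj (R.obj c b) ≫
          (α_ _ _ _).hom ≫ H.obj (Q.obj a d) ◁ ι ((mapQuiver H S).obj P) ((mapQuiver H S).obj R) d b c ≫
          ι ((mapQuiver H S).obj Q) ((mapQuiver H S).obj P ⊗ (mapQuiver H S).obj R) a b d := by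
      erw [map_ι_mapQuiverTensor_assoc, ι_whiskerRight_assoc]
      refine (δ_natural_left_assoc H (ι Q P a c d) (R.obj c b) _).symm.trans ?_
      refine whisker_eq _ ?_
      refine (comp_whiskerRight_assoc _ _ _ _).symm.trans ?_
      rw [map_ι_mapQuiverTensor]
      refine (comp_whiskerRight_assoc _ _ _ _).trans (whisker_eq _ ?_)
      exact ι_associator_hom ((mapQuiver H S).obj Q) ((mapQuiver H S).obj P) ((mapQuiver H S).obj R)
        a b c d
    have e2 : H.map (ι Q P a c d ▷ R.obj c b) ≫ H.map (ι (Q ⊗ P) R a b c) ≫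
        H.map ((α_ Q P R).hom.app a b) ≫ (mapQuiverTensor H Q (P ⊗ R)).app a b ≫
          ((mapQuiver H S).obj Q ◁ mapQuiverTensor H P R).app a b
        = H.map (α_ (Q.obj a d) (P.obj d c) (R.obj c b)).hom ≫
          δ H (Q.obj a d) (P.obj d c ⊗ R.obj c b) ≫ H.obj (Q.obj a d) ◁ δ H (P.obj d c) (R.obj c b) ≫
           H.obj (Q.obj a d) ◁ ι ((mapQuiver H S).obj P) ((mapQuiver H S).obj R) d b c ≫
          ι ((mapQuiver H S).obj Q) ((mapQuiver H S).obj P ⊗ (mapQuiver H S).obj R) a b d := by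
      rw [← H.map_comp_assoc, ← H.map_comp_assoc, Category.assoc, ι_associator_hom, H.map_comp_assoc,
        H.map_comp_assoc]
      erw [map_ι_mapQuiverTensor_assoc, ι_whiskerLeft]
      refine whisker_eq _ ?_
      refine (δ_natural_right_assoc H (Q.obj a d) (ι P R d b c) _).symm.trans ?_
      refine whisker_eq _ ?_
      refine (whiskerLeft_comp_assoc _ _ _ _).symm.trans ?_
      rw [map_ι_mapQuiverTensor]
      exact whiskerLeft_comp_assoc _ _ _ _
    refine e1.trans (Eq.trans ?_ e2.symm)
    exact associativity_assoc H (Q.obj a d) (P.obj d c) (R.obj c b) _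
  oplax_left_unitality Q := by
    ext a b
    have e : H.map ((λ_ Q).inv.app a b) ≫ (mapQuiverTensor H (𝟙_ _) Q).app a b ≫
        (mapQuiverUnit H S ▷ (mapQuiver H S).obj Q).app a b =
        H.map (λ_ (Q.obj a b)).inv ≫ δ H (𝟙_ U) (Q.obj a b) ≫ η H ▷ H.obj (Q.obj a b) ≫
          unitι (V := V) rfl ▷ H.obj (Q.obj a b) ≫ ι (𝟙_ _) ((mapQuiver H S).obj Q) a b a := by
      rw [leftUnitor_inv_app, H.map_comp_assoc, H.map_comp_assoc]
      erw [map_ι_mapQuiverTensor_assoc, ι_whiskerRight]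
      refine whisker_eq _ ?_
      refine (δ_natural_left_assoc H (unitι rfl) (Q.obj a b) _).symm.trans ?_
      refine whisker_eq _ ?_
      refine (comp_whiskerRight_assoc _ _ _ _).symm.trans ?_
      rw [map_unitι_mapQuiverUnit]
      exact comp_whiskerRight_assoc _ _ _ _
    refine Eq.trans ?_ e.symm
    rw [leftUnitor_inv_app]
    exact (left_unitality_assoc H (Q.obj a b) _)
  oplax_right_unitality Q := by
    ext a b
    have e : H.map ((ρ_ Q).inv.app a b) ≫ (mapQuiverTensor H Q (𝟙_ _)).app a b ≫
        ((mapQuiver H S).obj Q ◁ mapQuiverUnit H S).app a b =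
        H.map (ρ_ (Q.obj a b)).inv ≫ δ H (Q.obj a b) (𝟙_ U) ≫ H.obj (Q.obj a b) ◁ η H ≫
          H.obj (Q.obj a b) ◁ unitι (V := V) rfl ≫ ι ((mapQuiver H S).obj Q) (𝟙_ _) a b b := by
      rw [rightUnitor_inv_app, H.map_comp_assoc, H.map_comp_assoc]
      erw [map_ι_mapQuiverTensor_assoc, ι_whiskerLeft]
      refine whisker_eq _ ?_
      refine (δ_natural_right_assoc H (Q.obj a b) (unitι rfl) _).symm.trans ?_
      refine whisker_eq _ ?_
      refine (whiskerLeft_comp_assoc _ _ _ _).symm.trans ?_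
      rw [map_unitι_mapQuiverUnit]
      exact whiskerLeft_comp_assoc _ _ _ _
    refine Eq.trans ?_ e.symm
    rw [rightUnitor_inv_app]
    exact (right_unitality_assoc H (Q.obj a b) _)

end ChangeOfBase

end VQuiver

/-! ### The free functor -/

section Free

open Functor.OplaxMonoidal

/-- The free functor `F : Set ⥤ V`, `A ↦ ∐ (_ ∈ A), I`. -/
noncomputable def freeFunctor (V : Type w) [Category.{u} V] [MonoidalCategory V]
    [TensorCocomplete V] : Type u ⥤ V :=
  sigmaConst.obj (𝟙_ V)

variable {V : Type w} [Category.{u} V] [MonoidalCategory V] [TensorCocomplete V]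

instance : PreservesColimits (freeFunctor V) :=
  (sigmaConstAdj (𝟙_ V)).leftAdjoint_preservesColimits

/-- The generator of the free object on `A` that belongs to an element of `A`. -/
noncomputable def freeι {A : Type u} (x : A) : 𝟙_ V ⟶ (freeFunctor V).obj A :=
  Sigma.ι (fun _ : A => 𝟙_ V) x

/-- The morphism out of a free object with given values on generators. -/
noncomputable def freeDesc {A : Type u} {T : V} (φ : A → (𝟙_ V ⟶ T)) :
    (freeFunctor V).obj A ⟶ T :=
  Sigma.desc φ

@[simp]
lemma freeι_freeDesc {A : Type u} {T : V} (φ : A → (𝟙_ V ⟶ T)) (x : A) :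
    freeι x ≫ freeDesc φ = φ x :=
  Sigma.ι_desc _ _

@[simp]
lemma freeι_freeDesc_assoc {A : Type u} {T : V} (φ : A → (𝟙_ V ⟶ T)) (x : A) {Z : V} (t : _ ⟶ Z) :
    freeι x ≫ freeDesc φ ≫ t =
      φ x ≫ t := by
  simpa only [Category.assoc, Category.id_comp] using eq_whisker (freeι_freeDesc φ x) t

@[simp]
lemma freeι_map {A B : Type u} (f : A ⟶ B) (x : A) :
    freeι x ≫ (freeFunctor V).map f = freeι (f x) := by
  simp [freeι, freeFunctor]

@[simp]
lemma freeι_map_assoc {A B : Type u} (f : A ⟶ B) (x : A) {Z : V} (t : _ ⟶ Z) :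
    freeι x ≫ (freeFunctor V).map f ≫ t =
      freeι (f x) ≫ t := by
  simpa only [Category.assoc, Category.id_comp] using eq_whisker (freeι_map f x) t

lemma free_hom_ext {A : Type u} {T : V} {f g : (freeFunctor V).obj A ⟶ T}
    (h : ∀ x : A, freeι x ≫ f = freeι x ≫ g) : f = g :=
  Sigma.hom_ext _ _ h

lemma free_tensor_hom_ext {A : Type u} {B T : V} {f g : (freeFunctor V).obj A ⊗ B ⟶ T}
    (h : ∀ x : A, freeι x ▷ B ≫ f = freeι x ▷ B ≫ g) : f = g :=
  sigmaTensor_hom_ext h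

lemma tensor_free_hom_ext {A : Type u} {B T : V} {f g : B ⊗ (freeFunctor V).obj A ⟶ T}
    (h : ∀ x : A, B ◁ freeι x ≫ f = B ◁ freeι x ≫ g) : f = g :=
  tensorSigma_hom_ext h

/-- The counit of the monoidal structure of the free functor. -/
noncomputable def freeUnit (V : Type w) [Category.{u} V] [MonoidalCategory V]
    [TensorCocomplete V] : (freeFunctor V).obj (𝟙_ (Type u)) ⟶ 𝟙_ V :=
  freeDesc fun _ => 𝟙 _

/-- The comultiplication of the monoidal structure of the free functor, which sends the generator
of `(x, y)` to the tensor product of the generators of `x` and `y`. -/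
noncomputable def freeTensor (V : Type w) [Category.{u} V] [MonoidalCategory V]
    [TensorCocomplete V] (A B : Type u) :
    (freeFunctor V).obj (A ⊗ B) ⟶ (freeFunctor V).obj A ⊗ (freeFunctor V).obj B :=
  freeDesc fun p : A × B => (λ_ (𝟙_ V)).inv ≫ (freeι p.1 ⊗ₘ freeι p.2)

@[simp]
lemma freeι_freeUnit (x : 𝟙_ (Type u)) : freeι x ≫ freeUnit V = 𝟙 _ :=
  freeι_freeDesc _ _

@[simp]
lemma freeι_freeUnit_assoc (x : 𝟙_ (Type u)) {Z : V} (t : _ ⟶ Z) :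
    freeι x ≫ freeUnit V ≫ t =
      t := by
  simpa only [Category.assoc, Category.id_comp] using eq_whisker (freeι_freeUnit x) t

@[simp]
lemma freeι_freeTensor {A B : Type u} (p : (A ⊗ B : Type u)) :
    freeι p ≫ freeTensor V A B = (λ_ (𝟙_ V)).inv ≫ (freeι p.1 ⊗ₘ freeι p.2) :=
  freeι_freeDesc _ _

@[simp]
lemma freeι_freeTensor_assoc {A B : Type u} (p : (A ⊗ B : Type u)) {Z : V} (t : _ ⟶ Z) :
    freeι p ≫ freeTensor V A B ≫ t =
      (λ_ (𝟙_ V)).inv ≫ (freeι p.1 ⊗ₘ freeι p.2) ≫ t := by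
  simpa only [Category.assoc, Category.id_comp] using eq_whisker (freeι_freeTensor p) t

noncomputable instance : (freeFunctor V).OplaxMonoidal where
  η := freeUnit V
  δ := freeTensor V
  δ_natural_left f B := by
    refine free_hom_ext fun p => ?_
    simp only [freeι_freeTensor_assoc, freeι_map_assoc, freeι_freeTensor,
      ← tensorHom_id, tensorHom_comp_tensorHom, freeι_map, Category.comp_id]
    rfl
  δ_natural_right B f := by
    refine free_hom_ext fun p => ?_
    simp only [freeι_freeTensor_assoc, freeι_map_assoc, freeι_freeTensor,
      ← id_tensorHom, tensorHom_comp_tensorHom, freeι_map, Category.comp_id]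
    rfl
  oplax_associativity A B C := by
    refine free_hom_ext fun p => ?_
    obtain ⟨⟨x, y⟩, z⟩ := p
    have e1 : freeι (V := V) (A := (A ⊗ B) ⊗ C) ((x, y), z) ≫ freeTensor V (A ⊗ B) C ≫
        freeTensor V A B ▷ (freeFunctor V).obj C ≫ (α_ _ _ _).hom =
        (λ_ _).inv ≫ (λ_ _).inv ▷ _ ≫ ((freeι x ⊗ₘ freeι y) ⊗ₘ freeι z) ≫ (α_ _ _ _).hom := by
      rw [freeι_freeTensor_assoc]
      simp only [← tensorHom_id, tensorHom_comp_tensorHom_assoc, freeι_freeTensor,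
        Category.comp_id, Category.id_comp]
    have e2 : freeι (V := V) (A := (A ⊗ B) ⊗ C) ((x, y), z) ≫
        (freeFunctor V).map (α_ A B C).hom ≫ freeTensor V A (B ⊗ C) ≫
        (freeFunctor V).obj A ◁ freeTensor V B C =
        (λ_ _).inv ≫ _ ◁ (λ_ _).inv ≫ (freeι x ⊗ₘ (freeι y ⊗ₘ freeι z)) := by
      rw [freeι_map_assoc]
      refine (freeι_freeTensor_assoc (A := A) (B := B ⊗ C) (x, (y, z)) _).trans ?_
      simp only [← id_tensorHom, tensorHom_comp_tensorHom, Category.comp_id, Category.id_comp]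
      rw [freeι_freeTensor]
    refine e1.trans (Eq.trans ?_ e2.symm)
    rw [associator_naturality]
    monoidal
  oplax_left_unitality A := by
    refine free_hom_ext fun x => ?_
    have e : freeι x ≫ (freeFunctor V).map (λ_ A).inv ≫ freeTensor V (𝟙_ _) A ≫
        freeUnit V ▷ (freeFunctor V).obj A =
        (λ_ (𝟙_ V)).inv ≫ _ ◁ freeι x := by
      rw [freeι_map_assoc]
      refine (freeι_freeTensor_assoc (A := 𝟙_ (Type u)) (B := A) (PUnit.unit, x) _).trans ?_
      simp only [← tensorHom_id, tensorHom_comp_tensorHom, Category.comp_id, freeι_freeUnit]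
      rw [id_tensorHom]
    refine Eq.trans ?_ e.symm
    exact leftUnitor_inv_naturality _
  oplax_right_unitality A := by
    refine free_hom_ext fun x => ?_
    have e : freeι x ≫ (freeFunctor V).map (ρ_ A).inv ≫ freeTensor V A (𝟙_ _) ≫
        (freeFunctor V).obj A ◁ freeUnit V =
        (λ_ (𝟙_ V)).inv ≫ freeι x ▷ _ := by
      rw [freeι_map_assoc]
      refine (freeι_freeTensor_assoc (A := A) (B := 𝟙_ (Type u)) (x, PUnit.unit) _).trans ?_
      simp only [← id_tensorHom, tensorHom_comp_tensorHom, Category.comp_id, freeι_freeUnit]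
      rw [tensorHom_id]
    refine Eq.trans ?_ e.symm
    rw [unitors_inv_equal]
    exact rightUnitor_inv_naturality _

instance : IsIso (η (freeFunctor V)) :=
  ⟨freeι PUnit.unit, free_hom_ext fun x => by
      change freeι x ≫ freeUnit V ≫ _ = _
      exact (freeι_freeUnit_assoc x _).trans (Category.comp_id _).symm,
    freeι_freeUnit _⟩

/-- The inverse of `freeTensor`. -/
noncomputable def freeTensorInv (V : Type w) [Category.{u} V] [MonoidalCategory V]
    [TensorCocomplete V] (A B : Type u) :
    (freeFunctor V).obj A ⊗ (freeFunctor V).obj B ⟶ (freeFunctor V).obj (A ⊗ B) :=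
  sigmaTensorDesc fun x : A => tensorSigmaDesc fun y : B =>
    (λ_ (𝟙_ V)).hom ≫ freeι ((x, y) : A × B)

lemma freeι_freeTensorInv {A B : Type u} (x : A) (y : B) :
    (freeι x ⊗ₘ freeι y) ≫ freeTensorInv V A B =
      (λ_ (𝟙_ V)).hom ≫ freeι (A := (A ⊗ B : Type u)) (x, y) := by
  have e1 : freeι x ▷ (freeFunctor V).obj B ≫ freeTensorInv V A B =
      tensorSigmaDesc fun y : B => (λ_ (𝟙_ V)).hom ≫ freeι ((x, y) : A × B) :=
    ι_sigmaTensorDesc _ x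
  have e2 : 𝟙_ V ◁ freeι y ≫ freeι x ▷ (freeFunctor V).obj B ≫ freeTensorInv V A B =
      (λ_ (𝟙_ V)).hom ≫ freeι ((x, y) : A × B) :=
    (whisker_eq _ e1).trans (ι_tensorSigmaDesc _ y)
  rw [MonoidalCategory.tensorHom_def', Category.assoc]
  exact e2

instance (A B : Type u) : IsIso (δ (freeFunctor V) A B) :=
  ⟨freeTensorInv V A B,
    free_hom_ext fun p => by
      refine (freeι_freeTensor_assoc p _).trans ?_
      rw [freeι_freeTensorInv]
      exact (Iso.inv_hom_id_assoc _ _).trans (Category.comp_id _).symm,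
    free_tensor_hom_ext fun x => tensor_free_hom_ext fun y => by
      have e : (freeι x ⊗ₘ freeι y) ≫ freeTensorInv V A B ≫ freeTensor V A B =
          freeι x ⊗ₘ freeι y := by
        rw [reassoc_of% freeι_freeTensorInv x y]
        refine (whisker_eq _ (freeι_freeTensor (A := A) (B := B) (x, y))).trans ?_
        exact Iso.hom_inv_id_assoc _ _
      rw [MonoidalCategory.tensorHom_def', Category.assoc] at e
      rw [Category.comp_id]
      exact e⟩

end Free

namespace VQuiver

lemma isIso_of_app {S : Type u} {V : Type w} [Category.{u} V] {Q P : VQuiver S V} (f : Q ⟶ P)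
    (h : ∀ a b, IsIso (f.app a b)) : IsIso f :=
  ⟨⟨fun a b => inv (f.app a b)⟩, by ext; simp, by ext; simp⟩

lemma comp_cancel {C : Type w} [Category.{u} C] {X Y Z : C} {f : X ⟶ Y} {g : Y ⟶ X}
    (h : f ≫ g = 𝟙 X) (t : X ⟶ Z) : f ≫ g ≫ t = t := by
  rw [reassoc_of% h]

open Functor.OplaxMonoidal

variable {U : Type w'} [Category.{u} U] [MonoidalCategory U] [TensorCocomplete U]
  {V : Type w} [Category.{u} V] [MonoidalCategory V] [TensorCocomplete V]
  (H : U ⥤ V) [H.OplaxMonoidal] {S : Type u}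

/-- The inverse of `mapQuiverTensor`, for strong monoidal functors. -/
noncomputable def mapQuiverTensorInv [h : ∀ A B : U, IsIso (δ H A B)] (Q P : VQuiver S U)
    (a b : S) : ((mapQuiver H S).obj Q ⊗ (mapQuiver H S).obj P).obj a b ⟶ H.obj ((Q ⊗ P).obj a b) :=
  desc fun c =>
    have := h (Q.obj a c) (P.obj c b)
    (inv (δ H (Q.obj a c) (P.obj c b)) :
      H.obj (Q.obj a c) ⊗ H.obj (P.obj c b) ⟶ H.obj (Q.obj a c ⊗ P.obj c b)) ≫
    H.map (ι Q P a b c)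

lemma ι_mapQuiverTensorInv [h : ∀ A B : U, IsIso (δ H A B)] (Q P : VQuiver S U) (a b c : S) :
    ι ((mapQuiver H S).obj Q) ((mapQuiver H S).obj P) a b c ≫ mapQuiverTensorInv H Q P a b =
    (inv (δ H (Q.obj a c) (P.obj c b)) :
      H.obj (Q.obj a c) ⊗ H.obj (P.obj c b) ⟶ H.obj (Q.obj a c ⊗ P.obj c b)) ≫
    H.map (ι Q P a b c) :=
  ι_desc _ c

variable [∀ J : Type u, PreservesColimitsOfShape (Discrete J) H]

instance [IsIso (η H)] : IsIso (η (mapQuiver H S)) := by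
  refine isIso_of_app _ fun a b => ?_
  refine ⟨unitDesc fun h => inv (η H) ≫ H.map (unitι h), ?_, ?_⟩
  · refine mapSigma_hom_ext H fun e => ?_
    have e1 : H.map (unitι e.down.down) ≫ (mapQuiverUnit H S).app a b ≫
        (unitDesc fun h => inv (η H) ≫ H.map (unitι h)) = H.map (unitι e.down.down) := by
      refine (Category.assoc _ _ _).symm.trans ?_
      refine (eq_whisker (map_unitι_mapQuiverUnit H e.down.down) _).trans ?_
      rw [Category.assoc, unitι_unitDesc]
      exact IsIso.hom_inv_id_assoc _ _
    exact e1.trans (Category.comp_id _).symm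
  · refine unit_hom_ext fun e => ?_
    rw [unitι_unitDesc_assoc]
    refine (Category.assoc _ _ _).trans ?_
    refine (whisker_eq (inv (η H)) (map_unitι_mapQuiverUnit H e)).trans ?_
    exact (IsIso.inv_hom_id_assoc _ _).trans (Category.comp_id _).symm

instance [h : ∀ A B : U, IsIso (δ H A B)] (Q P : VQuiver S U) :
    IsIso (δ (mapQuiver H S) Q P) := by
  refine isIso_of_app _ fun a b => ?_
  refine ⟨mapQuiverTensorInv H Q P a b, ?_, ?_⟩
  · refine mapSigma_hom_ext H fun c => ?_
    refine (map_ι_mapQuiverTensor_assoc H Q P a b c _).trans ?_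
    refine (whisker_eq _ (ι_mapQuiverTensorInv H Q P a b c)).trans ?_
    exact (comp_cancel (IsIso.hom_inv_id (δ H (Q.obj a c) (P.obj c b))) _).trans (Category.comp_id _).symm
  · refine tensor_hom_ext fun c => ?_
    refine (Category.assoc _ _ _).symm.trans ?_
    refine (eq_whisker (ι_mapQuiverTensorInv H Q P a b c) _).trans ?_
    refine (Category.assoc _ _ _).trans ?_
    refine (whisker_eq _ (map_ι_mapQuiverTensor H Q P a b c)).trans ?_
    exact (comp_cancel (IsIso.inv_hom_id (δ H (Q.obj a c) (P.obj c b))) _).trans (Category.comp_id _).symm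

end VQuiver

open Functor.OplaxMonoidal Functor.LaxMonoidal
open Simplicial Opposite

namespace VQuiver

variable {V : Type w} [Category.{u} V] [MonoidalCategory V] [TensorCocomplete V]
  {R S T : Type u}

lemma pullbackTensor_id (Q P : VQuiver S V) :
    pullbackTensor (id : S → S) Q P = 𝟙 (Q ⊗ P) := by
  ext a b
  refine tensor_hom_ext fun c => ?_
  exact (ι_pullbackTensor id Q P a b c).trans (Category.comp_id _).symm

lemma pullbackUnit_id : pullbackUnit (V := V) (id : S → S) = 𝟙 _ := by
  ext a b
  refine unit_hom_ext fun e => ?_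
  exact (unitι_pullbackUnit id e).trans (Category.comp_id _).symm

lemma pullbackTensor_comp (f : R → S) (g : S → T) (Q P : VQuiver T V) :
    pullbackTensor (g ∘ f) Q P =
      pullbackTensor f ((pullback g).obj Q) ((pullback g).obj P) ≫
        (pullback f).map (pullbackTensor g Q P) := by
  ext a b
  refine tensor_hom_ext fun c => ?_
  refine (ι_pullbackTensor (g ∘ f) Q P a b c).trans (Eq.symm ?_)
  refine (ι_pullbackTensor_assoc f ((pullback g).obj Q) ((pullback g).obj P) a b c _).trans ?_
  exact ι_pullbackTensor g Q P (f a) (f b) (f c)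

lemma pullbackUnit_comp (f : R → S) (g : S → T) :
    pullbackUnit (V := V) (g ∘ f) = pullbackUnit f ≫ (pullback f).map (pullbackUnit g) := by
  ext a b
  refine unit_hom_ext fun e => ?_
  refine (unitι_pullbackUnit (g ∘ f) e).trans (Eq.symm ?_)
  refine (unitι_pullbackUnit_assoc f e _).trans ?_
  exact unitι_pullbackUnit g (congrArg f e)

end VQuiver

/-! ### Templicial objects -/

/-- A templicial object of `V`: a set `S` and a strongly unital colax monoidal functor from the
opposite of the category of finite intervals to `V`-quivers on `S`. -/
structure Templicial (V : Type w) [Category.{u} V] [MonoidalCategory V] [TensorCocomplete V] where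
  base : Type u
  functor : FinIntᵒᵖ ⥤ VQuiver base V
  [oplax : functor.OplaxMonoidal]
  [unital : IsIso (η functor)]

namespace Templicial

attribute [instance] oplax unital

variable {V : Type w} [Category.{u} V] [MonoidalCategory V] [TensorCocomplete V]

/-- A morphism of templicial objects: a map `f` of base sets and a monoidal natural transformation
from `X` to the pullback `f^* Y`. -/
@[ext]
structure Hom (X Y : Templicial V) where
  toFun : X.base → Y.base
  trans : X.functor ⟶ Y.functor ⋙ VQuiver.pullback toFun
  comul : ∀ m n : FinIntᵒᵖ,
    δ X.functor m n ≫ (trans.app m ⊗ₘ trans.app n) ≫ μ (VQuiver.pullback toFun) _ _ =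
      trans.app (m ⊗ n) ≫ (VQuiver.pullback toFun).map (δ Y.functor m n)
  counit : η X.functor ≫ ε (VQuiver.pullback toFun) =
    trans.app (𝟙_ _) ≫ (VQuiver.pullback toFun).map (η Y.functor)

lemma Hom.ext_app {X Y : Templicial V} {F G : Hom X Y} (h : F.toFun = G.toFun)
    (h' : ∀ n a b, (F.trans.app n).app a b ≫
      eqToHom (by rw [h]) = (G.trans.app n).app a b) : F = G := by
  obtain ⟨f, s, _, _⟩ := F
  obtain ⟨g, t, _, _⟩ := G
  obtain rfl : f = g := h
  obtain rfl : s = t := by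
    ext n a b
    exact (Category.comp_id _).symm.trans (h' n a b)
  rfl

/-- The identity morphism. -/
def Hom.id (X : Templicial V) : Hom X X where
  toFun := _root_.id
  trans :=
    { app := fun n => 𝟙 (X.functor.obj n)
      naturality := fun _ _ _ => (Category.comp_id _).trans (Category.id_comp _).symm }
  comul m n := by
    change δ X.functor m n ≫ (𝟙 (X.functor.obj m) ⊗ₘ 𝟙 (X.functor.obj n)) ≫
      VQuiver.pullbackTensor _root_.id (X.functor.obj m) (X.functor.obj n) =
        𝟙 (X.functor.obj (m ⊗ n)) ≫ δ X.functor m n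
    refine (whisker_eq _ (eq_whisker (id_tensorHom_id _ _) _)).trans ?_
    refine (whisker_eq _ (Category.id_comp _)).trans ?_
    refine (whisker_eq _ (VQuiver.pullbackTensor_id _ _)).trans ?_
    exact (Category.comp_id _).trans (Category.id_comp _).symm
  counit := by
    change η X.functor ≫ VQuiver.pullbackUnit _root_.id =
        𝟙 (X.functor.obj (𝟙_ _)) ≫ η X.functor
    refine (whisker_eq _ VQuiver.pullbackUnit_id).trans ?_
    exact (Category.comp_id _).trans (Category.id_comp _).symm

/-- The composition of morphisms. -/
def Hom.comp {X Y Z : Templicial V} (F : Hom X Y) (G : Hom Y Z) : Hom X Z where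
  toFun := G.toFun ∘ F.toFun
  trans :=
    { app := fun n => F.trans.app n ≫ (VQuiver.pullback F.toFun).map (G.trans.app n)
      naturality := by
        intro m n f
        have h : X.functor.map f ≫ F.trans.app n ≫
            (VQuiver.pullback F.toFun).map (G.trans.app n) =
            (F.trans.app m ≫ (VQuiver.pullback F.toFun).map (G.trans.app m)) ≫
              (VQuiver.pullback F.toFun).map ((VQuiver.pullback G.toFun).map (Z.functor.map f)) := by
          rw [F.trans.naturality_assoc]
          refine (whisker_eq _ ((VQuiver.pullback F.toFun).map_comp _ _).symm).trans ?_
          rw [G.trans.naturality]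
          refine (whisker_eq _ ((VQuiver.pullback F.toFun).map_comp _ _)).trans ?_
          exact (Category.assoc _ _ _).symm
        exact h }
  comul m n := by
    have h : δ X.functor m n ≫
        ((F.trans.app m ≫ (VQuiver.pullback F.toFun).map (G.trans.app m)) ⊗ₘ
          (F.trans.app n ≫ (VQuiver.pullback F.toFun).map (G.trans.app n))) ≫
        μ (VQuiver.pullback F.toFun) _ _ ≫
        (VQuiver.pullback F.toFun).map (μ (VQuiver.pullback G.toFun) _ _) =
        (F.trans.app (m ⊗ n) ≫ (VQuiver.pullback F.toFun).map (G.trans.app (m ⊗ n))) ≫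
          (VQuiver.pullback F.toFun).map ((VQuiver.pullback G.toFun).map (δ Z.functor m n)) := by
      rw [← tensorHom_comp_tensorHom, Category.assoc, μ_natural_assoc]
      refine Eq.trans ?_ ((eq_whisker (F.comul m n)
        ((VQuiver.pullback F.toFun).map (G.trans.app m ⊗ₘ G.trans.app n) ≫
          (VQuiver.pullback F.toFun).map (μ (VQuiver.pullback G.toFun) _ _))).trans ?_)
      · simp only [Category.assoc]
      rw [Category.assoc, Category.assoc]
      refine whisker_eq _ ?_
      rw [← Functor.map_comp]
      refine ((Functor.map_comp _ _ _).symm.trans ?_).trans (Functor.map_comp _ _ _)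
      exact congrArg _ (G.comul m n)
    refine Eq.trans ?_ h
    exact whisker_eq _ (whisker_eq _ (VQuiver.pullbackTensor_comp F.toFun G.toFun _ _))
  counit := by
    have h : η X.functor ≫ ε (VQuiver.pullback F.toFun) ≫
        (VQuiver.pullback F.toFun).map (ε (VQuiver.pullback G.toFun)) =
        (F.trans.app (𝟙_ _) ≫ (VQuiver.pullback F.toFun).map (G.trans.app (𝟙_ _))) ≫
          (VQuiver.pullback F.toFun).map ((VQuiver.pullback G.toFun).map (η Z.functor)) := by
      rw [← Category.assoc]
      refine (eq_whisker F.counit _).trans ?_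
      rw [Category.assoc, Category.assoc]
      refine whisker_eq _ ?_
      refine ((Functor.map_comp _ _ _).symm.trans ?_).trans (Functor.map_comp _ _ _)
      exact congrArg _ G.counit
    refine Eq.trans ?_ h
    exact whisker_eq _ (VQuiver.pullbackUnit_comp F.toFun G.toFun)

lemma Hom.comp_app {X Y Z : Templicial V} (F : Hom X Y) (G : Hom Y Z) (n : FinIntᵒᵖ)
    (a b : X.base) : ((F.comp G).trans.app n).app a b =
      (F.trans.app n).app a b ≫ (G.trans.app n).app (F.toFun a) (F.toFun b) :=
  rfl

instance : Category (Templicial V) where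
  Hom := Hom
  id := Hom.id
  comp := Hom.comp
  id_comp _ := Hom.ext_app rfl fun n a b =>
    (Category.comp_id _).trans ((Hom.comp_app _ _ n a b).trans (Category.id_comp _))
  comp_id _ := Hom.ext_app rfl fun n a b =>
    (Category.comp_id _).trans ((Hom.comp_app _ _ n a b).trans (Category.comp_id _))
  assoc F G _ := Hom.ext_app rfl fun n a b =>
    (Category.comp_id _).trans (Category.assoc ((F.trans.app n).app a b)
      ((G.trans.app n).app (F.toFun a) (F.toFun b)) _)

end Templicial

/-! ### Simplicial sets as templicial sets -/

namespace FinInt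

/-- The inclusion `[m] ⟶ [m + n]` of the initial segment. -/
def front (m n : FinInt) : toSimplex.obj m ⟶ toSimplex.obj (m ⊗ n) :=
  SimplexCategory.Hom.mk
    { toFun := fun i => ⟨i, Nat.lt_of_lt_of_le (show (i : ℕ) < m.len + 1 from i.2)
        (Nat.add_le_add_right (Nat.le_add_right _ _) 1)⟩
      monotone' := fun _ _ h => h }

/-- The inclusion `[n] ⟶ [m + n]` of the final segment. -/
def back (m n : FinInt) : toSimplex.obj n ⟶ toSimplex.obj (m ⊗ n) :=
  SimplexCategory.Hom.mk
    { toFun := fun i => ⟨m.len + i, Nat.add_lt_add_left (show (i : ℕ) < n.len + 1 from i.2) _⟩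
      monotone' := fun _ _ h => Nat.add_le_add_left h _ }

/-- The inclusion `[0] ⟶ [n]` of the vertex `i`. -/
def vertex (n : FinInt) (i : Fin (n.len + 1)) : SimplexCategory.mk 0 ⟶ toSimplex.obj n :=
  SimplexCategory.const _ _ i

/-- The value of a morphism to `[n]`, as a natural number. -/
def val {m : SimplexCategory} {n : FinInt} (f : m ⟶ toSimplex.obj n) (i : Fin (m.len + 1)) : ℕ :=
  (f.toOrderHom i : Fin (n.len + 1))

lemma toSimplex_hom_ext {m : SimplexCategory} {n : FinInt} {f g : m ⟶ toSimplex.obj n}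
    (h : ∀ i, val f i = val g i) : f = g :=
  SimplexCategory.Hom.ext _ _ (OrderHom.ext _ _ (funext fun i => Fin.ext (h i)))

lemma front_tensorHom {m m' n n' : FinInt} (f : m ⟶ m') (g : n ⟶ n') :
    front m n ≫ toSimplex.map (f ⊗ₘ g) = toSimplex.map f ≫ front m' n' :=
  toSimplex_hom_ext fun i => dif_pos (Nat.le_of_lt_succ i.2)

lemma back_tensorHom {m m' n n' : FinInt} (f : m ⟶ m') (g : n ⟶ n') :
    back m n ≫ toSimplex.map (f ⊗ₘ g) = toSimplex.map g ≫ back m' n' := by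
  refine toSimplex_hom_ext fun (i : Fin (n.len + 1)) => ?_
  have hi := Nat.add_lt_add_left i.2 m.len
  change addFun f g ⟨m.len + i, hi⟩ = m'.len + g.toOrderHom i
  unfold addFun
  split_ifs with h
  · have h0 : (i : ℕ) = 0 := by dsimp only at h; omega
    rw [apply_eq_last f (by dsimp only; omega), apply_eq_zero g h0, Nat.add_zero]
  · congr 1
    exact apply_congr g (Nat.add_sub_cancel_left _ _)

lemma front_front (l m n : FinInt) : front l m ≫ front (l ⊗ m) n =
    front l (m ⊗ n) ≫ toSimplex.map (α_ l m n).inv :=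
  toSimplex_hom_ext fun _ => rfl

lemma back_front (l m n : FinInt) : back l m ≫ front (l ⊗ m) n =
    front m n ≫ back l (m ⊗ n) ≫ toSimplex.map (α_ l m n).inv :=
  toSimplex_hom_ext fun _ => rfl

lemma back_back (l m n : FinInt) : back (l ⊗ m) n =
    back m n ≫ back l (m ⊗ n) ≫ toSimplex.map (α_ l m n).inv :=
  toSimplex_hom_ext fun i => Nat.add_assoc l.len m.len (i : Fin (n.len + 1))

lemma back_leftUnitor (n : FinInt) : back (𝟙_ _) n ≫ toSimplex.map (λ_ n).hom = 𝟙 _ :=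
  toSimplex_hom_ext fun i => Nat.zero_add (i : Fin (n.len + 1))

lemma front_rightUnitor (n : FinInt) : front n (𝟙_ _) ≫ toSimplex.map (ρ_ n).hom = 𝟙 _ :=
  toSimplex_hom_ext fun _ => rfl

end FinInt

namespace SSetTemplicial

variable (X : SSet.{u})

/-- The simplices of dimension `n`. -/
abbrev simplices (n : FinInt) : Type u := X.obj (op (FinInt.toSimplex.obj n))

/-- The vertices of a simplicial set. -/
abbrev vertices : Type u := X.obj (op (SimplexCategory.mk 0))

variable {X}

/-- The vertex of a simplex with a given index. -/
def vertex {n : FinInt} (y : simplices X n) (i : Fin (n.len + 1)) : vertices X :=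
  X.map (FinInt.vertex n i).op y

lemma map_map {l m n : SimplexCategory} (f : l ⟶ m) (g : m ⟶ n) (y : X.obj (op n)) :
    X.map f.op (X.map g.op y) = X.map (f ≫ g).op y := by
  rw [op_comp, Functor.map_comp]; rfl

lemma map_congr {m : SimplexCategory} {n : FinInt} {f g : m ⟶ FinInt.toSimplex.obj n}
    (h : ∀ i, FinInt.val f i = FinInt.val g i) (y : simplices X n) :
    X.map f.op y = X.map g.op y := by
  rw [FinInt.toSimplex_hom_ext h]

lemma map_eq_self {n : FinInt} {f : FinInt.toSimplex.obj n ⟶ FinInt.toSimplex.obj n}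
    (h : ∀ i, FinInt.val f i = i) (y : simplices X n) : X.map f.op y = y := by
  rw [FinInt.toSimplex_hom_ext (f := f) (g := 𝟙 _) h, op_id, CategoryTheory.Functor.map_id]; exact types_id_apply _ _

lemma vertex_map {m n : FinInt} (f : FinInt.toSimplex.obj m ⟶ FinInt.toSimplex.obj n)
    (y : simplices X n) {i : Fin (m.len + 1)} {j : Fin (n.len + 1)}
    (h : FinInt.val f i = j) : vertex (X.map f.op y : simplices X m) i = vertex y j :=
  (map_map _ f y).trans (map_congr (fun _ => h) y)

variable (X)

/-- The `n`-simplices `y` of `X`, indexed by their first vertex `a` and their last vertex `b`. -/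
def quiver (n : FinInt) : VQuiver (vertices X) (Type u) where
  obj a b := {y : simplices X n // vertex y 0 = a ∧ vertex y (Fin.last _) = b}

variable {X}

lemma quiver_ext {n : FinInt} {a b : vertices X} {y z : (quiver X n).obj a b}
    (h : y.1 = z.1) : y = z := Subtype.ext h

/-- The restriction of simplices along a morphism that preserves the endpoints. -/
def restrict {m n : FinInt} (f : m ⟶ n) {a b : vertices X} (y : (quiver X n).obj a b) :
    (quiver X m).obj a b :=
  ⟨X.map (FinInt.toSimplex.map f).op y.1,
    (vertex_map _ y.1 (congrArg Fin.val f.map_zero)).trans y.2.1,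
    (vertex_map _ y.1 (congrArg Fin.val f.map_last)).trans y.2.2⟩

variable (X)

/-- The functor underlying the templicial set of a simplicial set. -/
def functor : FinIntᵒᵖ ⥤ VQuiver (vertices X) (Type u) where
  obj n := quiver X n.unop
  map {_ _} f := ⟨fun _ _ => ↾(restrict f.unop)⟩
  map_id n := by
    ext a b y
    exact quiver_ext (map_eq_self (fun _ => rfl) y.1)
  map_comp f g := by
    ext a b y
    exact quiver_ext ((map_map (FinInt.toSimplex.map g.unop) (FinInt.toSimplex.map f.unop)
      y.1).trans (map_congr (fun _ => rfl) y.1)).symm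

variable {X}

/-- The comultiplication of the templicial set of a simplicial set: a simplex of dimension `m + n`
is sent to the pair of its initial `m`-simplex and its final `n`-simplex. -/
noncomputable def split (m n : FinInt) {a b : vertices X} (y : (quiver X (m ⊗ n)).obj a b) :
    (quiver X m ⊗ quiver X n).obj a b :=
  VQuiver.ι (quiver X m) (quiver X n) a b
    (vertex y.1 ⟨m.len, Nat.lt_succ_of_le (Nat.le_add_right _ _)⟩)
    (⟨X.map (FinInt.front m n).op y.1, (vertex_map _ y.1 rfl).trans y.2.1, vertex_map _ y.1 rfl⟩,
     ⟨X.map (FinInt.back m n).op y.1, vertex_map _ y.1 rfl, (vertex_map _ y.1 rfl).trans y.2.2⟩)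

/-- The counit of the templicial set of a simplicial set: the vertex `a` is sent to the element of
`I(a, a)`. -/
noncomputable def counit {a b : vertices X} (y : (quiver X (𝟙_ FinInt)).obj a b) :
    (𝟙_ (VQuiver (vertices X) (Type u))).obj a b :=
  VQuiver.unitι (V := Type u) (y.2.1.symm.trans y.2.2) PUnit.unit

lemma ι_congr {m n : FinInt} {a b c c' : vertices X} {p : (quiver X m).obj a c}
    {q : (quiver X n).obj c b} {p' : (quiver X m).obj a c'}
    {q' : (quiver X n).obj c' b} (hp : p.1 = p'.1) (hq : q.1 = q'.1) :
    VQuiver.ι (quiver X m) (quiver X n) a b c (p, q) =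
      VQuiver.ι (quiver X m) (quiver X n) a b c' (p', q') := by
  obtain rfl : c = c' := by rw [← p.2.2, ← p'.2.2, hp]
  rw [quiver_ext hp, quiver_ext hq]

lemma ι_congr₃ {l m n : FinInt} {a b c c' d d' : vertices X} {p : (quiver X l).obj a d}
    {q : (quiver X m).obj d c} {r : (quiver X n).obj c b} {p' : (quiver X l).obj a d'}
    {q' : (quiver X m).obj d' c'} {r' : (quiver X n).obj c' b} (hp : p.1 = p'.1)
    (hq : q.1 = q'.1) (hr : r.1 = r'.1) :
    VQuiver.ι (quiver X l) (quiver X m ⊗ quiver X n) a b d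
        (p, VQuiver.ι (quiver X m) (quiver X n) d b c (q, r)) =
      VQuiver.ι (quiver X l) (quiver X m ⊗ quiver X n) a b d'
        (p', VQuiver.ι (quiver X m) (quiver X n) d' b c' (q', r')) := by
  obtain rfl : d = d' := by rw [← p.2.2, ← p'.2.2, hp]
  obtain rfl : c = c' := by rw [← q.2.2, ← q'.2.2, hq]
  rw [quiver_ext hp, quiver_ext hq, quiver_ext hr]

lemma map_comm {l m m' n : SimplexCategory} {f : l ⟶ m} {g : m ⟶ n} {f' : l ⟶ m'} {g' : m' ⟶ n}
    (h : f ≫ g = f' ≫ g') (y : X.obj (op n)) :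
    X.map f.op (X.map g.op y) = X.map f'.op (X.map g'.op y) := by
  rw [map_map, map_map, h]

lemma map_comm₃ {l l' m m' n : SimplexCategory} {f : l ⟶ m} {g : m ⟶ n} {f' : l ⟶ l'} {g' : l' ⟶ m'}
    {h' : m' ⟶ n} (h : f ≫ g = f' ≫ g' ≫ h') (y : X.obj (op n)) :
    X.map f.op (X.map g.op y) = X.map f'.op (X.map g'.op (X.map h'.op y)) := by
  rw [map_map, map_map, map_map, h, Category.assoc]

lemma map_comm_self {m n : SimplexCategory} {f : m ⟶ n} {g : n ⟶ m} (h : f ≫ g = 𝟙 m)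
    (y : X.obj (op m)) : X.map f.op (X.map g.op y) = y := by
  rw [map_map, h, op_id, CategoryTheory.Functor.map_id]; exact types_id_apply _ _

lemma map_comm_id {m n n' : SimplexCategory} {f : m ⟶ n'} {g : n' ⟶ n} {k : m ⟶ m} {f' : m ⟶ n}
    (h : f ≫ g = k ≫ f') (hk : k = 𝟙 m) (y : X.obj (op n)) :
    X.map f.op (X.map g.op y) = X.map f'.op y := by
  rw [map_map, h, hk, Category.id_comp]

lemma whiskerRight_ι {S : Type u} {Q Q' : VQuiver S (Type u)} (f : Q ⟶ Q') (P : VQuiver S (Type u))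
    {a b c : S} (p : Q.obj a c) (q : P.obj c b) :
    (f ▷ P).app a b (VQuiver.ι Q P a b c (p, q)) = VQuiver.ι Q' P a b c (f.app a c p, q) :=
  ConcreteCategory.congr_hom (C := Type u) (VQuiver.ι_whiskerRight f P a b c)
    ((p, q) : Q.obj a c × P.obj c b)

lemma whiskerLeft_ι {S : Type u} (Q : VQuiver S (Type u)) {P P' : VQuiver S (Type u)} (f : P ⟶ P')
    {a b c : S} (p : Q.obj a c) (q : P.obj c b) :
    (Q ◁ f).app a b (VQuiver.ι Q P a b c (p, q)) = VQuiver.ι Q P' a b c (p, f.app c b q) :=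
  ConcreteCategory.congr_hom (C := Type u) (VQuiver.ι_whiskerLeft Q f a b c)
    ((p, q) : Q.obj a c × P.obj c b)

lemma associator_ι {S : Type u} (Q P R : VQuiver S (Type u)) {a b c d : S}
    (p : Q.obj a d) (q : P.obj d c) (r : R.obj c b) :
    (α_ Q P R).hom.app a b (VQuiver.ι (Q ⊗ P) R a b c (VQuiver.ι Q P a c d (p, q), r)) =
      VQuiver.ι Q (P ⊗ R) a b d (p, VQuiver.ι P R d b c (q, r)) :=
  ConcreteCategory.congr_hom (C := Type u) (VQuiver.ι_associator_hom Q P R a b c d)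
    (((p, q), r) : (Q.obj a d × P.obj d c) × R.obj c b)

lemma unit_ι_congr {n : FinInt} {a b c : vertices X} {p : (quiver X n).obj a b}
    {q : (quiver X n).obj c b} (h : a = c) (hq : p.1 = q.1) :
    VQuiver.ι (𝟙_ (VQuiver (vertices X) (Type u))) (quiver X n) a b a
        (VQuiver.unitι (V := Type u) rfl PUnit.unit, p) =
      VQuiver.ι (𝟙_ (VQuiver (vertices X) (Type u))) (quiver X n) a b c
        (VQuiver.unitι (V := Type u) h PUnit.unit, q) := by
  subst h
  rw [quiver_ext hq]

lemma ι_unit_congr {n : FinInt} {a b c : vertices X} {p : (quiver X n).obj a b}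
    {q : (quiver X n).obj a c} (h : c = b) (hq : p.1 = q.1) :
    VQuiver.ι (quiver X n) (𝟙_ (VQuiver (vertices X) (Type u))) a b b
        (p, VQuiver.unitι (V := Type u) rfl PUnit.unit) =
      VQuiver.ι (quiver X n) (𝟙_ (VQuiver (vertices X) (Type u))) a b c
        (q, VQuiver.unitι (V := Type u) h PUnit.unit) := by
  subst h
  rw [quiver_ext hq]

noncomputable instance : (functor X).OplaxMonoidal where
  η := ⟨fun _ _ => ↾counit⟩
  δ m n := ⟨fun _ _ => ↾(split m.unop n.unop)⟩
  δ_natural_left {m m'} f n := by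
    ext a b y
    refine (whiskerRight_ι ((functor X).map f) ((functor X).obj n) _ _).trans ?_
    refine ι_congr ?_ ?_
    · exact (map_comm (FinInt.front_tensorHom f.unop (𝟙 n.unop)) y.1).symm
    · refine (map_comm_id (FinInt.back_tensorHom f.unop (𝟙 n.unop)) ?_ y.1).symm
      exact FinInt.toSimplex.map_id n.unop
  δ_natural_right {m m'} n f := by
    ext a b y
    refine (whiskerLeft_ι ((functor X).obj n) ((functor X).map f) _ _).trans ?_
    refine ι_congr ?_ ?_
    · refine (map_comm_id (FinInt.front_tensorHom (𝟙 n.unop) f.unop) ?_ y.1).symm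
      exact FinInt.toSimplex.map_id n.unop
    · exact (map_comm (FinInt.back_tensorHom (𝟙 n.unop) f.unop) y.1).symm
  oplax_associativity l m n := by
    ext a b y
    refine (congrArg ((α_ (quiver X l.unop) (quiver X m.unop) (quiver X n.unop)).hom.app a b)
      (whiskerRight_ι _ ((functor X).obj n) _ _)).trans ?_
    refine (associator_ι (quiver X l.unop) (quiver X m.unop) (quiver X n.unop) _ _ _).trans ?_
    refine Eq.trans ?_ (whiskerLeft_ι ((functor X).obj l) _ _ _).symm
    refine ι_congr₃ ?_ ?_ ?_
    · exact map_comm (FinInt.front_front l.unop m.unop n.unop) y.1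
    · exact map_comm₃ (FinInt.back_front l.unop m.unop n.unop) y.1
    · refine Eq.trans ?_ (map_comm₃ (f := 𝟙 _)
        ((Category.id_comp _).trans (FinInt.back_back l.unop m.unop n.unop)) y.1)
      exact ((ConcreteCategory.congr_hom (X.map_id _) _).trans (types_id_apply _ _)).symm
  oplax_left_unitality n := by
    ext a b y
    refine Eq.trans ?_ (whiskerRight_ι _ ((functor X).obj n) _ _).symm
    refine unit_ι_congr _ ?_
    exact (map_comm_self (FinInt.back_leftUnitor n.unop) y.1).symm
  oplax_right_unitality n := by
    ext a b y
    refine Eq.trans ?_ (whiskerLeft_ι ((functor X).obj n) _ _ _).symm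
    refine ι_unit_congr _ ?_
    exact (map_comm_self (FinInt.front_rightUnitor n.unop) y.1).symm

lemma vertex_zero (a : vertices X) (i : Fin ((𝟙_ FinInt).len + 1)) :
    vertex (n := 𝟙_ FinInt) a i = a :=
  map_eq_self (n := 𝟙_ FinInt) (fun j => by
    have h : i = j := Subsingleton.elim (α := Fin 1) i j
    rw [← h]; rfl) a

instance : IsIso (Functor.OplaxMonoidal.η (functor X)) := by
  refine VQuiver.isIso_of_app _ fun a b => ?_
  refine ⟨VQuiver.unitDesc fun h => ↾fun _ => (⟨a, vertex_zero a _,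
    (vertex_zero a _).trans h⟩ : (quiver X (𝟙_ FinInt)).obj a b), ?_, ?_⟩
  · ext y
    refine (ConcreteCategory.congr_hom (VQuiver.unitι_unitDesc (V := Type u) _ _) _).trans ?_
    exact quiver_ext (y.2.1.symm.trans (vertex_zero _ _))
  · refine VQuiver.unit_hom_ext fun h => ?_
    refine (VQuiver.unitι_unitDesc_assoc _ _ _).trans ?_
    rfl

variable {Y : SSet.{u}}

lemma map_app (f : X ⟶ Y) {m n : SimplexCategory} (g : m ⟶ n) (y : X.obj (op n)) :
    Y.map g.op (f.app (op n) y) = f.app (op m) (X.map g.op y) :=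
  (ConcreteCategory.congr_hom (f.naturality g.op) y).symm

/-- The action of a map of simplicial sets on simplices with fixed first and last vertex. -/
def quiverMap (f : X ⟶ Y) {n : FinInt} {a b : vertices X} (y : (quiver X n).obj a b) :
    (quiver Y n).obj (f.app (op (SimplexCategory.mk 0)) a) (f.app (op (SimplexCategory.mk 0)) b) :=
  ⟨f.app _ y.1, (map_app f _ y.1).trans (congrArg _ y.2.1),
    (map_app f _ y.1).trans (congrArg _ y.2.2)⟩

lemma pullbackTensor_ι {S T : Type u} (f : S → T) (Q P : VQuiver T (Type u))
    {a b c : S} (p : Q.obj (f a) (f c)) (q : P.obj (f c) (f b)) :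
    (VQuiver.pullbackTensor f Q P).app a b
      (VQuiver.ι ((VQuiver.pullback f).obj Q) ((VQuiver.pullback f).obj P) a b c (p, q)) =
      VQuiver.ι Q P (f a) (f b) (f c) (p, q) :=
  ConcreteCategory.congr_hom (C := Type u) (VQuiver.ι_pullbackTensor f Q P a b c)
    ((p, q) : Q.obj (f a) (f c) × P.obj (f c) (f b))

lemma tensorHom_ι {S : Type u} {Q Q' P P' : VQuiver S (Type u)} (f : Q ⟶ Q') (g : P ⟶ P')
    {a b c : S} (p : Q.obj a c) (q : P.obj c b) :
    (f ⊗ₘ g).app a b (VQuiver.ι Q P a b c (p, q)) =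
      VQuiver.ι Q' P' a b c (f.app a c p, g.app c b q) :=
  ConcreteCategory.congr_hom (C := Type u) (VQuiver.ι_tensorHom f g a b c)
    ((p, q) : Q.obj a c × P.obj c b)

lemma pullbackUnit_unitι {S T : Type u} (f : S → T) {a b : S} (h : a = b) (x : 𝟙_ (Type u)) :
    (VQuiver.pullbackUnit (V := Type u) f).app a b (VQuiver.unitι (V := Type u) h x) =
      VQuiver.unitι (V := Type u) (congrArg f h) x :=
  ConcreteCategory.congr_hom (C := Type u) (VQuiver.unitι_pullbackUnit (V := Type u) f h) x

end SSetTemplicial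

open SSetTemplicial in
/-- The functor that regards a simplicial set as a templicial set. -/
noncomputable def ofSSet : SSet.{u} ⥤ Templicial (Type u) where
  obj X :=
    { base := vertices X
      functor := functor X }
  map {X Y} f :=
    { toFun := f.app (op (SimplexCategory.mk 0))
      trans :=
        { app := fun n => ⟨fun a b => ↾fun y : (quiver X n.unop).obj a b => (quiverMap f y :)⟩
          naturality := by
            intro m n g
            ext a b y
            exact quiver_ext (map_app f (FinInt.toSimplex.map g.unop) y.1).symm }
      comul := by
        intro m n
        ext a b y
        refine (congrArg ((VQuiver.pullbackTensor _ (quiver Y m.unop) (quiver Y n.unop)).app a b)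
          (tensorHom_ι _ _ _ _)).trans ?_
        refine (pullbackTensor_ι (f.app (op (SimplexCategory.mk 0))) (quiver Y m.unop) (quiver Y n.unop) _ _).trans ?_
        exact ι_congr (map_app f _ y.1).symm (map_app f _ y.1).symm
      counit := by
        ext a b y
        exact pullbackUnit_unitι (f.app (op (SimplexCategory.mk 0))) _ _ }
  map_id X := Templicial.Hom.ext_app rfl fun n a b => by
    ext y
    rfl
  map_comp f g := Templicial.Hom.ext_app rfl fun n a b => by
    ext y
    rfl

namespace VQuiver

variable {U : Type w'} [Category.{u} U] [MonoidalCategory U] [TensorCocomplete U]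
  {V : Type w} [Category.{u} V] [MonoidalCategory V] [TensorCocomplete V]
  (H : U ⥤ V) [H.OplaxMonoidal] [∀ J : Type u, PreservesColimitsOfShape (Discrete J) H]
  {S T : Type u}

lemma mapQuiverTensor_pullback (f : S → T) (Q P : VQuiver T U) :
    mapQuiverTensor H ((pullback f).obj Q) ((pullback f).obj P) ≫
        pullbackTensor f ((mapQuiver H T).obj Q) ((mapQuiver H T).obj P) =
      (mapQuiver H S).map (pullbackTensor f Q P) ≫ (pullback f).map (mapQuiverTensor H Q P) := by
  ext a b
  refine mapSigma_hom_ext H fun c => ?_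
  refine (map_ι_mapQuiverTensor_assoc H ((pullback f).obj Q) ((pullback f).obj P) a b c _).trans ?_
  refine (whisker_eq _ (ι_pullbackTensor f ((mapQuiver H T).obj Q)
    ((mapQuiver H T).obj P) a b c)).trans ?_
  refine Eq.trans ?_ (Category.assoc _ _ _)
  refine Eq.trans ?_ (eq_whisker (H.map_comp _ _) _)
  refine Eq.trans ?_ (eq_whisker (congrArg H.map (ι_pullbackTensor f Q P a b c).symm) _)
  exact (map_ι_mapQuiverTensor H Q P (f a) (f b) (f c)).symm

lemma mapQuiverUnit_pullback (f : S → T) :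
    mapQuiverUnit H S ≫ pullbackUnit f =
      (mapQuiver H S).map (pullbackUnit f) ≫ (pullback f).map (mapQuiverUnit H T) := by
  ext a b
  refine mapSigma_hom_ext H fun e => ?_
  obtain ⟨⟨e⟩⟩ := e
  refine Eq.trans ?_ (Category.assoc _ _ _)
  refine Eq.trans ?_ (eq_whisker (H.map_comp _ _) _)
  refine Eq.trans ?_ (eq_whisker (congrArg H.map (unitι_pullbackUnit f e).symm) _)
  refine Eq.trans ?_ (map_unitι_mapQuiverUnit H (congrArg f e)).symm
  refine (Category.assoc _ _ _).symm.trans ?_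
  refine (eq_whisker (map_unitι_mapQuiverUnit H e) _).trans ?_
  refine (Category.assoc _ _ _).trans ?_
  exact whisker_eq _ (unitι_pullbackUnit f e)

end VQuiver

namespace Templicial

variable {U : Type w'} [Category.{u} U] [MonoidalCategory U] [TensorCocomplete U]
  {V : Type w} [Category.{u} V] [MonoidalCategory V] [TensorCocomplete V]
  (H : U ⥤ V) [H.OplaxMonoidal] [∀ J : Type u, PreservesColimitsOfShape (Discrete J) H]

lemma changeOfBase_comul {X Y : Templicial U} (F : X ⟶ Y) (m n : FinIntᵒᵖ) :
    ((VQuiver.mapQuiver H X.base).map (δ X.functor m n) ≫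
      δ (VQuiver.mapQuiver H X.base) _ _) ≫
      ((VQuiver.mapQuiver H X.base).map (F.trans.app m) ⊗ₘ
        (VQuiver.mapQuiver H X.base).map (F.trans.app n)) ≫
      VQuiver.pullbackTensor F.toFun
        ((VQuiver.mapQuiver H Y.base).obj (Y.functor.obj m))
        ((VQuiver.mapQuiver H Y.base).obj (Y.functor.obj n)) =
      (VQuiver.mapQuiver H X.base).map (F.trans.app (m ⊗ n)) ≫
      (VQuiver.mapQuiver H X.base).map ((VQuiver.pullback F.toFun).map (δ Y.functor m n)) ≫
      (VQuiver.pullback F.toFun).map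
        (VQuiver.mapQuiverTensor H (Y.functor.obj m) (Y.functor.obj n)) := by
  rw [Category.assoc]
  refine (whisker_eq _ (δ_natural_assoc (VQuiver.mapQuiver H X.base) (F.trans.app m)
    (F.trans.app n) _)).trans ?_
  refine (whisker_eq _ (whisker_eq _ (VQuiver.mapQuiverTensor_pullback H F.toFun
    (Y.functor.obj m) (Y.functor.obj n)))).trans ?_
  have e := congrArg (VQuiver.mapQuiver H X.base).map (F.comul m n)
  rw [Functor.map_comp, Functor.map_comp, Functor.map_comp] at e
  have e' := eq_whisker e ((VQuiver.pullback F.toFun).map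
      (VQuiver.mapQuiverTensor H (Y.functor.obj m) (Y.functor.obj n)))
  refine Eq.trans ?_ (e'.trans (Category.assoc _ _ _))
  exact (whisker_eq _ (Category.assoc _ _ _).symm).trans (Category.assoc _ _ _).symm

lemma changeOfBase_counit {X Y : Templicial U} (F : X ⟶ Y) :
    ((VQuiver.mapQuiver H X.base).map (η X.functor) ≫
      η (VQuiver.mapQuiver H X.base)) ≫ VQuiver.pullbackUnit F.toFun =
      (VQuiver.mapQuiver H X.base).map (F.trans.app (𝟙_ _)) ≫
      (VQuiver.mapQuiver H X.base).map ((VQuiver.pullback F.toFun).map (η Y.functor)) ≫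
      (VQuiver.pullback F.toFun).map (VQuiver.mapQuiverUnit H Y.base) := by
  rw [Category.assoc]
  refine (whisker_eq _ (VQuiver.mapQuiverUnit_pullback H F.toFun)).trans ?_
  have e := congrArg (VQuiver.mapQuiver H X.base).map F.counit
  rw [Functor.map_comp, Functor.map_comp] at e
  have e' := eq_whisker e ((VQuiver.pullback F.toFun).map
    (VQuiver.mapQuiverUnit H Y.base))
  exact ((Category.assoc _ _ _).symm.trans e').trans (Category.assoc _ _ _)

variable [IsIso (η H)]

/-- The templicial object `H(X)` for a strongly unital colax monoidal functor `H` that preserves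
coproducts. -/
noncomputable abbrev changeOfBaseObj (X : Templicial U) : Templicial V where
  base := X.base
  functor := X.functor ⋙ VQuiver.mapQuiver H X.base
  unital := by
    rw [Functor.OplaxMonoidal.comp_η]
    infer_instance

/-- The functor on templicial objects induced by a strongly unital colax monoidal functor that
preserves coproducts. -/
noncomputable def changeOfBase : Templicial U ⥤ Templicial V where
  obj X := changeOfBaseObj H X
  map {X Y} F :=
    { toFun := F.toFun
      trans :=
        { app := fun n => (VQuiver.mapQuiver H X.base).map (F.trans.app n)
          naturality := by
            intro m n g
            have h := congrArg (VQuiver.mapQuiver H X.base).map (F.trans.naturality g)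
            rw [Functor.map_comp, Functor.map_comp] at h
            exact h }
      comul := changeOfBase_comul H F
      counit := changeOfBase_counit H F }
  map_id X := Templicial.Hom.ext_app rfl fun n a b => by
    refine (Category.comp_id _).trans ?_
    exact H.map_id ((X.functor.obj n).obj a b)
  map_comp f g := Templicial.Hom.ext_app rfl fun n a b => by
    refine (Category.comp_id _).trans ?_
    exact H.map_comp ((f.trans.app n).app a b) ((g.trans.app n).app (f.toFun a) (f.toFun b))

end Templicial

/-- The free templicial object of `V` on a simplicial set. -/
noncomputable def freeTemplicial (V : Type w) [Category.{u} V] [MonoidalCategory V]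
    [TensorCocomplete V] : SSet.{u} ⥤ Templicial V :=
  ofSSet ⋙ Templicial.changeOfBase (freeFunctor V)

/-! ### Nonassociative Frobenius structures and enriched quasi-categories -/

/-- A nonassociative Frobenius structure (always strongly unital: the unit is the inverse of the
counit) on a colax monoidal functor. -/
structure NaFStructure {C : Type w} [Category.{w'} C] [MonoidalCategory C] {D : Type*}
    [Category* D] [MonoidalCategory D] (H : C ⥤ D) [H.OplaxMonoidal] where
  unit : 𝟙_ D ⟶ H.obj (𝟙_ C)
  mul : ∀ A B : C, H.obj A ⊗ H.obj B ⟶ H.obj (A ⊗ B)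
  mul_natural : ∀ {A A' B B' : C} (f : A ⟶ A') (g : B ⟶ B'),
    (H.map f ⊗ₘ H.map g) ≫ mul A' B' = mul A B ≫ H.map (f ⊗ₘ g)
  frobenius_left : ∀ A B C : C,
    δ H A B ▷ H.obj C ≫ (α_ _ _ _).hom ≫ H.obj A ◁ mul B C =
      mul (A ⊗ B) C ≫ H.map (α_ A B C).hom ≫ δ H A (B ⊗ C)
  frobenius_right : ∀ A B C : C,
    H.obj A ◁ δ H B C ≫ (α_ _ _ _).inv ≫ mul A B ▷ H.obj C =
      mul A (B ⊗ C) ≫ H.map (α_ A B C).inv ≫ δ H (A ⊗ B) C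
  mul_unit : ∀ A : C,
    H.obj A ◁ unit ≫ mul A (𝟙_ C) ≫ H.map (ρ_ A).hom = (ρ_ (H.obj A)).hom
  unit_mul : ∀ A : C,
    unit ▷ H.obj A ≫ mul (𝟙_ C) A ≫ H.map (λ_ A).hom = (λ_ (H.obj A)).hom
  unit_counit : unit ≫ η H = 𝟙 _
  counit_unit : η H ≫ unit = 𝟙 _

/-- A `V`-enriched quasi-category is a templicial object of `V` that has the lifting property with
respect to the free templicial objects on all inner horn inclusions. -/
def EnrichedQuasiCategory {V : Type w} [Category.{u} V] [MonoidalCategory V] [TensorCocomplete V]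
    (X : Templicial V) : Prop :=
  ∀ (n : ℕ) (i : Fin (n + 1)), 0 < i → i < Fin.last n →
    ∀ g : (freeTemplicial V).obj (Λ[n, i] : SSet.{u}) ⟶ X,
      ∃ h : (freeTemplicial V).obj Δ[n] ⟶ X, (freeTemplicial V).map Λ[n, i].ι ≫ h = g

/-! ### Change of base for nonassociative Frobenius structures -/

namespace NaFStructure

variable {C : Type*} [Category* C] [MonoidalCategory C] {D : Type*} [Category* D]
  [MonoidalCategory D] {E : Type*} [Category* E] [MonoidalCategory E]

section StrongMonoidal

variable (M : D ⥤ E) [M.OplaxMonoidal] [h : ∀ A B : D, IsIso (δ M A B)]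

/-! A naF-structure is a choice of composites that may fail to be associative but is strictly
compatible with all cuts and with the inner operators. Each of the first three parts has its own
mechanism, and the last one combines them.

In a quasi-category, a `p`-simplex and a `q`-simplex with a common vertex form a wedge inside `Δ[p +
q]`. The aim is to extend all wedges at once, naturally in every monotone map that preserves the
joint; outer endpoints need not be preserved, and this generality turns both Frobenius identities
into instances of naturality (`map_join`). A wedge is encoded by two simplices of the full dimension
that are degenerate along the retractions onto the two segments, so that pulling back needs no
bookkeeping of the dimensions `p` and `q` (`IsWedge`). The extension is chosen by strong induction
on the dimension (`filler`, `filled`). A wedge that is degenerate along a surjection receives the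
pullback of the extension already chosen for a wedge of least dimension; this does not depend on
choices because a nondegenerate wedge determines its surjection, as in the Eilenberg–Zilber lemma
(`eq_of_map_eq`). If the joint is an endpoint, one of the two simplices is the extension. Otherwise
the extensions in lower dimension prescribe all faces except the one opposite the joint, and this
inner horn has a filler (`exists_isFiller_interior`).

Change of base conjugates the multiplication with the invertible structure maps of a strong monoidal
functor (`compStrongMonoidal`).

For horn filling in the additive case, a morphism on an inner horn extends to the simplex once there
is a single element `v` with prescribed cuts at all interior vertices and prescribed inner faces;
the two outer faces enter only through the cuts (`HornData`). The multiplication `Z` is a section of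
the comultiplication (`mul_δ`), so the error `d` of one cut is repaired by adding `Z(d)`. The left
Frobenius identity shows that this leaves the earlier cuts alone (`exists_cutsBelow_succ`). The
faces are then repaired by differences that have no interior cuts: each repair may damage only one
neighbouring face, and the order of the repairs drives the damage towards the face opposite `i`,
which the horn does not contain (`exists_agrees`, `exists_filler`). -/

lemma inv_δ_natural {A A' B B' : D} (f : A ⟶ A') (g : B ⟶ B') :
    (M.map f ⊗ₘ M.map g) ≫ inv (δ M A' B') = inv (δ M A B) ≫ M.map (f ⊗ₘ g) := by
  rw [IsIso.comp_inv_eq, Category.assoc, ← δ_natural, IsIso.inv_hom_id_assoc]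

lemma inv_δ_natural_left {A A' : D} (f : A ⟶ A') (B : D) :
    M.map f ▷ M.obj B ≫ inv (δ M A' B) = inv (δ M A B) ≫ M.map (f ▷ B) := by
  rw [IsIso.comp_inv_eq, Category.assoc, ← δ_natural_left, IsIso.inv_hom_id_assoc]

lemma inv_δ_natural_right {B B' : D} (A : D) (f : B ⟶ B') :
    M.obj A ◁ M.map f ≫ inv (δ M A B') = inv (δ M A B) ≫ M.map (A ◁ f) := by
  rw [IsIso.comp_inv_eq, Category.assoc, ← δ_natural_right, IsIso.inv_hom_id_assoc]

/-- Coassociativity of `M` with one comultiplication moved to the other side, the form in which it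
meets the left Frobenius identity. -/
lemma map_associator_hom_δ (A B C : D) :
    M.map (α_ A B C).hom ≫ δ M A (B ⊗ C) =
      δ M (A ⊗ B) C ≫ δ M A B ▷ M.obj C ≫ (α_ _ _ _).hom ≫ M.obj A ◁ inv (δ M B C) := by
  have e := congrArg (fun t => t ≫ M.obj A ◁ inv (δ M B C)) (associativity M A B C)
  simp only [Category.assoc, whiskerLeft_hom_inv', Category.comp_id] at e
  exact e.symm

lemma map_associator_inv_δ (A B C : D) :
    M.map (α_ A B C).inv ≫ δ M (A ⊗ B) C =
      δ M A (B ⊗ C) ≫ M.obj A ◁ δ M B C ≫ (α_ _ _ _).inv ≫ inv (δ M A B) ▷ M.obj C := by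
  have e := congrArg (fun t => t ≫ inv (δ M A B) ▷ M.obj C) (associativity_inv M A B C)
  simp only [Category.assoc, hom_inv_whiskerRight', Category.comp_id] at e
  exact e.symm

variable {H : C ⥤ D} [H.OplaxMonoidal]

/-- A strong monoidal functor preserves nonassociative Frobenius structures. -/
noncomputable def compStrongMonoidal (Z : NaFStructure H) [IsIso (η M)] :
    NaFStructure (H ⋙ M) where
  unit := inv (η M) ≫ M.map Z.unit
  mul A B := inv (δ M (H.obj A) (H.obj B)) ≫ M.map (Z.mul A B)
  mul_natural f g := by
    simp only [Functor.comp_obj, Functor.comp_map, Category.assoc]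
    rw [← Category.assoc, inv_δ_natural, Category.assoc, ← M.map_comp, ← M.map_comp,
      Z.mul_natural]
  frobenius_left A B C := by
    simp only [comp_δ, Functor.comp_obj, Functor.comp_map, Category.assoc, comp_whiskerRight,
      whiskerLeft_comp]
    have e := congrArg M.map (Z.frobenius_left A B C)
    simp only [M.map_comp] at e
    -- The identity for `H` is used under `M`; coassociativity of `M` then brings each `δ M` next to
    -- its inverse.
    rw [← reassoc_of% e, ← δ_natural_right, reassoc_of% map_associator_hom_δ,
      ← δ_natural_left_assoc, IsIso.inv_hom_id_assoc]
  frobenius_right A B C := by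
    simp only [comp_δ, Functor.comp_obj, Functor.comp_map, Category.assoc, comp_whiskerRight,
      whiskerLeft_comp]
    have e := congrArg M.map (Z.frobenius_right A B C)
    simp only [M.map_comp] at e
    rw [← reassoc_of% e, ← δ_natural_left, reassoc_of% map_associator_inv_δ,
      ← δ_natural_right_assoc, IsIso.inv_hom_id_assoc]
  mul_unit A := by
    simp only [Functor.comp_obj, Functor.comp_map, Category.assoc, whiskerLeft_comp]
    rw [reassoc_of% inv_δ_natural_right, ← M.map_comp, ← M.map_comp, Z.mul_unit]
    -- Precomposing with the invertible counit and comultiplication removes both inverses and leaves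
    -- unitality of `M`.
    rw [← cancel_epi (M.obj (H.obj A) ◁ η M), whiskerLeft_hom_inv'_assoc,
      ← cancel_epi (δ M (H.obj A) (𝟙_ D)), IsIso.hom_inv_id_assoc, right_unitality_hom]
  unit_mul A := by
    simp only [Functor.comp_obj, Functor.comp_map, Category.assoc, comp_whiskerRight]
    rw [reassoc_of% inv_δ_natural_left, ← M.map_comp, ← M.map_comp, Z.unit_mul]
    rw [← cancel_epi (η M ▷ M.obj (H.obj A)), hom_inv_whiskerRight'_assoc,
      ← cancel_epi (δ M (𝟙_ D) (H.obj A)), IsIso.hom_inv_id_assoc, left_unitality_hom]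
  unit_counit := by
    simp only [comp_η, Category.assoc]
    rw [← M.map_comp_assoc, Z.unit_counit, M.map_id, Category.id_comp, IsIso.inv_hom_id]
  counit_unit := by
    simp only [comp_η, Category.assoc]
    rw [IsIso.hom_inv_id_assoc, ← M.map_comp, Z.counit_unit, M.map_id]
    rfl

end StrongMonoidal

/-- The multiplication of a nonassociative Frobenius structure is a section of the
comultiplication. -/
lemma mul_δ {H : C ⥤ D} [H.OplaxMonoidal] (Z : NaFStructure H) (A B : C) :
    Z.mul A B ≫ δ H A B = 𝟙 _ := by
  have e1 : η H ▷ H.obj B ≫ (λ_ (H.obj B)).hom = Z.mul (𝟙_ C) B ≫ H.map (λ_ B).hom := by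
    rw [← Z.unit_mul, ← comp_whiskerRight_assoc, Z.counit_unit, id_whiskerRight,
      Category.id_comp]
  -- The Frobenius identity with the unit as middle object: its left side reduces to the right
  -- unitor by counitality, its right side to the multiplication followed by the comultiplication.
  have e2 := congrArg (fun t => t ≫ H.obj A ◁ H.map (λ_ B).hom) (Z.frobenius_left A (𝟙_ C) B)
  simp only [Category.assoc] at e2
  rw [← whiskerLeft_comp, ← e1, whiskerLeft_comp, ← associator_naturality_middle_assoc,
    triangle, ← comp_whiskerRight, ← comp_whiskerRight, right_unitality_hom, δ_natural_right,
    ← H.map_comp_assoc, triangle] at e2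
  have e3 := Z.mul_natural (ρ_ A).hom (𝟙 B)
  rw [H.map_id, tensorHom_id, tensorHom_id] at e3
  rw [← reassoc_of% e3] at e2
  rw [← cancel_epi (H.map (ρ_ A).hom ▷ H.obj B), ← e2, Category.comp_id]

end NaFStructure

/-- The free functor is strong monoidal, and so is the functor it induces on quivers, because that
functor acts entrywise and preserves the coproducts in the tensor product. Thus `compStrongMonoidal`
applies, and the formula for the product is its definition. -/
theorem exists_naFStructure_freeTemplicial (V : Type w) [Category.{u} V] [MonoidalCategory V]
    [TensorCocomplete V] (X : SSet.{u}) (Z : NaFStructure (ofSSet.obj X).functor) :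
    ∃ Z' : NaFStructure ((freeTemplicial V).obj X).functor, ∀ m n : FinIntᵒᵖ,
      Z'.mul m n =
        inv (δ (VQuiver.mapQuiver (freeFunctor V) (ofSSet.obj X).base)
            ((ofSSet.obj X).functor.obj m) ((ofSSet.obj X).functor.obj n)) ≫
          (VQuiver.mapQuiver (freeFunctor V) (ofSSet.obj X).base).map (Z.mul m n) :=
  ⟨Z.compStrongMonoidal (VQuiver.mapQuiver (freeFunctor V) (ofSSet.obj X).base),
    fun _ _ => rfl⟩

/-! ### Quasi-categories have nonassociative Frobenius structures -/

/-! ### Retractions onto initial and final segments, and sections of surjections. -/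

namespace SimplexCategory

lemma hom_ext_apply {m n : ℕ} {f g : ⦋m⦌ ⟶ ⦋n⦌} (h : ∀ i, f.toOrderHom i = g.toOrderHom i) :
    f = g :=
  Hom.ext _ _ (OrderHom.ext _ _ (funext h))

/-- The map `[n] ⟶ [n]` that retracts onto the initial segment ending in `p`. -/
def toFront {n : ℕ} (p : Fin (n + 1)) : ⦋n⦌ ⟶ ⦋n⦌ :=
  Hom.mk ⟨fun i => min i p, fun _ _ h => min_le_min_right p h⟩

/-- The map `[n] ⟶ [n]` that retracts onto the final segment starting in `p`. -/
def toBack {n : ℕ} (p : Fin (n + 1)) : ⦋n⦌ ⟶ ⦋n⦌ :=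
  Hom.mk ⟨fun i => max i p, fun _ _ h => max_le_max_right p h⟩

/-- Monotone maps commute with `min`. Hence wedges can be pulled back along any map that hits the
joint, without cutting the map into two pieces. -/
lemma toFront_comp {m n : ℕ} (h : ⦋m⦌ ⟶ ⦋n⦌) {r : Fin (m + 1)} {p : Fin (n + 1)}
    (hr : h.toOrderHom r = p) : toFront r ≫ h = h ≫ toFront p :=
  hom_ext_apply fun i => (h.toOrderHom.monotone.map_min (a := i) (b := r)).trans
    (congrArg (min (h.toOrderHom i)) hr)

lemma toBack_comp {m n : ℕ} (h : ⦋m⦌ ⟶ ⦋n⦌) {r : Fin (m + 1)} {p : Fin (n + 1)}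
    (hr : h.toOrderHom r = p) : toBack r ≫ h = h ≫ toBack p :=
  hom_ext_apply fun i => (h.toOrderHom.monotone.map_max (a := i) (b := r)).trans
    (congrArg (max (h.toOrderHom i)) hr)

lemma toFront_apply_self {n : ℕ} (p : Fin (n + 1)) : (toFront p).toOrderHom p = p :=
  min_self p

lemma toBack_apply_self {n : ℕ} (p : Fin (n + 1)) : (toBack p).toOrderHom p = p :=
  max_self p

lemma toFront_last (n : ℕ) : toFront (Fin.last n) = 𝟙 ⦋n⦌ :=
  hom_ext_apply fun i => min_eq_left (Fin.le_last i)

lemma toBack_zero (n : ℕ) : toBack (0 : Fin (n + 1)) = 𝟙 ⦋n⦌ :=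
  hom_ext_apply fun i => max_eq_left (Fin.zero_le i)

lemma exists_epi_mono {m n : ℕ} (h : ⦋m⦌ ⟶ ⦋n⦌) :
    ∃ (k : ℕ) (e : ⦋m⦌ ⟶ ⦋k⦌) (i : ⦋k⦌ ⟶ ⦋n⦌), Epi e ∧ Mono i ∧ e ≫ i = h :=
  ⟨(image h).len, factorThruImage h, image.ι h, inferInstanceAs (Epi (factorThruImage h)),
    inferInstanceAs (Mono (image.ι h)), image.fac h⟩

/-- A choice of preimages under a monotone map is monotone. -/
lemma exists_section {m n : ℕ} (h : ⦋n⦌ ⟶ ⦋m⦌) (c : Fin (m + 1) → Fin (n + 1))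
    (hc : ∀ j, h.toOrderHom (c j) = j) :
    ∃ s : ⦋m⦌ ⟶ ⦋n⦌, s ≫ h = 𝟙 _ ∧ ∀ j, s.toOrderHom j = c j := by
  refine ⟨Hom.mk ⟨c, fun a b hab => ?_⟩, hom_ext_apply hc, fun _ => rfl⟩
  by_contra hlt
  have h1 := h.toOrderHom.monotone (not_le.mp hlt).le
  have h2 : b ≤ a := (hc b).symm.le.trans (h1.trans (hc a).le)
  exact hlt (le_of_eq (congrArg c (le_antisymm hab h2)))

/-- A surjection has a section with a prescribed value `p`, and also with a second prescribed
value `j` if `p` and `j` do not have the same image. -/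
lemma exists_section_apply {m n : ℕ} (h : ⦋n⦌ ⟶ ⦋m⦌) [Epi h] (p j : Fin (n + 1))
    (hj : h.toOrderHom j = h.toOrderHom p → j = p) :
    ∃ s : ⦋m⦌ ⟶ ⦋n⦌, s ≫ h = 𝟙 _ ∧ s.toOrderHom (h.toOrderHom p) = p ∧
      s.toOrderHom (h.toOrderHom j) = j := by
  have hs : Function.Surjective h.toOrderHom := epi_iff_surjective.mp inferInstance
  -- The prescription `j` overrides `p`; they collide only over the same image, where `hj` says that
  -- they coincide.
  obtain ⟨s, hs1, hs2⟩ := exists_section h (Function.update (Function.update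
    (Function.surjInv hs) (h.toOrderHom p) p) (h.toOrderHom j) j) fun i => by
      by_cases h1 : i = h.toOrderHom j
      · subst h1
        rw [Function.update_self]
      · rw [Function.update_of_ne h1]
        by_cases h2 : i = h.toOrderHom p
        · subst h2
          rw [Function.update_self]
        · rw [Function.update_of_ne h2]
          exact Function.surjInv_eq hs i
  refine ⟨s, hs1, ?_, ?_⟩
  · rw [hs2]
    by_cases h1 : h.toOrderHom p = h.toOrderHom j
    · rw [h1, Function.update_self]
      exact hj h1.symm
    · rw [Function.update_of_ne h1, Function.update_self]
  · rw [hs2, Function.update_self]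

end SimplexCategory

/-! ### Coherent fillers of wedges in a quasi-category. -/

namespace SSet

open SimplexCategory

variable {X : SSet.{u}}

lemma map_op_comp {l m n : ℕ} (f : ⦋l⦌ ⟶ ⦋m⦌) (g : ⦋m⦌ ⟶ ⦋n⦌) (y : X _⦋n⦌) :
    X.map f.op (X.map g.op y) = X.map (f ≫ g).op y :=
  SSetTemplicial.map_map f g y

lemma map_op_id {n : ℕ} (y : X _⦋n⦌) : X.map (𝟙 ⦋n⦌).op y = y := by
  rw [op_id, CategoryTheory.Functor.map_id]; exact types_id_apply _ _

/-- The simplices `x` and `y` are the degenerate extensions of simplices on the vertices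
`0, …, p` and `p, …, n` that have the vertex `p` in common. -/
structure IsWedge {n : ℕ} (p : Fin (n + 1)) (x y : X _⦋n⦌) : Prop where
  front : X.map (toFront p).op x = x
  back : X.map (toBack p).op y = y
  glue : X.map (toBack p).op x = X.map (toFront p).op y

lemma IsWedge.map {m n : ℕ} {p : Fin (n + 1)} {x y : X _⦋n⦌} (w : IsWedge p x y)
    (h : ⦋m⦌ ⟶ ⦋n⦌) {r : Fin (m + 1)} (hr : h.toOrderHom r = p) :
    IsWedge r (X.map h.op x) (X.map h.op y) where
  front := by rw [map_op_comp, toFront_comp h hr, ← map_op_comp, w.front]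
  back := by rw [map_op_comp, toBack_comp h hr, ← map_op_comp, w.back]
  glue := by rw [map_op_comp, map_op_comp, toFront_comp h hr, toBack_comp h hr, ← map_op_comp,
    ← map_op_comp, w.glue]

/-- The conditions on a simplex `v` that extends the wedge of `x` and `y`, relative to a choice `F`
of such simplices in lower dimensions. -/
structure IsFiller {n : ℕ} (p : Fin (n + 1)) (x y v : X _⦋n⦌)
    (F : ∀ m < n, Fin (m + 1) → X _⦋m⦌ → X _⦋m⦌ → X _⦋m⦌) : Prop where
  front : X.map (toFront p).op v = x
  back : X.map (toBack p).op v = y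
  restrict : ∀ (m : ℕ) (hm : m < n) (h : ⦋m⦌ ⟶ ⦋n⦌) (r : Fin (m + 1)), h.toOrderHom r = p →
    X.map h.op v = F m hm r (X.map h.op x) (X.map h.op y)
  -- Required for every presentation of the wedge as a pullback along a surjection, so that
  -- naturality does not depend on a chosen factorisation.
  degenerate : ∀ (m : ℕ) (hm : m < n) (h : ⦋n⦌ ⟶ ⦋m⦌) (x' y' : X _⦋m⦌), Epi h →
    IsWedge (h.toOrderHom p) x' y' → X.map h.op x' = x → X.map h.op y' = y →
    v = X.map h.op (F m hm (h.toOrderHom p) x' y')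

open Classical in
/-- A coherent choice of simplices that extend wedges. -/
noncomputable def filler (n : ℕ) (p : Fin (n + 1)) (x y : X _⦋n⦌) : X _⦋n⦌ :=
  -- The default value `x` is not reached for wedges in a quasi-category, by `filled`.
  if h : ∃ v, IsFiller p x y v (fun m _ => filler m) then h.choose else x
termination_by n

variable (X) in
/-- The wedges in dimension `n` are extended by `filler`. -/
def Filled (n : ℕ) : Prop :=
  ∀ (p : Fin (n + 1)) (x y : X _⦋n⦌), IsWedge p x y →
    IsFiller p x y (filler n p x y) fun m _ => filler m

lemma isFiller_filler {n : ℕ} {p : Fin (n + 1)} {x y : X _⦋n⦌}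
    (h : ∃ v, IsFiller p x y v fun m _ => filler m) :
    IsFiller p x y (filler n p x y) fun m _ => filler m := by
  rw [filler, dif_pos h]
  exact h.choose_spec

/-- Factor `h` into a surjection followed by an injection. The injection is handled by `restrict`
and the surjection by `degenerate`; a factor that does not change the dimension is an identity. -/
lemma filler_natural {n : ℕ} (hF : ∀ k < n, Filled X k) {m m' : ℕ} (hm : m < n) (hm' : m' < n)
    (h : ⦋m⦌ ⟶ ⦋m'⦌) {r : Fin (m + 1)} {p : Fin (m' + 1)} (hr : h.toOrderHom r = p)
    {x y : X _⦋m'⦌} (w : IsWedge p x y) :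
    X.map h.op (filler m' p x y) = filler m r (X.map h.op x) (X.map h.op y) := by
  obtain ⟨k, e, i, _, _, rfl⟩ := exists_epi_mono h
  have h1 : X.map i.op (filler m' p x y) =
      filler k (e.toOrderHom r) (X.map i.op x) (X.map i.op y) := by
    obtain hk | rfl := (le_of_mono i).lt_or_eq
    · exact (hF m' hm' p x y w).restrict k hk i _ hr
    · obtain rfl := eq_id_of_mono i
      rw [map_op_id, map_op_id, map_op_id]
      exact congrArg (fun p => filler k p x y) hr.symm
  have w1 : IsWedge (e.toOrderHom r) (X.map i.op x) (X.map i.op y) := w.map i hr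
  rw [← map_op_comp, ← map_op_comp, ← map_op_comp, h1]
  obtain hk | rfl := (le_of_epi e).lt_or_eq
  · exact ((hF m hm r _ _ (w1.map e rfl)).degenerate k hk e _ _ inferInstance w1 rfl rfl).symm
  · obtain rfl := eq_id_of_epi e
    rw [map_op_id, map_op_id, map_op_id]
    rfl

/-- The wedge of `x` and `y` is degenerate along a map onto `[m]`. -/
def DegenerateWedge {n : ℕ} (p : Fin (n + 1)) (x y : X _⦋n⦌) (m : ℕ) : Prop :=
  ∃ (h : ⦋n⦌ ⟶ ⦋m⦌) (x' y' : X _⦋m⦌), Epi h ∧ IsWedge (h.toOrderHom p) x' y' ∧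
    X.map h.op x' = x ∧ X.map h.op y' = y

section Nondegenerate

variable {m : ℕ} {q : Fin (m + 1)} {x y : X _⦋m⦌} (w : IsWedge q x y)
  (hw : ∀ l < m, ¬ DegenerateWedge q x y l)

include w hw

/-- If `k` were not the identity, its image factorisation would exhibit the wedge as degenerate
along a map to a smaller simplex. -/
lemma eq_id_of_map_eq (k : ⦋m⦌ ⟶ ⦋m⦌) (hk : k.toOrderHom q = q) (hx : X.map k.op x = x)
    (hy : X.map k.op y = y) : k = 𝟙 _ := by
  obtain ⟨l, e, i, _, _, rfl⟩ := exists_epi_mono k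
  obtain hl | rfl := (le_of_mono i).lt_or_eq
  · refine (hw l hl ⟨e, X.map i.op x, X.map i.op y, inferInstance, w.map i hk, ?_, ?_⟩).elim
    · rw [map_op_comp, hx]
    · rw [map_op_comp, hy]
  · rw [eq_id_of_mono i, eq_id_of_epi e, Category.comp_id]

/-- A section `s` of `h` through `p` and `j` makes `s ≫ k` fix the joint and the wedge, so `s ≫ k`
is the identity. This splits `k`, and evaluation at the image of `j` compares the two maps there. -/
lemma apply_eq_of_map_eq {n : ℕ} (h k : ⦋n⦌ ⟶ ⦋m⦌) [Epi h] {p : Fin (n + 1)}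
    (hh : h.toOrderHom p = q) (hk : k.toOrderHom p = q) (hx : X.map h.op x = X.map k.op x)
    (hy : X.map h.op y = X.map k.op y) {j : Fin (n + 1)} (hj : h.toOrderHom j = q → j = p) :
    Epi k ∧ k.toOrderHom j = h.toOrderHom j := by
  subst hh
  obtain ⟨s, hs, hp, hj⟩ := exists_section_apply h p j hj
  have e : s ≫ k = 𝟙 _ := by
    refine eq_id_of_map_eq w hw (s ≫ k) ?_ ?_ ?_
    · exact (congrArg k.toOrderHom hp).trans hk
    · rw [← map_op_comp, ← hx, map_op_comp, hs, map_op_id]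
    · rw [← map_op_comp, ← hy, map_op_comp, hs, map_op_id]
  refine ⟨(SplitEpi.mk s e).epi, ?_⟩
  rw [← hj]
  refine (congrArg (fun t : ⦋m⦌ ⟶ ⦋m⦌ => t.toOrderHom (h.toOrderHom j)) e).trans ?_
  rw [hj]
  rfl

/-- A nondegenerate wedge is pulled back to the same wedge only along the same map. -/
lemma eq_of_map_eq {n : ℕ} (h k : ⦋n⦌ ⟶ ⦋m⦌) [Epi h] {p : Fin (n + 1)}
    (hh : h.toOrderHom p = q) (hk : k.toOrderHom p = q) (hx : X.map h.op x = X.map k.op x)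
    (hy : X.map h.op y = X.map k.op y) : h = k := by
  refine hom_ext_apply fun j => ?_
  -- The case `j = p` shows that `k` is surjective, so the roles of `h` and `k` can be exchanged.
  have := (apply_eq_of_map_eq w hw h k hh hk hx hy (fun _ : h.toOrderHom p = q => rfl)).1
  -- A section of `h` through `p` cannot also pass through another point of the same fibre. For such
  -- a point a section of `k` is used, unless `k` sends it to the joint as well.
  by_cases hj : h.toOrderHom j = q
  · by_cases hj' : k.toOrderHom j = q
    · rw [hj, hj']
    · exact (apply_eq_of_map_eq w hw k h hk hh hx.symm hy.symm (fun e => (hj' e).elim)).2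
  · exact (apply_eq_of_map_eq w hw h k hh hk hx hy (fun e => (hj e).elim)).2.symm

end Nondegenerate

/-- Present the wedge by a wedge of least dimension and pull back its filler. The latter wedge is
nondegenerate, so its surjection `h` is unique; hence `h` factors through any other surjection `k`
that presents the given wedge, and the two candidate values agree by naturality. -/
lemma exists_isFiller_of_degenerate {n : ℕ} (hF : ∀ k < n, Filled X k) {p : Fin (n + 1)}
    {x y : X _⦋n⦌} (hd : ∃ m < n, DegenerateWedge p x y m) :
    ∃ v, IsFiller p x y v fun m _ => filler m := by
  classical
  obtain ⟨hm, h, x₁, y₁, _, w₁, hx, hy⟩ := Nat.find_spec hd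
  have hmin := fun l => Nat.find_min hd (m := l)
  revert hm h x₁ y₁ hmin
  generalize Nat.find hd = m
  intro hm h x₁ y₁ _ w₁ hx hy hmin
  -- A further degeneracy of the smaller wedge would compose with `h` and contradict minimality.
  have hw : ∀ l < m, ¬ DegenerateWedge (h.toOrderHom p) x₁ y₁ l := by
    rintro l hl ⟨g, x₂, y₂, _, w₂, hx', hy'⟩
    refine hmin l hl ⟨hl.trans hm, h ≫ g, x₂, y₂, epi_comp h g, w₂, ?_, ?_⟩
    · rw [← map_op_comp, hx', hx]
    · rw [← map_op_comp, hy', hy]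
  have h₁ := hF m hm _ _ _ w₁
  refine ⟨X.map h.op (filler m (h.toOrderHom p) x₁ y₁), ?_, ?_, ?_, ?_⟩
  · rw [map_op_comp, toFront_comp h rfl, ← map_op_comp, h₁.front, hx]
  · rw [map_op_comp, toBack_comp h rfl, ← map_op_comp, h₁.back, hy]
  · intro l hl k r hr
    rw [map_op_comp, ← hx, ← hy, map_op_comp, map_op_comp]
    exact filler_natural hF hl hm (k ≫ h) (congrArg h.toOrderHom hr) w₁
  · intro l hl k x' y' _ w' hx' hy'
    obtain ⟨s, hs, hp, -⟩ := exists_section_apply k p p fun _ => rfl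
    have ex : x' = X.map (s ≫ h).op x₁ := by
      rw [← map_op_comp, hx, ← hx', map_op_comp, hs, map_op_id]
    have ey : y' = X.map (s ≫ h).op y₁ := by
      rw [← map_op_comp, hy, ← hy', map_op_comp, hs, map_op_id]
    -- Both maps pull the nondegenerate wedge back to the given one, so uniqueness applies.
    have e : h = k ≫ s ≫ h := by
      refine eq_of_map_eq w₁ hw h (k ≫ s ≫ h) rfl (congrArg h.toOrderHom hp) ?_ ?_
      · rw [hx, ← map_op_comp, ← ex, hx']
      · rw [hy, ← map_op_comp, ← ey, hy']
    have hsh : (s ≫ h).toOrderHom (k.toOrderHom p) = h.toOrderHom p := congrArg h.toOrderHom hp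
    refine Eq.trans ?_ (congrArg (X.map k.op) ((filler_natural hF hl hm (s ≫ h) hsh w₁).trans ?_))
    · rw [map_op_comp, ← e]
    · rw [← ex, ← ey]

/-- The initial segment is a point, so `y` itself is the filler. It restricts correctly because a
lower filler at such a joint is unchanged by `toBack r`, and its `toBack r` is the restriction of
`y`. -/
lemma exists_isFiller_zero {n : ℕ} (hF : ∀ k < n, Filled X k) {x y : X _⦋n⦌}
    (w : IsWedge 0 x y) (hd : ¬ ∃ m < n, DegenerateWedge 0 x y m) :
    ∃ v, IsFiller 0 x y v fun m _ => filler m := by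
  refine ⟨y, ?_, w.back, ?_, ?_⟩
  · rw [← w.glue, toBack_zero, map_op_id]
  · intro m hm h r hr
    have w' := w.map h hr
    have e : toBack r ≫ h = h := by rw [toBack_comp h hr, toBack_zero, Category.comp_id]
    have hx : X.map (toBack r).op (X.map h.op x) = X.map h.op x := by rw [map_op_comp, e]
    have h1 := filler_natural hF hm hm (toBack r) (toBack_apply_self r) w'
    rw [hx, w'.back, (hF m hm _ _ _ w').back] at h1
    exact h1
  · intro m hm h x' y' he w' hx hy
    exact (hd ⟨m, hm, h, x', y', he, w', hx, hy⟩).elim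

lemma exists_isFiller_last {n : ℕ} (hF : ∀ k < n, Filled X k) {x y : X _⦋n⦌}
    (w : IsWedge (Fin.last n) x y) (hd : ¬ ∃ m < n, DegenerateWedge (Fin.last n) x y m) :
    ∃ v, IsFiller (Fin.last n) x y v fun m _ => filler m := by
  refine ⟨x, w.front, ?_, ?_, ?_⟩
  · rw [w.glue, toFront_last, map_op_id]
  · intro m hm h r hr
    have w' := w.map h hr
    have e : toFront r ≫ h = h := by rw [toFront_comp h hr, toFront_last, Category.comp_id]
    have hy : X.map (toFront r).op (X.map h.op y) = X.map h.op y := by rw [map_op_comp, e]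
    have h1 := filler_natural hF hm hm (toFront r) (toFront_apply_self r) w'
    rw [hy, w'.front, (hF m hm _ _ _ w').front] at h1
    exact h1
  · intro m hm h x' y' he w' hx hy
    exact (hd ⟨m, hm, h, x', y', he, w', hx, hy⟩).elim

/-- Compatible families of faces of inner horns in a quasi-category are the faces of a simplex. -/
lemma exists_of_compatible_faces [Quasicategory X] {n : ℕ} {i : Fin (n + 3)} (h0 : 0 < i)
    (hn : i < Fin.last (n + 2)) (y : ∀ j : Fin (n + 3), j ≠ i → X _⦋n + 1⦌)
    (hy : ∀ (j k : Fin (n + 3)) (hj : j ≠ i) (hk : k ≠ i) (hjk : j < k),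
      X.map (SimplexCategory.δ (k.pred (Fin.ne_zero_of_lt hjk))).op (y j hj) =
        X.map (SimplexCategory.δ (j.castPred (Fin.ne_last_of_lt hjk))).op (y k hk)) :
    ∃ v : X _⦋n + 2⦌, ∀ (j : Fin (n + 3)) (hj : j ≠ i),
      X.map (SimplexCategory.δ j).op v = y j hj := by
  have hc : horn.IsCompatible (X := X) (i := i) fun j hj => yonedaEquiv.symm (y j hj) := by
    rw [horn.isCompatible_iff]
    intro j k hj hk hjk
    refine (yonedaEquiv_symm_naturality_left _ _).trans
      (Eq.trans ?_ (yonedaEquiv_symm_naturality_left _ _).symm)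
    exact congrArg _ (hy j k hj hk hjk)
  obtain ⟨φ, hφ⟩ := hc.exists_desc
  obtain ⟨σ, rfl⟩ := Quasicategory.hornFilling h0 hn φ
  refine ⟨yonedaEquiv σ, fun j hj => ?_⟩
  have h1 := hφ j hj
  rw [horn.ι_ι_assoc] at h1
  exact (yonedaEquiv_naturality _ _).trans
    ((congrArg yonedaEquiv h1).trans (Equiv.apply_symm_apply _ _))

lemma toFront_ne_last {n : ℕ} {p : Fin (n + 1)} (hp : p < Fin.last n) (i : Fin (n + 1)) :
    (toFront p).toOrderHom i ≠ Fin.last n :=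
  ((min_le_right i p).trans_lt hp).ne

lemma toBack_ne_zero {n : ℕ} {p : Fin (n + 1)} (hp : 0 < p) (i : Fin (n + 1)) :
    (toBack p).toOrderHom i ≠ 0 :=
  (hp.trans_le (le_max_right i p)).ne'

/-- Lower fillers prescribe the face opposite each `j ≠ p`, and they agree on common faces by
naturality, since these still contain `p`. The remaining face is opposite an interior vertex, so
this is an inner horn. Any map from a smaller simplex through `p` factors through one of the
prescribed faces. Degeneracies impose no condition because the wedge is nondegenerate. -/
lemma exists_isFiller_interior [Quasicategory X] {n : ℕ} (hF : ∀ k < n + 2, Filled X k)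
    {p : Fin (n + 3)} (h0 : 0 < p) (hl : p < Fin.last (n + 2)) {x y : X _⦋n + 2⦌}
    (w : IsWedge p x y) (hd : ¬ ∃ m < n + 2, DegenerateWedge p x y m) :
    ∃ v, IsFiller p x y v fun m _ => filler m := by
  -- The vertex `r j` is the position of the joint `p` inside the face opposite `j`.
  choose r hr using fun (j : Fin (n + 3)) (hj : j ≠ p) => Fin.exists_succAbove_eq hj.symm
  have wf := fun (j : Fin (n + 3)) (hj : j ≠ p) => w.map (SimplexCategory.δ j) (hr j hj)
  let z := fun (j : Fin (n + 3)) (hj : j ≠ p) =>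
    filler (n + 1) (r j hj) (X.map (SimplexCategory.δ j).op x) (X.map (SimplexCategory.δ j).op y)
  have hz {m : ℕ} (hm : m < n + 2) (j : Fin (n + 3)) (hj : j ≠ p) (k : ⦋m⦌ ⟶ ⦋n + 1⦌)
      {q : Fin (m + 1)} (hq : (k ≫ SimplexCategory.δ j).toOrderHom q = p) :
      X.map k.op (z j hj) = filler m q (X.map (k ≫ SimplexCategory.δ j).op x)
        (X.map (k ≫ SimplexCategory.δ j).op y) := by
    rw [← map_op_comp, ← map_op_comp]
    refine filler_natural hF hm (Nat.lt_succ_self _) k ?_ (wf j hj)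
    exact Fin.succAbove_right_injective (p := j) (hq.trans (hr j hj).symm)
  obtain ⟨v, hv⟩ := exists_of_compatible_faces h0 hl z fun j k hj hk hjk => by
    have e : SimplexCategory.δ (k.pred (Fin.ne_zero_of_lt hjk)) ≫ SimplexCategory.δ j =
        SimplexCategory.δ (j.castPred (Fin.ne_last_of_lt hjk)) ≫ SimplexCategory.δ k := by
      obtain ⟨j, rfl⟩ := j.eq_castSucc_of_ne_last (Fin.ne_last_of_lt hjk)
      obtain ⟨k, rfl⟩ := k.eq_succ_of_ne_zero (Fin.ne_zero_of_lt hjk)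
      rw [Fin.pred_succ, Fin.castPred_castSucc]
      exact (SimplexCategory.δ_comp_δ (Fin.castSucc_lt_succ_iff.mp hjk)).symm
    -- The joint survives in the common face because it is neither of the two removed vertices.
    obtain ⟨q, hq⟩ : ∃ q, (SimplexCategory.δ (k.pred (Fin.ne_zero_of_lt hjk))).toOrderHom q =
        r j hj := by
      refine Fin.exists_succAbove_eq fun h => hk ?_
      rw [← hr j hj, h]
      exact (Fin.succAbove_pred_of_lt _ _ hjk).symm
    have hq' : (SimplexCategory.δ (k.pred (Fin.ne_zero_of_lt hjk)) ≫
        SimplexCategory.δ j).toOrderHom q = p :=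
      (congrArg (SimplexCategory.δ j).toOrderHom hq).trans (hr j hj)
    rw [hz (Nat.lt_succ_of_lt (Nat.lt_succ_self n)) j hj _ hq',
      hz (Nat.lt_succ_of_lt (Nat.lt_succ_self n)) k hk _
        ((congrArg (fun t => t.toOrderHom q) e).symm.trans hq'), e]
  refine ⟨v, ?_, ?_, ?_, ?_⟩
  -- As `p` is not the last vertex, the retraction onto the initial segment factors through the last
  -- face, where the condition `front` is known.
  · obtain ⟨k, hk⟩ := eq_comp_δ_of_not_surjective' (toFront p) _ (toFront_ne_last hl)
    have e : k ≫ toFront (r _ hl.ne') = k := by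
      rw [← cancel_mono (SimplexCategory.δ (Fin.last (n + 2))), Category.assoc,
        toFront_comp (SimplexCategory.δ _) (hr _ hl.ne'), ← reassoc_of% hk, ← hk]
      exact hom_ext_apply fun i => min_eq_left (min_le_right i p)
    rw [hk, ← map_op_comp, hv _ hl.ne', ← e, ← map_op_comp,
      (hF _ (Nat.lt_succ_self _) _ _ _ (wf _ hl.ne')).front, map_op_comp, ← hk, w.front]
  · obtain ⟨k, hk⟩ := eq_comp_δ_of_not_surjective' (toBack p) _ (toBack_ne_zero h0)
    have e : k ≫ toBack (r _ h0.ne) = k := by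
      rw [← cancel_mono (SimplexCategory.δ (0 : Fin (n + 3))), Category.assoc,
        toBack_comp (SimplexCategory.δ _) (hr _ h0.ne), ← reassoc_of% hk, ← hk]
      exact hom_ext_apply fun i => max_eq_left (le_max_right i p)
    rw [hk, ← map_op_comp, hv _ h0.ne, ← e, ← map_op_comp,
      (hF _ (Nat.lt_succ_self _) _ _ _ (wf _ h0.ne)).back, map_op_comp, ← hk, w.back]
  · intro m hm k q hq
    -- By counting, a map from a smaller simplex misses some vertex, which is not `p` since `p` is
    -- hit.
    obtain ⟨j, hj⟩ : ∃ j, ∀ i, k.toOrderHom i ≠ j := by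
      by_contra! hs
      have := Fintype.card_le_of_surjective _ hs
      simp only [len_mk, Fintype.card_fin] at this
      omega
    have hjp : j ≠ p := fun e => hj q (hq.trans e.symm)
    obtain ⟨k, rfl⟩ := eq_comp_δ_of_not_surjective' k j hj
    rw [← map_op_comp, hv j hjp]
    exact hz hm j hjp k hq
  · intro m hm h x' y' he w' hx hy
    exact (hd ⟨m, hm, h, x', y', he, w', hx, hy⟩).elim

/-- Strong induction on the dimension. Degenerate wedges have to be settled before any horn is
filled, since an arbitrary horn filler need not respect degeneracies. -/
theorem filled [Quasicategory X] (n : ℕ) : Filled X n := by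
  induction n using Nat.strong_induction_on with
  | _ n hF =>
    intro p x y w
    apply isFiller_filler
    by_cases hd : ∃ m < n, DegenerateWedge p x y m
    · exact exists_isFiller_of_degenerate hF hd
    obtain rfl | h0 := eq_or_ne p 0
    · exact exists_isFiller_zero hF w hd
    obtain rfl | hl := eq_or_ne p (Fin.last n)
    · exact exists_isFiller_last hF w hd
    rw [← Fin.pos_iff_ne_zero] at h0
    rw [← Fin.lt_last_iff_ne_last] at hl
    -- Dimensions zero and one have no interior vertex.
    obtain _ | _ | n := n
    · omega
    · omega
    · exact exists_isFiller_interior hF h0 hl w hd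

lemma filler_map [Quasicategory X] {m n : ℕ} (h : ⦋m⦌ ⟶ ⦋n⦌) {r : Fin (m + 1)}
    {p : Fin (n + 1)} (hr : h.toOrderHom r = p) {x y : X _⦋n⦌} (w : IsWedge p x y) :
    X.map h.op (filler n p x y) = filler m r (X.map h.op x) (X.map h.op y) :=
  filler_natural (n := max m n + 1) (fun k _ => filled k) (Nat.lt_succ_of_le (le_max_left _ _))
    (Nat.lt_succ_of_le (le_max_right _ _)) h hr w

end SSet

/-! ### Maps of `[m + n]` that split at the joint. -/

namespace FinInt

/-- The vertex `m` of `[m + n]`. -/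
def joint (m n : FinInt) : Fin (m.len + n.len + 1) :=
  ⟨m.len, Nat.lt_succ_of_le (Nat.le_add_right _ _)⟩

/-- The retraction of `[m + n]` onto the initial segment `[m]`. -/
def frontRetraction (m n : FinInt) : toSimplex.obj (m ⊗ n) ⟶ toSimplex.obj m :=
  SimplexCategory.Hom.mk
    { toFun := fun i => ⟨min (i : Fin (m.len + n.len + 1)) m.len,
        Nat.lt_succ_of_le (min_le_right _ _)⟩
      monotone' := fun i j h => min_le_min_right m.len
        (show ((i : Fin (m.len + n.len + 1)) : ℕ) ≤ (j : Fin (m.len + n.len + 1)) from h) }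

/-- The retraction of `[m + n]` onto the final segment `[n]`. -/
def backRetraction (m n : FinInt) : toSimplex.obj (m ⊗ n) ⟶ toSimplex.obj n :=
  SimplexCategory.Hom.mk
    { toFun := fun i => ⟨(i : Fin (m.len + n.len + 1)) - m.len, by
        have : ((i : Fin (m.len + n.len + 1)) : ℕ) < m.len + n.len + 1 := Fin.is_lt _
        change _ < n.len + 1
        omega⟩
      monotone' := fun i j h => Nat.sub_le_sub_right
        (show ((i : Fin (m.len + n.len + 1)) : ℕ) ≤ (j : Fin (m.len + n.len + 1)) from h) m.len }

lemma val_le {m : SimplexCategory} {n : FinInt} (f : m ⟶ toSimplex.obj n)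
    (i : Fin (m.len + 1)) : val f i ≤ n.len :=
  Nat.le_of_lt_succ (f.toOrderHom i : Fin (n.len + 1)).2

variable {m n m' n' : FinInt}

lemma front_comp_toFront : front m n ≫ SimplexCategory.toFront (joint m n) = front m n :=
  toSimplex_hom_ext fun (i : Fin (m.len + 1)) =>
    congrArg Fin.val (min_eq_left (show (⟨i, by omega⟩ : Fin (m.len + n.len + 1)) ≤ joint m n from
      Nat.le_of_lt_succ i.2))

lemma back_comp_toBack : back m n ≫ SimplexCategory.toBack (joint m n) = back m n :=
  toSimplex_hom_ext fun (i : Fin (n.len + 1)) =>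
    congrArg Fin.val (max_eq_left (show joint m n ≤ (⟨m.len + i, by omega⟩ :
      Fin (m.len + n.len + 1)) from Nat.le_add_right _ _))

lemma front_comp_frontRetraction : front m n ≫ frontRetraction m n = 𝟙 _ :=
  toSimplex_hom_ext fun (i : Fin (m.len + 1)) => min_eq_left (Nat.le_of_lt_succ i.2)

lemma back_comp_backRetraction : back m n ≫ backRetraction m n = 𝟙 _ :=
  toSimplex_hom_ext fun (i : Fin (n.len + 1)) => Nat.add_sub_cancel_left m.len i

lemma frontRetraction_comp_front :
    frontRetraction m n ≫ front m n = SimplexCategory.toFront (joint m n) :=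
  toSimplex_hom_ext fun (i : Fin (m.len + n.len + 1)) =>
    (Fin.coe_min i (joint m n)).symm

lemma backRetraction_comp_back :
    backRetraction m n ≫ back m n = SimplexCategory.toBack (joint m n) :=
  toSimplex_hom_ext fun (i : Fin (m.len + n.len + 1)) => by
    refine Eq.trans ?_ (Fin.coe_max i (joint m n)).symm
    change m.len + (i - m.len) = max (i : ℕ) m.len
    omega

lemma toFront_comp_frontRetraction : (show toSimplex.obj (m ⊗ n) ⟶ toSimplex.obj (m ⊗ n) from
    SimplexCategory.toFront (joint m n)) ≫ frontRetraction m n = frontRetraction m n := by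
  refine (eq_whisker frontRetraction_comp_front.symm _).trans ?_
  exact (Category.assoc _ _ _).trans
    ((whisker_eq _ front_comp_frontRetraction).trans (Category.comp_id _))

lemma toBack_comp_backRetraction : (show toSimplex.obj (m ⊗ n) ⟶ toSimplex.obj (m ⊗ n) from
    SimplexCategory.toBack (joint m n)) ≫ backRetraction m n = backRetraction m n := by
  refine (eq_whisker backRetraction_comp_back.symm _).trans ?_
  exact (Category.assoc _ _ _).trans
    ((whisker_eq _ back_comp_backRetraction).trans (Category.comp_id _))

lemma toBack_comp_frontRetraction : SimplexCategory.toBack (joint m n) ≫ frontRetraction m n =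
    SimplexCategory.const _ _ 0 ≫ vertex m (Fin.last _) :=
  toSimplex_hom_ext fun (i : Fin (m.len + n.len + 1)) => by
    change min ((max i (joint m n) : Fin _) : ℕ) m.len = m.len
    rw [Fin.coe_max]
    exact min_eq_right (le_max_right _ _)

lemma toFront_comp_backRetraction : SimplexCategory.toFront (joint m n) ≫ backRetraction m n =
    SimplexCategory.const _ _ 0 ≫ vertex n 0 :=
  toSimplex_hom_ext fun (i : Fin (m.len + n.len + 1)) => by
    change ((min i (joint m n) : Fin _) : ℕ) - m.len = 0
    rw [Fin.coe_min]
    exact Nat.sub_eq_zero_of_le (min_le_right _ _)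

section Sum

variable {h : toSimplex.obj (m ⊗ n) ⟶ toSimplex.obj (m' ⊗ n')}
  {f : toSimplex.obj m ⟶ toSimplex.obj m'} {g : toSimplex.obj n ⟶ toSimplex.obj n'}
  (hf : front m n ≫ h = f ≫ front m' n') (hg : back m n ≫ h = g ≫ back m' n')

include hf in
lemma val_of_le (i : Fin (m.len + n.len + 1)) (hi : (i : ℕ) ≤ m.len) :
    val h i = val f ⟨i, Nat.lt_succ_of_le hi⟩ :=
  congrArg (fun t => val t ⟨i, Nat.lt_succ_of_le hi⟩) hf

include hg in
lemma val_of_ge (i : Fin (m.len + n.len + 1)) (hi : m.len ≤ (i : ℕ)) :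
    val h i = m'.len + val g ⟨i - m.len, by change _ < n.len + 1; omega⟩ := by
  refine Eq.trans ?_ (congrArg (fun t => val t ⟨i - m.len, by change _ < n.len + 1; omega⟩) hg)
  refine congrArg (val h) (Fin.ext ?_)
  change (i : ℕ) = m.len + (i - m.len)
  omega

include hf hg

lemma val_joint : val h (joint m n) = m'.len := by
  have h1 := val_of_le hf (joint m n) le_rfl
  have h2 := val_of_ge hg (joint m n) le_rfl
  have h3 := val_le f ⟨(joint m n : ℕ), Nat.lt_succ_of_le le_rfl⟩
  omega

/-- On the initial segment `h` is `f`; every later point is retracted to the joint, on which `h` and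
`f` agree. The maps `f` and `g` may move the outer endpoints, so face inclusions are allowed. -/
lemma comp_frontRetraction : h ≫ frontRetraction m' n' = frontRetraction m n ≫ f := by
  refine toSimplex_hom_ext fun (i : Fin (m.len + n.len + 1)) => ?_
  change min (val h i) m'.len = val f ⟨min i m.len, _⟩
  obtain hi | hi := le_total (i : ℕ) m.len
  · rw [val_of_le hf i hi, min_eq_left (val_le f _)]
    exact congrArg (val f) (Fin.ext (min_eq_left hi).symm)
  · rw [val_of_ge hg i hi, min_eq_right (Nat.le_add_right _ _), ← val_joint hf hg,
      val_of_le hf (joint m n) le_rfl]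
    exact congrArg (val f) (Fin.ext (min_eq_right hi).symm)

lemma comp_backRetraction : h ≫ backRetraction m' n' = backRetraction m n ≫ g := by
  refine toSimplex_hom_ext fun (i : Fin (m.len + n.len + 1)) => ?_
  change val h i - m'.len = val g ⟨i - m.len, _⟩
  obtain hi | hi := le_total m.len (i : ℕ)
  · rw [val_of_ge hg i hi, Nat.add_sub_cancel_left]
  · have h1 := val_joint hf hg
    rw [val_of_ge hg (joint m n) le_rfl] at h1
    rw [val_of_le hf i hi, Nat.sub_eq_zero_of_le (val_le f _)]
    refine (Nat.add_eq_left.mp h1).symm.trans (congrArg (val g) (Fin.ext ?_))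
    exact (Nat.sub_self m.len).trans (Nat.sub_eq_zero_of_le hi).symm

end Sum

end FinInt

/-! ### Joins of simplices and the naF-structure of a quasi-category. -/

namespace SSetTemplicial

variable {X : SSet.{u}}

open FinInt

/-- A simplex of dimension `m + n` with initial face `x` and final face `y`. -/
noncomputable def join {m n : FinInt} (x : simplices X m) (y : simplices X n) :
    simplices X (m ⊗ n) :=
  SSet.filler (m.len + n.len) (joint m n) (X.map (frontRetraction m n).op x)
    (X.map (backRetraction m n).op y)

section

variable {m n : FinInt} {x : simplices X m} {y : simplices X n}
  (hxy : vertex x (Fin.last _) = vertex y 0)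

include hxy in
lemma isWedge : SSet.IsWedge (joint m n) (X.map (frontRetraction m n).op x)
    (X.map (backRetraction m n).op y) where
  front := by
    refine (map_map (SimplexCategory.toFront (joint m n)) (frontRetraction m n) x).trans ?_
    exact congrArg (fun f => X.map f.op x) toFront_comp_frontRetraction
  back := by
    refine (map_map (SimplexCategory.toBack (joint m n)) (backRetraction m n) y).trans ?_
    exact congrArg (fun f => X.map f.op y) toBack_comp_backRetraction
  glue := by
    refine (map_map (SimplexCategory.toBack (joint m n)) (frontRetraction m n) x).trans ?_
    refine Eq.trans ?_
      (map_map (SimplexCategory.toFront (joint m n)) (backRetraction m n) y).symm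
    -- Both composites collapse everything to the joint, so both sides are degenerate on the common
    -- vertex.
    rw [toBack_comp_frontRetraction, toFront_comp_backRetraction, ← map_map, ← map_map]
    exact congrArg _ hxy

include hxy

variable [SSet.Quasicategory X]

lemma front_join : X.map (front m n).op (join x y) = x := by
  have h := (SSet.filled _ _ _ _ (isWedge hxy)).front
  have h' := congrArg (X.map (front m n).op) h
  refine Eq.trans ?_ (h'.trans (map_comm_self front_comp_frontRetraction x))
  refine Eq.trans ?_ (map_map (front m n) (SimplexCategory.toFront (joint m n)) _).symm
  rw [front_comp_toFront]
  rfl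

lemma back_join : X.map (back m n).op (join x y) = y := by
  have h := (SSet.filled _ _ _ _ (isWedge hxy)).back
  have h' := congrArg (X.map (back m n).op) h
  refine Eq.trans ?_ (h'.trans (map_comm_self back_comp_backRetraction y))
  refine Eq.trans ?_ (map_map (back m n) (SimplexCategory.toBack (joint m n)) _).symm
  rw [back_comp_toBack]
  rfl

/-- Fillers are natural in all maps that preserve the joint. Endpoint-preserving `f` and `g` give
naturality of the multiplication; taking one of them to be an outer face inclusion gives the
Frobenius identities. -/
lemma map_join {m' n' : FinInt} (h : toSimplex.obj (m' ⊗ n') ⟶ toSimplex.obj (m ⊗ n))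
    (f : toSimplex.obj m' ⟶ toSimplex.obj m) (g : toSimplex.obj n' ⟶ toSimplex.obj n)
    (hf : front m' n' ≫ h = f ≫ front m n) (hg : back m' n' ≫ h = g ≫ back m n) :
    X.map h.op (join x y) =
      join (X.map f.op x : simplices X m') (X.map g.op y : simplices X n') := by
  refine (SSet.filler_map h (r := joint m' n') (p := joint m n) (Fin.ext (val_joint hf hg)) (isWedge hxy)).trans ?_
  unfold join
  congr 1
  · exact map_comm (comp_frontRetraction hf hg) x
  · exact map_comm (comp_backRetraction hf hg) y

lemma vertex_zero_join : vertex (n := m ⊗ n) (join x y) 0 = vertex x 0 := by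
  conv_rhs => rw [← front_join hxy]
  exact (vertex_map (front m n) (join x y) (i := 0) (j := 0) rfl).symm

lemma vertex_last_join :
    vertex (n := m ⊗ n) (join x y) (Fin.last _) = vertex y (Fin.last _) := by
  conv_rhs => rw [← back_join hxy]
  exact (vertex_map (back m n) (join x y) (i := Fin.last _) (j := Fin.last _) rfl).symm

end

variable [SSet.Quasicategory X]

/-- The simplex `join x y` as an element of the templicial set of a quasi-category. -/
noncomputable def quiverJoin (m n : FinInt) {a b c : vertices X}
    (p : (quiver X m).obj a c × (quiver X n).obj c b) : (quiver X (m ⊗ n)).obj a b :=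
  ⟨join p.1.1 p.2.1,
    (vertex_zero_join (p.1.2.2.trans p.2.2.1.symm)).trans p.1.2.1,
    (vertex_last_join (p.1.2.2.trans p.2.2.1.symm)).trans p.2.2.2⟩

variable (X) in
/-- The multiplication on the templicial set of a quasi-category. -/
noncomputable def mulJoin (m n : FinInt) : quiver X m ⊗ quiver X n ⟶ quiver X (m ⊗ n) :=
  ⟨fun _ _ => VQuiver.desc fun _ => ↾(quiverJoin m n)⟩

lemma mulJoin_ι (m n : FinInt) {a b c : vertices X} (p : (quiver X m).obj a c)
    (q : (quiver X n).obj c b) :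
    (mulJoin X m n).app a b (VQuiver.ι (quiver X m) (quiver X n) a b c (p, q)) =
      quiverJoin m n (p, q) :=
  ConcreteCategory.congr_hom (C := Type u)
    (VQuiver.ι_desc (Q := quiver X m) (P := quiver X n) (fun _ => ↾(quiverJoin m n)) c)
    ((p, q) : (quiver X m).obj a c × (quiver X n).obj c b)

lemma tensor_hom_ext_ι {S : Type u} {Q P R : VQuiver S (Type u)} {f g : Q ⊗ P ⟶ R}
    (h : ∀ (a b c : S) (p : Q.obj a c) (q : P.obj c b),
      f.app a b (VQuiver.ι Q P a b c (p, q)) = g.app a b (VQuiver.ι Q P a b c (p, q))) :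
    f = g := by
  refine VQuiver.hom_ext fun a b => VQuiver.tensor_hom_ext (V := Type u) fun c => ?_
  ext x
  exact h a b c x.1 x.2

lemma tensor_unit_hom_ext_ι {S : Type u} {Q R : VQuiver S (Type u)}
    {f g : Q ⊗ 𝟙_ (VQuiver S (Type u)) ⟶ R}
    (h : ∀ (a b : S) (p : Q.obj a b),
      f.app a b (VQuiver.ι Q (𝟙_ _) a b b (p, VQuiver.unitι (V := Type u) rfl PUnit.unit)) =
      g.app a b (VQuiver.ι Q (𝟙_ _) a b b (p, VQuiver.unitι (V := Type u) rfl PUnit.unit))) :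
    f = g := by
  refine VQuiver.hom_ext fun a b => VQuiver.tensor_hom_ext (V := Type u) fun c =>
    VQuiver.tensor_unit_hom_ext (V := Type u) fun e => ?_
  subst e
  ext x
  exact h a c x.1

lemma unit_tensor_hom_ext_ι {S : Type u} {Q R : VQuiver S (Type u)}
    {f g : 𝟙_ (VQuiver S (Type u)) ⊗ Q ⟶ R}
    (h : ∀ (a b : S) (p : Q.obj a b),
      f.app a b (VQuiver.ι (𝟙_ _) Q a b a (VQuiver.unitι (V := Type u) rfl PUnit.unit, p)) =
      g.app a b (VQuiver.ι (𝟙_ _) Q a b a (VQuiver.unitι (V := Type u) rfl PUnit.unit, p))) :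
    f = g := by
  refine VQuiver.hom_ext fun a b => VQuiver.tensor_hom_ext (V := Type u) fun c =>
    VQuiver.unit_tensor_hom_ext (V := Type u) fun e => ?_
  subst e
  ext x
  exact h a b x.2

lemma associator_inv_ι {S : Type u} (Q P R : VQuiver S (Type u)) {a b c d : S}
    (p : Q.obj a d) (q : P.obj d c) (r : R.obj c b) :
    (α_ Q P R).inv.app a b (VQuiver.ι Q (P ⊗ R) a b d (p, VQuiver.ι P R d b c (q, r))) =
      VQuiver.ι (Q ⊗ P) R a b c (VQuiver.ι Q P a c d (p, q), r) :=
  ConcreteCategory.congr_hom (C := Type u) (VQuiver.ι_associator_inv Q P R a b c d)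
    ((p, (q, r)) : Q.obj a d × P.obj d c × R.obj c b)

lemma leftUnitor_ι {S : Type u} (Q : VQuiver S (Type u)) {a b : S} (p : Q.obj a b) :
    (λ_ Q).hom.app a b (VQuiver.ι (𝟙_ (VQuiver S (Type u))) Q a b a
      (VQuiver.unitι (V := Type u) rfl PUnit.unit, p)) = p :=
  ConcreteCategory.congr_hom (C := Type u) (VQuiver.ι_leftUnitor_hom Q a b)
    ((PUnit.unit, p) : PUnit.{u + 1} × Q.obj a b)

lemma rightUnitor_ι {S : Type u} (Q : VQuiver S (Type u)) {a b : S} (p : Q.obj a b) :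
    (ρ_ Q).hom.app a b (VQuiver.ι Q (𝟙_ (VQuiver S (Type u))) a b b
      (p, VQuiver.unitι (V := Type u) rfl PUnit.unit)) = p :=
  ConcreteCategory.congr_hom (C := Type u) (VQuiver.ι_rightUnitor_hom Q a b)
    ((p, PUnit.unit) : Q.obj a b × PUnit.{u + 1})

/-- The inverse right unitor is the inclusion of the initial segment, along which a join restricts
to its first factor. -/
lemma map_rightUnitor_join {m : FinInt} {a b c : vertices X} (p : (quiver X m).obj a c)
    (q : (quiver X (𝟙_ FinInt)).obj c b) :
    X.map (toSimplex.map (ρ_ m).inv).op (join p.1 q.1) = p.1 := by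
  refine Eq.trans ?_ (front_join (p.2.2.trans q.2.1.symm))
  exact map_congr (n := m ⊗ 𝟙_ FinInt) (fun _ => rfl) _

lemma map_leftUnitor_join {m : FinInt} {a b c : vertices X} (p : (quiver X (𝟙_ FinInt)).obj a c)
    (q : (quiver X m).obj c b) :
    X.map (toSimplex.map (λ_ m).inv).op (join p.1 q.1) = q.1 := by
  refine Eq.trans ?_ (back_join (p.2.2.trans q.2.1.symm))
  exact map_congr (n := 𝟙_ FinInt ⊗ m) (fun i => (Nat.zero_add (i : Fin (m.len + 1))).symm) _

/-- The nonassociative Frobenius structure on the templicial set of a quasi-category. -/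
noncomputable def naFStructure (X : SSet.{u}) [SSet.Quasicategory X] :
    NaFStructure (functor X) where
  unit := inv (η (functor X))
  mul A B := mulJoin X A.unop B.unop
  mul_natural {A A' B B'} f g := by
    refine tensor_hom_ext_ι fun a b c p q => ?_
    refine (congrArg ((mulJoin X A'.unop B'.unop).app a b)
      (tensorHom_ι ((functor X).map f) ((functor X).map g) p q)).trans ?_
    refine (mulJoin_ι _ _ _ _).trans ?_
    refine Eq.trans ?_
      (congrArg (((functor X).map (f ⊗ₘ g)).app a b) (mulJoin_ι A.unop B.unop p q)).symm
    exact quiver_ext (map_join (p.2.2.trans q.2.1.symm) _ _ _ (front_tensorHom f.unop g.unop)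
      (back_tensorHom f.unop g.unop)).symm
  frobenius_left A B C := by
    refine tensor_hom_ext_ι fun a b c p q => ?_
    have hpq := p.2.2.trans q.2.1.symm
    refine (congrArg (fun t => ((functor X).obj A ◁ mulJoin X B.unop C.unop).app a b
      ((α_ (quiver X A.unop) (quiver X B.unop) (quiver X C.unop)).hom.app a b t))
      (whiskerRight_ι (δ (functor X) A B) ((functor X).obj C) p q)).trans ?_
    refine (congrArg (((functor X).obj A ◁ mulJoin X B.unop C.unop).app a b)
      (associator_ι (quiver X A.unop) (quiver X B.unop) (quiver X C.unop) _ _ _)).trans ?_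
    refine (whiskerLeft_ι ((functor X).obj A) (mulJoin X B.unop C.unop) _ _).trans ?_
    refine Eq.trans ?_
      (congrArg (fun t => (δ (functor X) A (B ⊗ C)).app a b
        (((functor X).map (α_ A B C).hom).app a b t)) (mulJoin_ι (A ⊗ B).unop C.unop p q)).symm
    refine ι_congr ?_ ((congrArg Subtype.val (mulJoin_ι B.unop C.unop _ _)).trans ?_)
    · exact (congrArg (X.map (front A.unop B.unop).op) (front_join hpq).symm).trans
        (map_comm (front_front A.unop B.unop C.unop) _)
    -- The inclusion of the final `[B + C]` into `[A + B + C]` restricts to `back A B` and to the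
    -- identity on the two sides of the joint.
    · refine Eq.symm ((map_map _ _ _).trans ((map_join hpq _ (back A.unop B.unop) (𝟙 _)
        ((Category.assoc _ _ _).symm.trans (back_front A.unop B.unop C.unop).symm)
        ((Category.assoc _ _ _).symm.trans (back_back A.unop B.unop C.unop).symm)).trans ?_))
      exact congrArg (join _) (SSet.map_op_id q.1)
  frobenius_right A B C := by
    refine tensor_hom_ext_ι fun a b c p q => ?_
    have hpq := p.2.2.trans q.2.1.symm
    refine (congrArg (fun t => (mulJoin X A.unop B.unop ▷ (functor X).obj C).app a b
      ((α_ (quiver X A.unop) (quiver X B.unop) (quiver X C.unop)).inv.app a b t))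
      (whiskerLeft_ι ((functor X).obj A) (δ (functor X) B C) p q)).trans ?_
    refine (congrArg ((mulJoin X A.unop B.unop ▷ (functor X).obj C).app a b)
      (associator_inv_ι (quiver X A.unop) (quiver X B.unop) (quiver X C.unop) _ _ _)).trans ?_
    refine (whiskerRight_ι (mulJoin X A.unop B.unop) ((functor X).obj C) _ _).trans ?_
    refine Eq.trans ?_
      (congrArg (fun t => (δ (functor X) (A ⊗ B) C).app a b
        (((functor X).map (α_ A B C).inv).app a b t)) (mulJoin_ι A.unop (B ⊗ C).unop p q)).symm
    refine ι_congr ((congrArg Subtype.val (mulJoin_ι A.unop B.unop _ _)).trans ?_) ?_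
    -- The mirror image: the initial `[A + B]` is included by the identity and by `front B C`.
    · refine Eq.symm ((map_map _ _ _).trans ((map_join hpq _ (𝟙 _) (front B.unop C.unop)
        (toSimplex_hom_ext fun _ => rfl) (toSimplex_hom_ext fun _ => rfl)).trans ?_))
      exact congrArg (fun x => join x _) (SSet.map_op_id p.1)
    · refine (congrArg (X.map (back B.unop C.unop).op) (back_join hpq).symm).trans
        (map_comm (toSimplex_hom_ext fun i => ?_) _)
      exact (Nat.add_assoc A.unop.len B.unop.len (i : Fin (C.unop.len + 1))).symm
  mul_unit A := by
    refine tensor_unit_hom_ext_ι fun a b p => ?_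
    refine Eq.trans ?_ (rightUnitor_ι ((functor X).obj A) p).symm
    refine (congrArg (fun t => ((functor X).map (ρ_ A).hom).app a b
      ((mulJoin X A.unop (𝟙_ FinInt)).app a b t))
      (whiskerLeft_ι ((functor X).obj A) (inv (η (functor X))) p _)).trans ?_
    refine (congrArg (((functor X).map (ρ_ A).hom).app a b) (mulJoin_ι _ _ _ _)).trans ?_
    exact quiver_ext (map_rightUnitor_join p _)
  unit_mul A := by
    refine unit_tensor_hom_ext_ι fun a b p => ?_
    refine Eq.trans ?_ (leftUnitor_ι ((functor X).obj A) p).symm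
    refine (congrArg (fun t => ((functor X).map (λ_ A).hom).app a b
      ((mulJoin X (𝟙_ FinInt) A.unop).app a b t))
      (whiskerRight_ι (inv (η (functor X))) ((functor X).obj A) _ p)).trans ?_
    refine (congrArg (((functor X).map (λ_ A).hom).app a b) (mulJoin_ι _ _ _ _)).trans ?_
    exact quiver_ext (map_leftUnitor_join _ p)
  unit_counit := IsIso.inv_hom_id _
  counit_unit := IsIso.hom_inv_id _

end SSetTemplicial

/-! ### Elements of quivers -/

namespace VQuiver

variable {S : Type u} {V : Type w} [Category.{u} V] [MonoidalCategory V]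

/-- A generalized element of a quiver. -/
abbrev Elt (Q : VQuiver S V) (a b : S) := 𝟙_ V ⟶ Q.obj a b

variable {Q P R Q' P' : VQuiver S V} {a b c d : S}

/-- The image of an element under a morphism of quivers. -/
def push (x : Q.Elt a b) (f : Q ⟶ P) : P.Elt a b := x ≫ f.app a b

lemma push_comp (x : Q.Elt a b) (f : Q ⟶ P) (g : P ⟶ R) : push x (f ≫ g) = push (push x f) g :=
  (Category.assoc _ _ _).symm

lemma push_id (x : Q.Elt a b) : push x (𝟙 Q) = x :=
  Category.comp_id _

variable [TensorCocomplete V]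

/-- The element of a tensor product of quivers given by two elements. -/
noncomputable def pair (x : Q.Elt a c) (y : P.Elt c b) : (Q ⊗ P).Elt a b :=
  (λ_ (𝟙_ V)).inv ≫ (x ⊗ₘ y) ≫ ι Q P a b c

lemma push_pair_tensorHom (x : Q.Elt a c) (y : P.Elt c b) (f : Q ⟶ Q') (g : P ⟶ P') :
    push (pair x y) (f ⊗ₘ g) = pair (push x f) (push y g) := by
  simp only [push, pair, Category.assoc, ι_tensorHom, tensorHom_comp_tensorHom_assoc]

lemma push_pair_whiskerRight (x : Q.Elt a c) (y : P.Elt c b) (f : Q ⟶ Q') :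
    push (pair x y) (f ▷ P) = pair (push x f) y := by
  rw [← tensorHom_id, push_pair_tensorHom, push_id]

lemma push_pair_whiskerLeft (x : Q.Elt a c) (y : P.Elt c b) (g : P ⟶ P') :
    push (pair x y) (Q ◁ g) = pair x (push y g) := by
  rw [← id_tensorHom, push_pair_tensorHom, push_id]

lemma push_pair_associator (x : Q.Elt a d) (y : P.Elt d c) (z : R.Elt c b) :
    push (pair (pair x y) z) (α_ Q P R).hom = pair x (pair y z) := by
  have e1 : (pair x y ⊗ₘ z) = (λ_ (𝟙_ V)).inv ▷ 𝟙_ V ≫ ((x ⊗ₘ y) ⊗ₘ z) ≫ ι Q P a c d ▷ _ := by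
    simp only [pair, ← tensorHom_id, tensorHom_comp_tensorHom, Category.id_comp,
      Category.comp_id]
  have e2 : (x ⊗ₘ pair y z) = 𝟙_ V ◁ (λ_ (𝟙_ V)).inv ≫ (x ⊗ₘ (y ⊗ₘ z)) ≫ _ ◁ ι P R d b c := by
    simp only [pair, ← id_tensorHom, tensorHom_comp_tensorHom, Category.id_comp,
      Category.comp_id]
  change ((λ_ (𝟙_ V)).inv ≫ (pair x y ⊗ₘ z) ≫ ι (Q ⊗ P) R a b c) ≫ (α_ Q P R).hom.app a b =
    (λ_ (𝟙_ V)).inv ≫ (x ⊗ₘ pair y z) ≫ ι Q (P ⊗ R) a b d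
  rw [e1, e2]
  simp only [Category.assoc, ι_associator_hom]
  rw [associator_naturality_assoc]
  have e3 : (λ_ (𝟙_ V)).inv ≫ (λ_ (𝟙_ V)).inv ▷ 𝟙_ V ≫ (α_ _ _ _).hom =
      (λ_ (𝟙_ V)).inv ≫ 𝟙_ V ◁ (λ_ (𝟙_ V)).inv := by monoidal
  rw [reassoc_of% e3]

lemma push_leftUnitor_inv (x : Q.Elt a b) :
    push x (λ_ Q).inv = pair (unitι (V := V) (rfl : a = a)) x := by
  rw [push, pair, leftUnitor_inv_app, leftUnitor_inv_naturality_assoc,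
    MonoidalCategory.tensorHom_def', Category.assoc]

lemma push_rightUnitor_inv (x : Q.Elt a b) :
    push x (ρ_ Q).inv = pair x (unitι (V := V) (rfl : b = b)) := by
  rw [push, pair, rightUnitor_inv_app, rightUnitor_inv_naturality_assoc,
    MonoidalCategory.tensorHom_def, Category.assoc, unitors_inv_equal]

end VQuiver

/-! ### Morphisms out of free templicial objects -/

namespace VQuiver

variable {V : Type w} [Category.{u} V] [MonoidalCategory V] [TensorCocomplete V]
  {S T : Type u} {f : S → T} {A B : VQuiver S (Type u)} {P Q : VQuiver T V} {a b c : S}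

/-- The value of a morphism out of a free quiver on a generator. -/
noncomputable def evalFree (s : (mapQuiver (freeFunctor V) S).obj A ⟶ (pullback f).obj P)
    (x : A.obj a b) : P.Elt (f a) (f b) :=
  CategoryStruct.comp (Y := (freeFunctor V).obj (A.obj a b)) (freeι x) (s.app a b)

lemma evalFree_ext {s t : (mapQuiver (freeFunctor V) S).obj A ⟶ (pullback f).obj P}
    (h : ∀ a b (x : A.obj a b), evalFree s x = evalFree t x) : s = t :=
  VQuiver.hom_ext fun a b => free_hom_ext (h a b)

lemma evalFree_map_comp (g : A ⟶ B)
    (s : (mapQuiver (freeFunctor V) S).obj B ⟶ (pullback f).obj P) (x : A.obj a b) :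
    evalFree ((mapQuiver (freeFunctor V) S).map g ≫ s) x = evalFree s (g.app a b x) :=
  freeι_map_assoc (g.app a b) x _

lemma evalFree_comp_map (s : (mapQuiver (freeFunctor V) S).obj A ⟶ (pullback f).obj P)
    (h : P ⟶ Q) (x : A.obj a b) :
    evalFree (s ≫ (pullback f).map h) x = push (evalFree s x) h :=
  (Category.assoc _ _ _).symm

/-- The free functor splits the generator of `(x, y)` into the generators of `x` and `y`. This turns
the comultiplication axiom of a morphism into an identity between pairs of elements. -/
lemma evalFree_tensor (s : (mapQuiver (freeFunctor V) S).obj A ⟶ (pullback f).obj P)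
    (t : (mapQuiver (freeFunctor V) S).obj B ⟶ (pullback f).obj Q)
    (x : A.obj a c) (y : B.obj c b) :
    evalFree (P := P ⊗ Q)
      (mapQuiverTensor (freeFunctor V) A B ≫ (s ⊗ₘ t) ≫ pullbackTensor f P Q)
      (VQuiver.ι A B a b c (x, y)) = pair (evalFree s x) (evalFree t y) := by
  have e1 : (freeι (VQuiver.ι A B a b c (x, y)) : 𝟙_ V ⟶ _) =
      freeι (A := (A.obj a c ⊗ B.obj c b : Type u)) (x, y) ≫
        (freeFunctor V).map (VQuiver.ι A B a b c) :=
    (freeι_map _ _).symm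
  refine (eq_whisker e1 _).trans ((Category.assoc _ _ _).trans ?_)
  refine (whisker_eq _ (map_ι_mapQuiverTensor_assoc (freeFunctor V) A B a b c _)).trans ?_
  refine (freeι_freeTensor_assoc (A := A.obj a c) (B := B.obj c b) (x, y) _).trans ?_
  refine whisker_eq _ ?_
  refine (whisker_eq _ (ι_tensorHom_assoc s t a b c _)).trans ?_
  refine (tensorHom_comp_tensorHom_assoc _ _ _ _ _).trans ?_
  exact whisker_eq _ (ι_pullbackTensor f P Q a b c)

lemma evalFree_unit (h : a = b) :
    evalFree (P := 𝟙_ (VQuiver T V)) (mapQuiverUnit (freeFunctor V) S ≫ pullbackUnit f)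
      (unitι (V := Type u) h PUnit.unit) = unitι (congrArg f h) := by
  have e1 : (freeι (unitι (V := Type u) h PUnit.unit) : 𝟙_ V ⟶ _) =
      freeι PUnit.unit ≫ (freeFunctor V).map (unitι (V := Type u) h) :=
    (freeι_map _ _).symm
  refine (eq_whisker e1 _).trans ((Category.assoc _ _ _).trans ?_)
  refine (whisker_eq _ ((Category.assoc _ _ _).symm.trans
    (eq_whisker (map_unitι_mapQuiverUnit (freeFunctor V) h) _))).trans ?_
  refine (whisker_eq _ (Category.assoc _ _ _)).trans ?_
  refine (freeι_freeUnit_assoc _ _).trans ?_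
  exact unitι_pullbackUnit f h

end VQuiver

namespace Templicial

open SSetTemplicial VQuiver

variable {V : Type w} [Category.{u} V] [MonoidalCategory V] [TensorCocomplete V]
  {Y : SSet.{u}} {X : Templicial V}

/-- The value of a morphism out of a free templicial object on a simplex. -/
noncomputable def eval (G : (freeTemplicial V).obj Y ⟶ X) {n : FinInt} {a b : vertices Y}
    (y : (quiver Y n).obj a b) :
    (X.functor.obj (op n)).Elt (Hom.toFun G a) (Hom.toFun G b) :=
  evalFree (A := quiver Y n) (P := X.functor.obj (op n)) ((Hom.trans G).app (op n)) y

lemma eval_restrict (G : (freeTemplicial V).obj Y ⟶ X) {m n : FinInt} (f : m ⟶ n)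
    {a b : vertices Y} (y : (quiver Y n).obj a b) :
    eval G (restrict f y) = push (eval G y) (X.functor.map f.op) := by
  refine Eq.trans ?_ (evalFree_comp_map _ _ _)
  refine Eq.trans ?_ (congrArg (fun t => evalFree t y) ((Hom.trans G).naturality f.op))
  exact (evalFree_map_comp ((SSetTemplicial.functor Y).map f.op) ((Hom.trans G).app (op m)) y).symm

/-- The middle vertex `c` is arbitrary, since in applications it is only propositionally the joint
vertex; the equations of simplices determine it. -/
lemma split_eq {m n : FinInt} {a b c : vertices Y} (y : (quiver Y (m ⊗ n)).obj a b)
    (p : (quiver Y m).obj a c) (q : (quiver Y n).obj c b)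
    (hp : p.1 = Y.map (FinInt.front m n).op y.1) (hq : q.1 = Y.map (FinInt.back m n).op y.1) :
    split m n y = VQuiver.ι (quiver Y m) (quiver Y n) a b c (p, q) :=
  ι_congr hp.symm hq.symm

lemma eval_comul (G : (freeTemplicial V).obj Y ⟶ X) {m n : FinInt} {a b c : vertices Y}
    (y : (quiver Y (m ⊗ n)).obj a b) (p : (quiver Y m).obj a c) (q : (quiver Y n).obj c b)
    (hp : p.1 = Y.map (FinInt.front m n).op y.1) (hq : q.1 = Y.map (FinInt.back m n).op y.1) :
    push (eval G y) (δ X.functor (op m) (op n)) = pair (eval G p) (eval G q) := by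
  refine Eq.trans (evalFree_comp_map _ _ _).symm ?_
  refine Eq.trans (congrArg (fun t => evalFree t y) (Hom.comul G (op m) (op n)).symm) ?_
  refine Eq.trans ?_ (evalFree_tensor (A := quiver Y m) (B := quiver Y n) _ _ p q)
  rw [← split_eq y p q hp hq]
  refine Eq.trans ?_ (evalFree_map_comp (δ (SSetTemplicial.functor Y) (op m) (op n)) _ y)
  exact congrArg (fun t => evalFree t y) (Category.assoc _ _ _)

lemma eval_counit (G : (freeTemplicial V).obj Y ⟶ X) {a b : vertices Y}
    (y : (quiver Y (𝟙_ FinInt)).obj a b) :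
    push (eval G y) (η X.functor) = unitι (congrArg (Hom.toFun G) (y.2.1.symm.trans y.2.2)) := by
  refine Eq.trans (evalFree_comp_map _ _ _).symm ?_
  refine Eq.trans (congrArg (fun t => evalFree t y) (Hom.counit G).symm) ?_
  refine Eq.trans ?_ (evalFree_unit (V := V) (y.2.1.symm.trans y.2.2))
  refine Eq.trans ?_ (evalFree_map_comp (η (SSetTemplicial.functor Y)) _ y)
  exact congrArg (fun t => evalFree t y) (Category.assoc _ _ _)

section HomOfEval

variable (f : vertices Y → X.base)
  (φ : ∀ (n : FinInt) (a b : vertices Y), (quiver Y n).obj a b →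
    (X.functor.obj (op n)).Elt (f a) (f b))

/-- The components of a morphism out of a free templicial object with given values. -/
noncomputable def appOfEval (n : FinIntᵒᵖ) :
    ((freeTemplicial V).obj Y).functor.obj n ⟶ (VQuiver.pullback f).obj (X.functor.obj n) :=
  ⟨fun a b => freeDesc fun y : (quiver Y n.unop).obj a b => φ n.unop a b y⟩

lemma evalFree_appOfEval (n : FinInt) {a b : vertices Y} (y : (quiver Y n).obj a b) :
    evalFree (A := quiver Y n) (P := X.functor.obj (op n)) (appOfEval f φ (op n)) y = φ n a b y :=
  freeι_freeDesc _ _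

variable (hφ : ∀ {m n : FinInt} (g : m ⟶ n) {a b : vertices Y} (y : (quiver Y n).obj a b),
    φ m a b (restrict g y) = push (φ n a b y) (X.functor.map g.op))
  (comul : ∀ {m n : FinInt} {a b c : vertices Y} (y : (quiver Y (m ⊗ n)).obj a b)
    (p : (quiver Y m).obj a c) (q : (quiver Y n).obj c b),
    p.1 = Y.map (FinInt.front m n).op y.1 → q.1 = Y.map (FinInt.back m n).op y.1 →
    push (φ _ a b y) (δ X.functor (op m) (op n)) = pair (φ m a c p) (φ n c b q))
  (counit : ∀ {a b : vertices Y} (y : (quiver Y (𝟙_ FinInt)).obj a b),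
    push (φ _ a b y) (η X.functor) = unitι (congrArg f (y.2.1.symm.trans y.2.2)))

/-- A morphism out of a free templicial object from its values on simplices. -/
noncomputable def homOfEval : Hom ((freeTemplicial V).obj Y) X where
  toFun := f
  trans :=
    { app := appOfEval f φ
      naturality := by
        intro m n g
        refine evalFree_ext (A := quiver Y m.unop) fun a b y => ?_
        refine (evalFree_map_comp ((SSetTemplicial.functor Y).map g) (appOfEval f φ n) y).trans ?_
        refine ((evalFree_appOfEval f φ _ _).trans (hφ g.unop y)).trans ?_
        refine Eq.trans ?_ (evalFree_comp_map (appOfEval f φ m) (X.functor.map g) y).symm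
        exact congrArg (push · _) (evalFree_appOfEval f φ m.unop y).symm }
  comul m n := by
    refine evalFree_ext (A := quiver Y (m.unop ⊗ n.unop)) fun a b y => ?_
    refine Eq.trans ?_ (evalFree_comp_map (appOfEval f φ (m ⊗ n)) (δ X.functor m n) y).symm
    refine (congrArg (fun t => evalFree t y) (Category.assoc _ _ _)).trans ?_
    refine (evalFree_map_comp (δ (SSetTemplicial.functor Y) m n) _ y).trans ?_
    refine (evalFree_tensor (A := quiver Y m.unop) (B := quiver Y n.unop) (appOfEval f φ m)
      (appOfEval f φ n) _ _).trans ?_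
    refine (congrArg₂ VQuiver.pair (evalFree_appOfEval f φ m.unop _)
      (evalFree_appOfEval f φ n.unop _)).trans ?_
    refine Eq.trans ?_ (congrArg (push · _) (evalFree_appOfEval f φ (m.unop ⊗ n.unop) y).symm)
    exact (comul y _ _ rfl rfl).symm
  counit := by
    refine evalFree_ext (A := quiver Y (𝟙_ FinInt)) fun a b y => ?_
    refine Eq.trans ?_ (evalFree_comp_map (appOfEval f φ (𝟙_ _)) (η X.functor) y).symm
    refine (congrArg (fun t => evalFree t y) (Category.assoc _ _ _)).trans ?_
    refine (evalFree_map_comp (η (SSetTemplicial.functor Y)) _ y).trans ?_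
    refine (evalFree_unit (V := V) (y.2.1.symm.trans y.2.2)).trans ?_
    refine Eq.trans ?_ (congrArg (push · _) (evalFree_appOfEval f φ (𝟙_ FinInt) y).symm)
    exact (counit y).symm

lemma map_comp_homOfEval {Y' : SSet.{u}} (j : Y' ⟶ Y) (G : (freeTemplicial V).obj Y' ⟶ X)
    (hf : f ∘ j.app (op (SimplexCategory.mk 0)) = Hom.toFun G)
    (h : ∀ {n : FinInt} {a b : vertices Y'} (y : (quiver Y' n).obj a b),
      φ n _ _ (quiverMap j y) ≫ eqToHom (by rw [← hf]; rfl) = eval G y) :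
    (freeTemplicial V).map j ≫
      (show (freeTemplicial V).obj Y ⟶ X from homOfEval f φ hφ comul counit) = G := by
  refine Hom.ext_app hf fun n a b => free_hom_ext fun (y : (quiver Y' n.unop).obj a b) => ?_
  refine Eq.trans ?_ (h (n := n.unop) y)
  refine (Category.assoc _ _ _).symm.trans (eq_whisker ?_ _)
  refine (freeι_map_assoc (↾(quiverMap j (n := n.unop) (a := a) (b := b))) y _).trans ?_
  exact evalFree_appOfEval f φ n.unop (quiverMap j y)

end HomOfEval

end Templicial

/-! ### Filling horns in the presence of a nonassociative Frobenius structure -/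

namespace FinInt

/-- The image of the gluing point. -/
def mid {P Q N : FinInt} (f : P ⊗ Q ⟶ N) : ℕ := f.toOrderHom (joint P Q)

/-- The gluing point is not sent to an endpoint. -/
def Interior {P Q N : FinInt} (f : P ⊗ Q ⟶ N) : Prop := 0 < mid f ∧ mid f < N.len

/-- The morphism `f` misses the vertex `k`. -/
def Misses {P N : FinInt} (f : P ⟶ N) (k : ℕ) : Prop := ∀ x, (f.toOrderHom x : ℕ) ≠ k

/-- The morphism `f` defines a simplex of the `i`-th horn. -/
def InHorn {P N : FinInt} (i : ℕ) (f : P ⟶ N) : Prop := ∃ k ≤ N.len, k ≠ i ∧ Misses f k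

lemma Misses.comp {P P' N : FinInt} {f : P ⟶ N} {k : ℕ} (hf : Misses f k) (g : P' ⟶ P) :
    Misses (g ≫ f) k := fun x => hf (g.toOrderHom x)

lemma InHorn.comp {P P' N : FinInt} {i : ℕ} {f : P ⟶ N} (hf : InHorn i f) (g : P' ⟶ P) :
    InHorn i (g ≫ f) := by
  obtain ⟨k, h, h', h''⟩ := hf
  exact ⟨k, h, h', h''.comp g⟩

/-- Morphisms of finite intervals hit both endpoints, so a missed vertex is interior. Hence only
inner faces have to be matched directly. -/
lemma InHorn.exists_misses {P N : FinInt} {i : ℕ} {f : P ⟶ N} (hf : InHorn i f) :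
    ∃ k, 0 < k ∧ k < N.len ∧ k ≠ i ∧ Misses f k := by
  obtain ⟨k, h, h', h''⟩ := hf
  refine ⟨k, Nat.pos_of_ne_zero fun hk => h'' 0 ?_, lt_of_le_of_ne h fun hk => h'' (Fin.last _) ?_,
    h', h''⟩
  · rw [f.map_zero, hk]; rfl
  · rw [f.map_last, hk]; rfl

/-- By monotonicity the two segments land on the two sides of the gluing point, so the morphism is
the sum of its two restrictions. -/
lemma exists_eq_tensorHom {P Q C D : FinInt} (f : P ⊗ Q ⟶ C ⊗ D) (h : mid f = C.len) :
    ∃ (f₁ : P ⟶ C) (f₂ : Q ⟶ D), f = f₁ ⊗ₘ f₂ := by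
  have h0 : (f.toOrderHom 0 : ℕ) = 0 := apply_eq_zero f rfl
  have h1 : (f.toOrderHom (Fin.last _) : ℕ) = C.len + D.len := apply_eq_last f rfl
  have hlt (x : Fin (P.len + 1)) : (x : ℕ) < (P ⊗ Q).len + 1 :=
    lt_of_lt_of_le x.2 (Nat.add_le_add_right (Nat.le_add_right _ _) 1)
  have hle (x : Fin (P.len + 1)) : (f.toOrderHom ⟨x, hlt x⟩ : ℕ) ≤ C.len := by
    rw [← h]
    exact f.toOrderHom.monotone (show (⟨x, hlt x⟩ : Fin _) ≤ joint P Q from Nat.le_of_lt_succ x.2)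
  have hlt' (x : Fin (Q.len + 1)) : P.len + (x : ℕ) < (P ⊗ Q).len + 1 :=
    Nat.add_lt_add_left x.2 P.len
  have hge (x : Fin (Q.len + 1)) : C.len ≤ (f.toOrderHom ⟨P.len + x, hlt' x⟩ : ℕ) := by
    rw [← h]
    exact f.toOrderHom.monotone
      (show joint P Q ≤ (⟨P.len + x, hlt' x⟩ : Fin _) from Nat.le_add_right _ _)
  have hge' (x : Fin (Q.len + 1)) : (f.toOrderHom ⟨P.len + x, hlt' x⟩ : ℕ) - C.len < D.len + 1 := by
    have := (f.toOrderHom ⟨P.len + x, hlt' x⟩).2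
    simp only [tensorObj_len] at this
    omega
  refine ⟨⟨⟨fun x => ⟨f.toOrderHom ⟨x, hlt x⟩, Nat.lt_succ_of_le (hle x)⟩, fun x y hxy =>
      f.toOrderHom.monotone hxy⟩, Fin.ext h0, Fin.ext h⟩,
    ⟨⟨fun x => ⟨f.toOrderHom ⟨P.len + x, hlt' x⟩ - C.len, hge' x⟩, fun x y hxy =>
      Nat.sub_le_sub_right (f.toOrderHom.monotone (Nat.add_le_add_left hxy _)) _⟩,
      Fin.ext (show mid f - C.len = 0 by omega),
      Fin.ext (show (f.toOrderHom (Fin.last _) : ℕ) - C.len = D.len by omega)⟩, ?_⟩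
  refine hom_ext fun x => ?_
  rw [tensorHom_apply]
  split_ifs with hx
  · rfl
  · have e : P.len + ((x : ℕ) - P.len) = x := by omega
    change _ = C.len + ((f.toOrderHom ⟨P.len + (x - P.len), _⟩ : ℕ) - C.len)
    have h2 := hge ⟨x - P.len, by have := x.2; simp only [tensorObj_len] at this; omega⟩
    have h3 := apply_congr f (i := ⟨P.len + (x - P.len), by omega⟩) (j := x) e
    dsimp only at h2
    omega

/-- The endomorphism that moves the interior point `k` to an adjacent point `k'`. -/
def move (N : FinInt) (k k' : Fin (N.len + 1)) (h : (k' : ℕ) = k + 1 ∨ (k : ℕ) = k' + 1)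
    (h0 : 0 < (k : ℕ)) (h1 : (k : ℕ) < N.len) : N ⟶ N where
  toOrderHom :=
    { toFun := fun x => if x = k then k' else x
      -- Nothing lies strictly between `k` and the adjacent point `k'`.
      monotone' := by
        intro x y hxy
        simp only [Fin.le_def, Fin.ext_iff] at hxy ⊢
        split_ifs <;> omega }
  map_zero := if_neg fun e => by simp [← e] at h0
  map_last := if_neg fun e => by simp [← e] at h1

end FinInt

namespace VQuiver

variable {S : Type u} {V : Type w} [Category.{u} V] [MonoidalCategory V] [Preadditive V]
  {Q P : VQuiver S V} {a b : S}

lemma push_add (x y : Q.Elt a b) (f : Q ⟶ P) : push (x + y) f = push x f + push y f :=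
  Preadditive.add_comp _ _ _ _ _ _

lemma push_sub (x y : Q.Elt a b) (f : Q ⟶ P) : push (x - y) f = push x f - push y f :=
  Preadditive.sub_comp _ _ _

end VQuiver

/-! ### Filling horns by correcting cuts and then faces. -/

section HornFilling

open FinInt VQuiver

variable {S : Type u} {V : Type w} [Category.{u} V] [MonoidalCategory V] [TensorCocomplete V]

/-- The values on the `i`-th horn of a morphism to a colax monoidal functor `H`: elements for the
simplices of the horn, and for the pairs of simplices of the horn obtained by cutting a simplex at
an interior vertex. -/
structure HornData (H : FinIntᵒᵖ ⥤ VQuiver S V) [H.OplaxMonoidal] (N : FinInt) (i : ℕ)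
    (s t : S) where
  face : ∀ {P : FinInt} (f : P ⟶ N), InHorn i f → (H.obj (op P)).Elt s t
  cut : ∀ {P Q : FinInt} (f : P ⊗ Q ⟶ N), Interior f → (H.obj (op P) ⊗ H.obj (op Q)).Elt s t
  face_comp : ∀ {P P' : FinInt} (g : P' ⟶ P) (f : P ⟶ N) (hf : InHorn i f),
    face (g ≫ f) (hf.comp g) = push (face f hf) (H.map g.op)
  cut_comp : ∀ {P Q P' Q' : FinInt} (g : P' ⟶ P) (h : Q' ⟶ Q) (f : P ⊗ Q ⟶ N)
    (hf : Interior f) (hf' : Interior ((g ⊗ₘ h) ≫ f)),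
    cut ((g ⊗ₘ h) ≫ f) hf' = push (cut f hf) (H.map g.op ⊗ₘ H.map h.op)
  cut_assoc : ∀ {P Q R : FinInt} (f : (P ⊗ Q) ⊗ R ⟶ N) (hf : Interior f)
    (hf' : Interior ((α_ P Q R).inv ≫ f)),
    push (cut f hf) (δ H (op P) (op Q) ▷ H.obj (op R) ≫ (α_ _ _ _).hom) =
      push (cut ((α_ P Q R).inv ≫ f) hf') (H.obj (op P) ◁ δ H (op Q) (op R))
  push_face : ∀ {P Q : FinInt} (f : P ⊗ Q ⟶ N) (hf : InHorn i f) (hf' : Interior f),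
    push (face f hf) (δ H (op P) (op Q)) = cut f hf'

namespace HornData

section Cuts

variable {H : FinIntᵒᵖ ⥤ VQuiver S V} [H.OplaxMonoidal] {N : FinInt} {i : ℕ} {s t : S}

/-- The element `v` has the prescribed image when cut along a morphism with gluing point less
than `K`. -/
def CutsBelow (D : HornData H N i s t) (K : ℕ) (v : (H.obj (op N)).Elt s t) : Prop :=
  ∀ {P Q : FinInt} (f : P ⊗ Q ⟶ N) (hf : Interior f), mid f < K →
    push v (H.map f.op ≫ δ H (op P) (op Q)) = D.cut f hf

variable [Preadditive V]

/-- Add `Z(d)`, where `d` is the error of the cut at `A`. That cut becomes correct because `Z` is a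
section of the comultiplication. By the left Frobenius identity, an earlier cut of `Z(d)` is
computed from the corresponding cut of the first factor of `d`, which vanishes because the earlier
cuts of `v` are already right. Only additivity in the element is used, not bilinearity of the tensor
product. -/
lemma exists_cutsBelow_succ {A B : FinInt} (Z : NaFStructure H) (D : HornData H (A ⊗ B) i s t)
    (hA : 0 < A.len) (hB : 0 < B.len) {v : (H.obj (op (A ⊗ B))).Elt s t}
    (hv : D.CutsBelow A.len v) : ∃ v', D.CutsBelow (A.len + 1) v' := by
  have hI : Interior (𝟙 (A ⊗ B)) := ⟨hA, Nat.lt_add_of_pos_right hB⟩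
  obtain ⟨d, hd⟩ : ∃ d, d = D.cut (𝟙 (A ⊗ B)) hI - push v (δ H (op A) (op B)) := ⟨_, rfl⟩
  refine ⟨v + push d (Z.mul (op A) (op B)), fun {P Q} f hf hK => ?_⟩
  rcases Nat.lt_succ_iff_lt_or_eq.mp hK with hK | hK
  -- An earlier gluing point refines the decomposition to `(C + R) + B`.
  · obtain ⟨C, R, rfl, hC⟩ : ∃ C R : FinInt, A = C ⊗ R ∧ mid f = C.len := by
      obtain ⟨r, hr⟩ := Nat.le.dest hK.le
      exact ⟨⟨mid f⟩, ⟨r⟩, congrArg FinInt.mk hr.symm, rfl⟩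
    have hI' : Interior ((α_ C R B).inv ≫ 𝟙 _) :=
      ⟨show 0 < C.len from hC ▸ hf.1, show C.len < _ from hC ▸ hf.2⟩
    -- Cutting the prescribed pair once more gives the prescribed triple, by `cut_assoc`; cutting
    -- `v` twice gives the same triple, by coassociativity and the hypothesis on `v`.
    have hd0 : push d (δ H (op C) (op R) ▷ H.obj (op B) ≫ (α_ _ _ _).hom) = 0 := by
      have e := hv _ hI' (show C.len < _ from hC ▸ hK)
      rw [hd, push_sub, D.cut_assoc _ hI hI', ← e, ← push_comp, ← push_comp, Category.comp_id,
        sub_eq_zero]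
      congr 1
      exact (Category.assoc _ _ _).trans (associativity H (op C) (op R) (op B)).symm
    obtain ⟨f₁, f₂, h⟩ := exists_eq_tensorHom (f ≫ (α_ C R B).hom) hC
    obtain rfl : f = (f₁ ⊗ₘ f₂) ≫ (α_ C R B).inv := by rw [← h, Category.assoc, Iso.hom_inv_id,
      Category.comp_id]
    have e : Z.mul (op (C ⊗ R)) (op B) ≫ H.map ((f₁ ⊗ₘ f₂) ≫ (α_ C R B).inv).op ≫
        δ H (op P) (op Q) = (δ H (op C) (op R) ▷ H.obj (op B) ≫ (α_ _ _ _).hom) ≫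
          H.obj (op C) ◁ Z.mul (op R) (op B) ≫ (H.map f₁.op ⊗ₘ H.map f₂.op) := by
      have e1 := Z.frobenius_left (op C) (op R) (op B)
      have e2 := δ_natural H f₁.op f₂.op
      rw [op_comp, H.map_comp, Category.assoc]
      refine (whisker_eq _ (whisker_eq _ e2.symm)).trans ?_
      refine Eq.trans ?_ ((eq_whisker e1.symm (H.map f₁.op ⊗ₘ H.map f₂.op)).trans ?_)
      · simp only [Category.assoc]; rfl
      · simp only [Category.assoc]
    rw [push_add, ← push_comp d, e, push_comp d, hd0]
    rw [hv _ hf hK]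
    simp [push]
  -- The gluing point is that of `A ⊗ B`, so this cut is a restriction of the one just repaired.
  · obtain ⟨f₁, f₂, rfl⟩ := exists_eq_tensorHom f hK
    have e := D.cut_comp f₁ f₂ (𝟙 _) hI (by rwa [Category.comp_id])
    have e1 := δ_natural H f₁.op f₂.op
    have e2 : H.map (f₁ ⊗ₘ f₂).op ≫ δ H (op P) (op Q) =
      δ H (op A) (op B) ≫ (H.map f₁.op ⊗ₘ H.map f₂.op) := e1.symm
    have e3 : D.cut (f₁ ⊗ₘ f₂) hf = D.cut ((f₁ ⊗ₘ f₂) ≫ 𝟙 _) (by rwa [Category.comp_id]) := by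
      congr 1
    rw [e3, e, e2, push_comp, push_add, ← push_comp, Z.mul_δ, push_id, hd, add_sub_cancel]

/-- The element `v` has the prescribed image when cut at an interior vertex. -/
def Cuts (D : HornData H N i s t) (v : (H.obj (op N)).Elt s t) : Prop :=
  ∀ {P Q : FinInt} (f : P ⊗ Q ⟶ N) (hf : Interior f),
    push v (H.map f.op ≫ δ H (op P) (op Q)) = D.cut f hf

/-- Start with zero and repair the cuts in increasing order of the gluing point. -/
lemma exists_cuts (Z : NaFStructure H) (D : HornData H N i s t) : ∃ v, D.Cuts v := by
  have h (K : ℕ) : ∃ v, D.CutsBelow K v := by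
    induction K with
    | zero => exact ⟨0, fun _ _ h => absurd h (Nat.not_lt_zero _)⟩
    | succ K ih =>
      obtain ⟨v, hv⟩ := ih
      by_cases hK : 0 < K ∧ K < N.len
      · obtain ⟨A, B, rfl, rfl⟩ : ∃ A B : FinInt, N = A ⊗ B ∧ K = A.len := by
          obtain ⟨r, hr⟩ := Nat.le.dest hK.2.le
          exact ⟨⟨K⟩, ⟨r⟩, congrArg FinInt.mk hr.symm, rfl⟩
        exact exists_cutsBelow_succ Z D hK.1 (Nat.pos_of_lt_add_right hK.2) hv
      -- No interior gluing point equals this `K`, so nothing has to be repaired.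
      · refine ⟨v, fun f hf hfK => hv f hf ?_⟩
        obtain ⟨h0, h1⟩ := hf
        omega
  obtain ⟨v, hv⟩ := h N.len
  exact ⟨v, fun f hf => hv f hf hf.2⟩

/-- The element `v` has the prescribed restrictions to the simplices that miss the vertex `k`. -/
def Agrees (D : HornData H N i s t) (v : (H.obj (op N)).Elt s t) (k : ℕ) : Prop :=
  ∀ {P : FinInt} (f : P ⟶ N) (hf : InHorn i f), Misses f k → push v (H.map f.op) = D.face f hf

/-- The map `r` collapses onto the face opposite `k`. Adding the prescribed value on `r` minus the
restriction of `v` along `r` corrects that face. The correction has zero cuts, since both terms have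
the prescribed ones, and it vanishes on every other face that was already correct, except possibly
the face opposite `k'`. -/
lemma exists_agrees (D : HornData H N i s t) {v : (H.obj (op N)).Elt s t} (hv : D.Cuts v)
    {k k' : ℕ} (h : k' = k + 1 ∨ k = k' + 1) (h0 : 0 < k) (h1 : k < N.len) (h0' : 0 < k')
    (h1' : k' < N.len) (hi : k ≠ i) :
    ∃ v', D.Cuts v' ∧ D.Agrees v' k ∧ ∀ j ≤ N.len, j ≠ k' → j ≠ i → D.Agrees v j →
      D.Agrees v' j := by
  let r := move N ⟨k, by omega⟩ ⟨k', by omega⟩ h h0 h1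
  have hr (x) : (r.toOrderHom x : ℕ) = if (x : ℕ) = k then k' else x := by
    change ((if x = ⟨k, _⟩ then (⟨k', _⟩ : Fin _) else x : Fin _) : ℕ) = _
    simp only [Fin.ext_iff]
    split_ifs <;> rfl
  have hrk : Misses r k := fun x => by
    rw [hr]
    split_ifs <;> omega
  have hrH : InHorn i r := ⟨k, h1.le, hi, hrk⟩
  have e {P : FinInt} (f : P ⟶ N) : push (v + (D.face r hrH - push v (H.map r.op))) (H.map f.op) =
      push v (H.map f.op) + (D.face (f ≫ r) (hrH.comp f) - push v (H.map (f ≫ r).op)) := by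
    rw [push_add, push_sub, ← push_comp, D.face_comp, op_comp, H.map_comp]
  refine ⟨v + (D.face r hrH - push v (H.map r.op)), fun {P Q} f hf => ?_, fun {P} f hf hfk => ?_,
    fun j hj hjk hji hvj {P} f hf hfj => ?_⟩
  -- Since `k'` is interior, `r` keeps interior gluing points interior, so the prescribed cuts apply
  -- to both terms.
  · have hfr : Interior (f ≫ r) := by
      obtain ⟨h2, h3⟩ := hf
      unfold Interior
      have e1 : mid (f ≫ r) = if mid f = k then k' else mid f := hr _
      rw [e1]
      split_ifs <;> omega
    have e1 := hv f hf
    have e2 := hv (f ≫ r) hfr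
    rw [push_comp] at e1 e2
    rw [push_comp, e, push_add, push_sub, e1, e2]
    have e3 := D.push_face (f ≫ r) (hrH.comp f) hfr
    exact (congrArg (fun t => _ + (t - _)) e3).trans (by rw [sub_self, add_zero])
  · have hfr : f ≫ r = f := hom_ext fun x => (hr _).trans (if_neg (hfk x))
    rw [e]
    have e1 : D.face (f ≫ r) (hrH.comp f) = D.face f hf := by
      congr 1
    rw [e1, hfr, add_sub_cancel]
  -- Applying `r` can only add `k'` to the image; hence `j ≠ k'` stays missed.
  · have hfr : Misses (f ≫ r) j := fun x => by
      rw [comp_apply, hr]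
      have := hfj x
      split_ifs <;> omega
    rw [e, hvj f hf hfj, hvj (f ≫ r) (hrH.comp f) hfr, sub_self, add_zero]

/-- Horn data with values in a colax monoidal functor with a nonassociative Frobenius structure
can be filled. -/
theorem exists_filler (Z : NaFStructure H) (D : HornData H N i s t) (h0 : 0 < i) (h1 : i < N.len) :
    ∃ v, D.Cuts v ∧ ∀ {P : FinInt} (f : P ⟶ N) (hf : InHorn i f),
      push v (H.map f.op) = D.face f hf := by
  -- Below `i` the faces are repaired upwards with `k' = k + 1`: the face at risk is either not yet
  -- treated or the missing face `i`.
  have step₁ (K : ℕ) : ∃ v, D.Cuts v ∧ ∀ k, 0 < k → k < K → k < i → D.Agrees v k := by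
    induction K with
    | zero =>
      obtain ⟨v, hv⟩ := D.exists_cuts Z
      exact ⟨v, hv, fun k _ hk => absurd hk (Nat.not_lt_zero _)⟩
    | succ K ih =>
      obtain ⟨v, hv, hvk⟩ := ih
      by_cases hK : 0 < K ∧ K < i
      · obtain ⟨v', hv', hK', h⟩ := D.exists_agrees hv (k := K) (k' := K + 1) (.inl rfl) hK.1
          (by omega) (by omega) (by omega) (by omega)
        refine ⟨v', hv', fun k hk0 hkK hki => ?_⟩
        rcases Nat.lt_succ_iff_lt_or_eq.mp hkK with hlt | rfl
        · exact h k (by omega) (by omega) (by omega) (hvk k hk0 hlt hki)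
        · exact hK'
      · exact ⟨v, hv, fun k hk0 hkK hki => hvk k hk0 (by omega) hki⟩
  -- Above `i` they are repaired downwards with `k' = k - 1`, which is at least `i`, so the faces
  -- below `i` are safe. The number `M` bounds the distance of the treated faces from the top.
  have step₂ (M : ℕ) : ∃ v, D.Cuts v ∧ (∀ k, 0 < k → k < i → D.Agrees v k) ∧
      ∀ k, i < k → k < N.len → N.len ≤ k + M → D.Agrees v k := by
    induction M with
    | zero =>
      obtain ⟨v, hv, hvk⟩ := step₁ i
      exact ⟨v, hv, fun k hk hki => hvk k hk hki hki, fun k _ hk hk' => by omega⟩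
    | succ M ih =>
      obtain ⟨v, hv, hvk, hvk'⟩ := ih
      by_cases hM : i + (M + 1) < N.len
      · obtain ⟨v', hv', hM', h⟩ := D.exists_agrees hv (k := N.len - (M + 1))
          (k' := N.len - (M + 1) - 1) (.inr (by omega)) (by omega) (by omega) (by omega)
          (by omega) (by omega)
        refine ⟨v', hv', fun k hk0 hki => h k (by omega) (by omega) (by omega) (hvk k hk0 hki),
          fun k hki hkN hkM => ?_⟩
        rcases Nat.lt_or_ge (N.len - (M + 1)) k with hlt | hle
        · exact h k (by omega) (by omega) (by omega) (hvk' k hki hkN (by omega))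
        · obtain rfl : k = N.len - (M + 1) := by omega
          exact hM'
      · exact ⟨v, hv, hvk, fun k hki hkN _ => hvk' k hki hkN (by omega)⟩
  obtain ⟨v, hv, hvk, hvk'⟩ := step₂ N.len
  refine ⟨v, hv, fun f hf => ?_⟩
  obtain ⟨k, hk0, hkN, hki, hfk⟩ := hf.exists_misses
  rcases lt_or_gt_of_ne hki with hlt | hgt
  · exact hvk k hk0 hlt f hf hfk
  · exact hvk' k hgt hkN (by omega) f hf hfk

end Cuts

end HornData

end HornFilling

/-! ### Morphisms out of free templicial objects on horns -/

namespace SSetTemplicial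

variable {Y : SSet.{u}}

lemma restrict_comp {l m n : FinInt} (f : l ⟶ m) (g : m ⟶ n) {a b : vertices Y}
    (y : (quiver Y n).obj a b) : restrict (f ≫ g) y = restrict f (restrict g y) :=
  quiver_ext ((map_map (FinInt.toSimplex.map f) (FinInt.toSimplex.map g) y.1).trans
    (map_congr (fun _ => rfl) y.1)).symm

/-- The initial face of a simplex of dimension `m + n`. -/
def frontFace {m n : FinInt} {a b : vertices Y} (y : (quiver Y (m ⊗ n)).obj a b) :
    (quiver Y m).obj a (vertex y.1 (FinInt.joint m n)) :=
  ⟨Y.map (FinInt.front m n).op y.1, (vertex_map _ y.1 rfl).trans y.2.1, vertex_map _ y.1 rfl⟩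

/-- The final face of a simplex of dimension `m + n`. -/
def backFace {m n : FinInt} {a b : vertices Y} (y : (quiver Y (m ⊗ n)).obj a b) :
    (quiver Y n).obj (vertex y.1 (FinInt.joint m n)) b :=
  ⟨Y.map (FinInt.back m n).op y.1, vertex_map _ y.1 rfl, (vertex_map _ y.1 rfl).trans y.2.2⟩

end SSetTemplicial

namespace Templicial

open SSetTemplicial VQuiver FinInt

variable {V : Type w} [Category.{u} V] [MonoidalCategory V] [TensorCocomplete V]
  {X : Templicial V}

section Subcomplex

variable {Y : SSet.{u}} {A : Y.Subcomplex} (hA : ∀ a : vertices Y, a ∈ A.obj (op ⦋0⦌))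
  (G : (freeTemplicial V).obj (A : SSet.{u}) ⟶ X)

/-- The action on vertices of a morphism defined on a subcomplex that contains all vertices. -/
def baseMap (a : vertices Y) : X.base := Hom.toFun G (⟨a, hA a⟩ : (A : SSet.{u}).obj (op ⦋0⦌))

/-- A simplex that belongs to a subcomplex, as a simplex of the subcomplex. -/
def toSub {n : FinInt} {a b : vertices Y} (y : (quiver Y n).obj a b) (hy : y.1 ∈ A.obj _) :
    (quiver (A : SSet.{u}) n).obj ⟨a, hA a⟩ ⟨b, hA b⟩ :=
  ⟨⟨y.1, hy⟩, Subtype.ext y.2.1, Subtype.ext y.2.2⟩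

/-- The value on a simplex of a morphism defined on a subcomplex that contains all vertices. -/
noncomputable def evalSub {n : FinInt} {a b : vertices Y} (y : (quiver Y n).obj a b)
    (hy : y.1 ∈ A.obj _) : (X.functor.obj (op n)).Elt (baseMap hA G a) (baseMap hA G b) :=
  eval G (toSub hA y hy)

lemma evalSub_restrict {m n : FinInt} (f : m ⟶ n) {a b : vertices Y} (y : (quiver Y n).obj a b)
    (hy : y.1 ∈ A.obj _) (hy' : (restrict f y).1 ∈ A.obj _) :
    evalSub hA G (restrict f y) hy' = push (evalSub hA G y hy) (X.functor.map f.op) :=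
  eval_restrict G f (toSub hA y hy)

lemma evalSub_comul {m n : FinInt} {a b c : vertices Y} (y : (quiver Y (m ⊗ n)).obj a b)
    (p : (quiver Y m).obj a c) (q : (quiver Y n).obj c b)
    (hp : p.1 = Y.map (FinInt.front m n).op y.1) (hq : q.1 = Y.map (FinInt.back m n).op y.1)
    (hy : y.1 ∈ A.obj _) (hp' : p.1 ∈ A.obj _) (hq' : q.1 ∈ A.obj _) :
    push (evalSub hA G y hy) (δ X.functor (op m) (op n)) =
      pair (evalSub hA G p hp') (evalSub hA G q hq') :=
  eval_comul G (toSub hA y hy) (toSub hA p hp') (toSub hA q hq') (Subtype.ext hp) (Subtype.ext hq)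

lemma evalSub_counit {a b : vertices Y} (y : (quiver Y (𝟙_ FinInt)).obj a b)
    (hy : y.1 ∈ A.obj _) : push (evalSub hA G y hy) (η X.functor) =
      unitι (congrArg (baseMap hA G) (y.2.1.symm.trans y.2.2)) :=
  eval_counit G (toSub hA y hy)

/-- The simplices determine the middle vertex, so equality of simplices suffices although the
elements have dependent types. -/
lemma pair_evalSub_congr {m n : FinInt} {a b c c' : vertices Y} {p : (quiver Y m).obj a c}
    {q : (quiver Y n).obj c b} {p' : (quiver Y m).obj a c'} {q' : (quiver Y n).obj c' b}
    (hp : p.1 ∈ A.obj _) (hq : q.1 ∈ A.obj _) (hp' : p'.1 ∈ A.obj _) (hq' : q'.1 ∈ A.obj _)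
    (e : p.1 = p'.1) (e' : q.1 = q'.1) :
    pair (evalSub hA G p hp) (evalSub hA G q hq) =
      pair (evalSub hA G p' hp') (evalSub hA G q' hq') := by
  obtain rfl : c = c' := by rw [← p.2.2, ← p'.2.2, e]
  obtain rfl := quiver_ext e
  obtain rfl := quiver_ext e'
  rfl

lemma pair_pair_evalSub_congr {l m n : FinInt} {a b c c' d d' : vertices Y}
    {p : (quiver Y l).obj a d} {q : (quiver Y m).obj d c} {r : (quiver Y n).obj c b}
    {p' : (quiver Y l).obj a d'} {q' : (quiver Y m).obj d' c'} {r' : (quiver Y n).obj c' b}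
    (hp : p.1 ∈ A.obj _) (hq : q.1 ∈ A.obj _) (hr : r.1 ∈ A.obj _)
    (hp' : p'.1 ∈ A.obj _) (hq' : q'.1 ∈ A.obj _) (hr' : r'.1 ∈ A.obj _)
    (e : p.1 = p'.1) (e' : q.1 = q'.1) (e'' : r.1 = r'.1) :
    pair (evalSub hA G p hp) (pair (evalSub hA G q hq) (evalSub hA G r hr)) =
      pair (evalSub hA G p' hp') (pair (evalSub hA G q' hq') (evalSub hA G r' hr')) := by
  obtain rfl : d = d' := by rw [← p.2.2, ← p'.2.2, e]
  obtain rfl : c = c' := by rw [← q.2.2, ← q'.2.2, e']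
  obtain rfl := quiver_ext e
  obtain rfl := quiver_ext e'
  obtain rfl := quiver_ext e''
  rfl

end Subcomplex

section Horn

/-- The nondegenerate simplex of maximal dimension of a standard simplex. -/
def topSimplex (N : FinInt) : simplices (Δ[N.len] : SSet.{u}) N :=
  SSet.stdSimplex.objEquiv.symm (𝟙 ⦋N.len⦌)

/-- The nondegenerate simplex of maximal dimension of a standard simplex. -/
def top (N : FinInt) : (quiver (Δ[N.len] : SSet.{u}) N).obj (vertex (topSimplex N) 0)
    (vertex (topSimplex N) (Fin.last _)) := ⟨topSimplex N, rfl, rfl⟩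

variable {N : FinInt} {i : Fin (N.len + 1)}

lemma restrict_top_mem {P : FinInt} (f : P ⟶ N) :
    (restrict f (top.{u} N)).1 ∈ (SSet.horn.{u} N.len i).obj _ ↔ InHorn i f := by
  refine (SSet.mem_horn_iff_notMem_range (d := P.len) _ i).trans ⟨?_, ?_⟩
  · rintro ⟨k, hk, h⟩
    exact ⟨k, Nat.le_of_lt_succ k.2, fun e => hk (Fin.ext e), fun x hx => h ⟨x, Fin.ext hx⟩⟩
  · rintro ⟨k, hkN, hk, h⟩
    refine ⟨⟨k, Nat.lt_succ_of_le hkN⟩, fun e => hk (congrArg Fin.val e), ?_⟩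
    rintro ⟨x, hx⟩
    exact h x (congrArg Fin.val hx)

/-- The initial piece stops at the gluing point and so misses the last vertex, which differs from
`i`. Such pieces need not preserve endpoints, which is why cuts are recorded separately from faces.
-/
lemma frontFace_mem {P Q : FinInt} (f : P ⊗ Q ⟶ N) (hf : Interior f) (hl : i < Fin.last _) :
    (frontFace (restrict f (top.{u} N))).1 ∈ (SSet.horn.{u} N.len i).obj _ := by
  refine (SSet.mem_horn_iff_notMem_range (d := P.len) _ i).mpr ⟨Fin.last _, hl.ne', ?_⟩
  rintro ⟨x, hx⟩
  have h : (f.toOrderHom (⟨x, by have := x.2; simp only [tensorObj_len]; omega⟩) : ℕ) ≤ mid f :=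
    f.toOrderHom.monotone (Nat.le_of_lt_succ x.2)
  have h' : (f.toOrderHom (⟨x, by have := x.2; simp only [tensorObj_len]; omega⟩) : ℕ) = N.len :=
    congrArg Fin.val hx
  exact absurd hf.2 (h' ▸ h).not_gt

lemma backFace_mem {P Q : FinInt} (f : P ⊗ Q ⟶ N) (hf : Interior f) (h0 : 0 < i) :
    (backFace (restrict f (top.{u} N))).1 ∈ (SSet.horn.{u} N.len i).obj _ := by
  refine (SSet.mem_horn_iff_notMem_range (d := Q.len) _ i).mpr ⟨0, h0.ne, ?_⟩
  rintro ⟨x, hx⟩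
  have h : mid f ≤
      (f.toOrderHom (⟨P.len + x, by have := x.2; simp only [tensorObj_len]; omega⟩) : ℕ) :=
    f.toOrderHom.monotone (Nat.le_add_right _ _)
  have h' : (f.toOrderHom (⟨P.len + x, by have := x.2; simp only [tensorObj_len]; omega⟩) : ℕ) = 0 :=
    congrArg Fin.val hx
  exact absurd hf.1 (h' ▸ h).not_gt

/-- An inner index forces dimension at least two, where a horn contains all vertices. -/
lemma vertex_mem (h0 : 0 < i) (hl : i < Fin.last _) (a : vertices (Δ[N.len] : SSet.{u})) :
    a ∈ (SSet.horn.{u} N.len i).obj (op ⦋0⦌) := by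
  have h0' : 0 < (i : ℕ) := h0
  have hl' : (i : ℕ) < N.len := hl
  rw [SSet.horn_obj_eq_univ i 0]
  trivial

/-- The values on a horn of a morphism out of the free templicial object. -/
noncomputable def hornData (h0 : 0 < i) (hl : i < Fin.last _)
    (G : (freeTemplicial V).obj (Λ[N.len, i] : SSet.{u}) ⟶ X) :
    HornData X.functor N i (baseMap (vertex_mem h0 hl) G (vertex (topSimplex N) 0))
      (baseMap (vertex_mem h0 hl) G (vertex (topSimplex N) (Fin.last _))) where
  face f hf := evalSub _ G (restrict f (top N)) ((restrict_top_mem f).mpr hf)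
  cut f hf := pair (evalSub _ G (frontFace (restrict f (top N))) (frontFace_mem f hf hl))
    (evalSub _ G (backFace (restrict f (top N))) (backFace_mem f hf h0))
  face_comp g f hf := evalSub_restrict _ G g (restrict f (top N)) ((restrict_top_mem f).mpr hf)
    ((restrict_top_mem (g ≫ f)).mpr (hf.comp g))
  cut_comp {P Q P' Q'} g h f hf hf' := by
    rw [push_pair_tensorHom,
      ← evalSub_restrict _ G g (frontFace (restrict f (top N))) (frontFace_mem f hf hl)
        ((SSet.horn.{u} N.len i).map _ (frontFace_mem f hf hl)),
      ← evalSub_restrict _ G h (backFace (restrict f (top N))) (backFace_mem f hf h0)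
        ((SSet.horn.{u} N.len i).map _ (backFace_mem f hf h0))]
    refine pair_evalSub_congr _ G _ _ _ _ ?_ ?_
    · rw [restrict_comp]
      exact map_comm (front_tensorHom g h) _
    · rw [restrict_comp]
      exact map_comm (back_tensorHom g h) _
  -- Both sides are the triple of initial, middle and final pieces: the first by cutting the initial
  -- piece, the second by cutting the final one.
  cut_assoc {P Q R} f hf hf' := by
    have hp := frontFace_mem f hf hl
    have hq' := backFace_mem _ hf' h0
    rw [push_comp, push_pair_whiskerRight, push_pair_whiskerLeft,
      evalSub_comul _ G (frontFace (restrict f (top N)))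
        (frontFace (frontFace (restrict f (top N)))) (backFace (frontFace (restrict f (top N))))
        rfl rfl hp ((SSet.horn.{u} N.len i).map _ hp) ((SSet.horn.{u} N.len i).map _ hp),
      evalSub_comul _ G (backFace (restrict ((α_ P Q R).inv ≫ f) (top N)))
        (frontFace (backFace (restrict ((α_ P Q R).inv ≫ f) (top N))))
        (backFace (backFace (restrict ((α_ P Q R).inv ≫ f) (top N))))
        rfl rfl hq' ((SSet.horn.{u} N.len i).map _ hq') ((SSet.horn.{u} N.len i).map _ hq'),
      push_pair_associator]
    refine pair_pair_evalSub_congr _ G _ _ _ _ _ _ ?_ ?_ ?_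
    · rw [restrict_comp]
      exact map_comm (front_front P Q R) _
    · rw [restrict_comp]
      exact (map_comm₃ (back_front P Q R) _)
    · rw [restrict_comp]
      refine Eq.trans ?_ (map_comm₃ (f := 𝟙 _) ((Category.id_comp _).trans (back_back P Q R)) _)
      exact ((ConcreteCategory.congr_hom ((Δ[N.len] : SSet.{u}).map_id _) _).trans
        (types_id_apply _ _)).symm
  push_face f hf hf' := evalSub_comul _ G _ _ _ rfl rfl _ _ _

end Horn

end Templicial

/-! ### Extension along inner horn inclusions -/

namespace FinInt

lemma exists_toSimplex_map {P N : FinInt} (α : toSimplex.obj P ⟶ toSimplex.obj N)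
    (h0 : ∃ x, val α x = 0) (hl : ∃ x, val α x = N.len) :
    ∃ f : P ⟶ N, toSimplex.map f = α := by
  obtain ⟨x, hx⟩ := h0
  obtain ⟨y, hy⟩ := hl
  refine ⟨⟨α.toOrderHom, Fin.ext (Nat.le_zero.mp ?_), Fin.ext (le_antisymm ?_ ?_)⟩, rfl⟩
  · exact (show val α 0 ≤ val α x from α.toOrderHom.monotone (Fin.zero_le _)).trans hx.le
  · exact Nat.le_of_lt_succ (α.toOrderHom (Fin.last _)).2
  · exact hy.ge.trans (show val α y ≤ val α (Fin.last _) from α.toOrderHom.monotone (Fin.le_last _))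

lemma front_comp_leftUnitor {P Q N : FinInt} (f : P ⟶ 𝟙_ FinInt) (g : Q ⟶ N) :
    front P Q ≫ toSimplex.map ((f ⊗ₘ g) ≫ (λ_ N).hom) = toSimplex.map f ≫ vertex N 0 := by
  rw [Functor.map_comp, ← Category.assoc, front_tensorHom, Category.assoc]
  refine whisker_eq _ (toSimplex_hom_ext fun (x : Fin 1) => ?_)
  rw [Subsingleton.elim x 0]
  rfl

lemma back_comp_leftUnitor {P Q N : FinInt} (f : P ⟶ 𝟙_ FinInt) (g : Q ⟶ N) :
    back P Q ≫ toSimplex.map ((f ⊗ₘ g) ≫ (λ_ N).hom) = toSimplex.map g := by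
  rw [Functor.map_comp, ← Category.assoc, back_tensorHom, Category.assoc, back_leftUnitor,
    Category.comp_id]

lemma front_comp_rightUnitor {P Q N : FinInt} (f : P ⟶ N) (g : Q ⟶ 𝟙_ FinInt) :
    front P Q ≫ toSimplex.map ((f ⊗ₘ g) ≫ (ρ_ N).hom) = toSimplex.map f := by
  rw [Functor.map_comp, ← Category.assoc, front_tensorHom, Category.assoc, front_rightUnitor,
    Category.comp_id]

lemma back_comp_rightUnitor {P Q N : FinInt} (f : P ⟶ N) (g : Q ⟶ 𝟙_ FinInt) :
    back P Q ≫ toSimplex.map ((f ⊗ₘ g) ≫ (ρ_ N).hom) =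
      toSimplex.map g ≫ vertex N (Fin.last _) := by
  rw [Functor.map_comp, ← Category.assoc, back_tensorHom, Category.assoc]
  refine whisker_eq _ (toSimplex_hom_ext fun (x : Fin 1) => ?_)
  rw [Subsingleton.elim x 0]
  rfl

end FinInt

namespace SSetTemplicial

variable {Y : SSet.{u}}

/-- A vertex, as a simplex of dimension zero. -/
def point (a : vertices Y) : (quiver Y (𝟙_ FinInt)).obj a a :=
  ⟨a, vertex_zero a _, vertex_zero a _⟩

end SSetTemplicial

namespace Templicial

open SSetTemplicial VQuiver FinInt

variable {V : Type w} [Category.{u} V] [MonoidalCategory V] [TensorCocomplete V]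

section Unit

variable {S : Type u} {H : FinIntᵒᵖ ⥤ VQuiver S V} [H.OplaxMonoidal] {a b : S}

variable (H) in
lemma map_comp_δ {P Q A B N : FinInt} (f : P ⟶ A) (g : Q ⟶ B) (h : A ⊗ B ⟶ N) :
    H.map ((f ⊗ₘ g) ≫ h).op ≫ δ H (op P) (op Q) =
      (H.map h.op ≫ δ H (op A) (op B)) ≫ (H.map f.op ⊗ₘ H.map g.op) := by
  rw [op_comp, H.map_comp, Category.assoc, Category.assoc]
  exact whisker_eq _ (δ_natural H f.op g.op).symm

/-- Counitality and the invertible counit force the comultiplication at `[0] + N`, so cutting at an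
endpoint imposes no condition on `v`. -/
lemma push_leftUnitor_δ {N : FinInt} (v : (H.obj (op N)).Elt a b)
    (e : (H.obj (op (𝟙_ FinInt))).Elt a a) [IsIso (η H)] (he : push e (η H) = unitι rfl) :
    push v (H.map (λ_ N).hom.op ≫ δ H (op (𝟙_ FinInt)) (op N)) = pair e v := by
  have h : H.map (λ_ N).hom.op ≫ δ H (op (𝟙_ FinInt)) (op N) =
      (λ_ _).inv ≫ inv (η H) ▷ H.obj (op N) := by
    have h' := left_unitality H (op N)
    rw [h', Category.assoc, Category.assoc, hom_inv_whiskerRight']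
    exact whisker_eq _ (Category.comp_id _).symm
  rw [h, push_comp, push_leftUnitor_inv, push_pair_whiskerRight, ← he, ← push_comp,
    IsIso.hom_inv_id, push_id]

lemma push_rightUnitor_δ {N : FinInt} (v : (H.obj (op N)).Elt a b)
    (e : (H.obj (op (𝟙_ FinInt))).Elt b b) [IsIso (η H)] (he : push e (η H) = unitι rfl) :
    push v (H.map (ρ_ N).hom.op ≫ δ H (op N) (op (𝟙_ FinInt))) = pair v e := by
  have h : H.map (ρ_ N).hom.op ≫ δ H (op N) (op (𝟙_ FinInt)) =
      (ρ_ _).inv ≫ H.obj (op N) ◁ inv (η H) := by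
    have h' := right_unitality H (op N)
    rw [h', Category.assoc, Category.assoc, whiskerLeft_hom_inv']
    exact whisker_eq _ (Category.comp_id _).symm
  rw [h, push_comp, push_rightUnitor_inv, push_pair_whiskerLeft, ← he, ← push_comp,
    IsIso.hom_inv_id, push_id]

end Unit

variable {X : Templicial V} {N : FinInt} {i : Fin (N.len + 1)}

/-- A simplex outside the horn hits every vertex other than `i`, in particular both endpoints
because `i` is inner. It is therefore given by a morphism of finite intervals, and a value on the
top simplex determines its value. -/
lemma mem_horn_or_exists {P : FinInt} {a b : vertices (Δ[N.len] : SSet.{u})}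
    (h0 : 0 < i) (hl : i < Fin.last _) (y : (quiver (Δ[N.len] : SSet.{u}) P).obj a b) :
    y.1 ∈ (SSet.horn.{u} N.len i).obj _ ∨ ∃ (f : P ⟶ N) (_ : vertex (topSimplex N) 0 = a)
      (_ : vertex (topSimplex N) (Fin.last _) = b), y.1 = (restrict f (top N)).1 := by
  by_cases hy : y.1 ∈ (SSet.horn.{u} N.len i).obj _
  · exact .inl hy
  · right
    have hy' := fun h => hy ((SSet.mem_horn_iff_notMem_range (d := P.len) _ i).mpr h)
    obtain ⟨x, hx⟩ := not_not.mp fun h => hy' ⟨0, h0.ne, h⟩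
    obtain ⟨z, hz⟩ := not_not.mp fun h => hy' ⟨Fin.last _, hl.ne', h⟩
    obtain ⟨f, hf⟩ := exists_toSimplex_map (SSet.stdSimplex.objEquiv y.1)
      ⟨x, congrArg Fin.val hx⟩ ⟨z, congrArg Fin.val hz⟩
    have e : y.1 = (restrict f (top N)).1 := SSet.stdSimplex.objEquiv.injective hf.symm
    exact ⟨f, (restrict f (top N)).2.1.symm.trans ((congrArg (vertex · 0) e.symm).trans y.2.1),
      (restrict f (top N)).2.2.symm.trans ((congrArg (vertex · (Fin.last _)) e.symm).trans y.2.2), e⟩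

lemma restrict_top_injective {P : FinInt} {f g : P ⟶ N}
    (h : (restrict f (top.{u} N)).1 = (restrict g (top N)).1) : f = g :=
  hom_ext fun x => congrArg (fun α => (α.toOrderHom x : ℕ))
    (SSet.stdSimplex.objEquiv.injective.eq_iff.mpr h)

variable (h0 : 0 < i) (hl : i < Fin.last _) (G : (freeTemplicial V).obj (Λ[N.len, i] : SSet.{u}) ⟶ X)
  (v : (X.functor.obj (op N)).Elt (baseMap (vertex_mem h0 hl) G (vertex (topSimplex N) 0))
      (baseMap (vertex_mem h0 hl) G (vertex (topSimplex N) (Fin.last _))))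

open Classical in
/-- The extension of a morphism defined on a horn that sends the top simplex to `v`. -/
noncomputable def extend {P : FinInt} {a b : vertices (Δ[N.len] : SSet.{u})}
    (y : (quiver (Δ[N.len] : SSet.{u}) P).obj a b) :
    (X.functor.obj (op P)).Elt (baseMap (vertex_mem h0 hl) G a) (baseMap (vertex_mem h0 hl) G b) :=
  if hy : y.1 ∈ (SSet.horn.{u} N.len i).obj _ then evalSub (vertex_mem h0 hl) G y hy
  else
    have h := (mem_horn_or_exists h0 hl y).resolve_left hy
    -- The transports identify `a` and `b` with the endpoints of the top simplex.
    h.choose_spec.choose ▸ h.choose_spec.choose_spec.choose ▸ push v (X.functor.map h.choose.op)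

lemma extend_of_mem {P : FinInt} {a b : vertices (Δ[N.len] : SSet.{u})}
    (y : (quiver (Δ[N.len] : SSet.{u}) P).obj a b) (hy : y.1 ∈ (SSet.horn.{u} N.len i).obj _) :
    extend h0 hl G v y = evalSub (vertex_mem h0 hl) G y hy :=
  dif_pos hy

/-- On the horn this is the hypothesis on the faces of `v`; off the horn the chosen morphism is `f`,
since simplices of the standard simplex determine their maps. -/
lemma extend_restrict_top
    (hv : ∀ {P : FinInt} (f : P ⟶ N) (hf : InHorn i f),
      push v (X.functor.map f.op) = (hornData h0 hl G).face f hf)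
    {P : FinInt} (f : P ⟶ N) :
    extend h0 hl G v (restrict f (top N)) = push v (X.functor.map f.op) := by
  by_cases hf : InHorn i f
  · exact (extend_of_mem h0 hl G v _ ((restrict_top_mem f).mpr hf)).trans (hv f hf).symm
  · have hf' := fun h => hf ((restrict_top_mem.{u} f).mp h)
    refine (dif_neg hf').trans ?_
    have h := (mem_horn_or_exists h0 hl (restrict f (top.{u} N))).resolve_left hf'
    have e : h.choose = f :=
      (restrict_top_injective h.choose_spec.choose_spec.choose_spec).symm
    change push v (X.functor.map h.choose.op) = _
    rw [e]

lemma extend_restrict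
    (hv : ∀ {P : FinInt} (f : P ⟶ N) (hf : InHorn i f),
      push v (X.functor.map f.op) = (hornData h0 hl G).face f hf)
    {P Q : FinInt} (f : P ⟶ Q) {a b : vertices (Δ[N.len] : SSet.{u})}
    (y : (quiver (Δ[N.len] : SSet.{u}) Q).obj a b) :
    extend h0 hl G v (restrict f y) = push (extend h0 hl G v y) (X.functor.map f.op) := by
  rcases mem_horn_or_exists h0 hl y with hy | ⟨g, rfl, rfl, hy⟩
  · have hy' := (SSet.horn.{u} N.len i).map (toSimplex.map f).op hy
    rw [extend_of_mem h0 hl G v y hy, extend_of_mem h0 hl G v (restrict f y) hy']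
    exact evalSub_restrict _ G f y hy hy'
  · obtain rfl : y = restrict g (top N) := quiver_ext hy
    rw [← restrict_comp, extend_restrict_top h0 hl G v hv, extend_restrict_top h0 hl G v hv,
      op_comp, Functor.map_comp, push_comp]

lemma extend_counit {a b : vertices (Δ[N.len] : SSet.{u})}
    (y : (quiver (Δ[N.len] : SSet.{u}) (𝟙_ FinInt)).obj a b) :
    push (extend h0 hl G v y) (η X.functor) =
      unitι (congrArg (baseMap (vertex_mem h0 hl) G) (y.2.1.symm.trans y.2.2)) := by
  rw [extend_of_mem h0 hl G v y (vertex_mem h0 hl y.1)]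
  exact evalSub_counit _ G y _

/-- Simplices of the horn are governed by `G`. For the others the position of the gluing point
decides: an interior one is a prescribed cut of `v`, and one at an endpoint is covered by
counitality. -/
lemma extend_comul
    (hv : ∀ {P : FinInt} (f : P ⟶ N) (hf : InHorn i f),
      push v (X.functor.map f.op) = (hornData h0 hl G).face f hf)
    (hc : (hornData h0 hl G).Cuts v) {P Q : FinInt}
    {a b c : vertices (Δ[N.len] : SSet.{u})}
    (y : (quiver (Δ[N.len] : SSet.{u}) (P ⊗ Q)).obj a b)
    (p : (quiver (Δ[N.len] : SSet.{u}) P).obj a c) (q : (quiver (Δ[N.len] : SSet.{u}) Q).obj c b)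
    (hp : p.1 = (Δ[N.len] : SSet.{u}).map (front P Q).op y.1)
    (hq : q.1 = (Δ[N.len] : SSet.{u}).map (back P Q).op y.1) :
    push (extend h0 hl G v y) (δ X.functor (op P) (op Q)) =
      pair (extend h0 hl G v p) (extend h0 hl G v q) := by
  rcases mem_horn_or_exists h0 hl y with hy | ⟨f, rfl, rfl, hy⟩
  · have hp' : p.1 ∈ (SSet.horn.{u} N.len i).obj _ := by
      rw [hp]; exact (SSet.horn.{u} N.len i).map _ hy
    have hq' : q.1 ∈ (SSet.horn.{u} N.len i).obj _ := by
      rw [hq]; exact (SSet.horn.{u} N.len i).map _ hy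
    rw [extend_of_mem h0 hl G v y hy, extend_of_mem h0 hl G v p hp',
      extend_of_mem h0 hl G v q hq', evalSub_comul _ G y p q hp hq hy hp' hq']
  · obtain rfl : y = restrict f (top N) := quiver_ext hy
    have hle : mid f ≤ N.len := Nat.le_of_lt_succ (f.toOrderHom _).2
    rw [extend_restrict_top h0 hl G v hv, ← push_comp]
    by_cases hf : Interior f
    · have hp' : p.1 ∈ (SSet.horn.{u} N.len i).obj _ := by
        rw [hp]; exact frontFace_mem f hf hl
      have hq' : q.1 ∈ (SSet.horn.{u} N.len i).obj _ := by
        rw [hq]; exact backFace_mem f hf h0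
      rw [hc f hf, extend_of_mem h0 hl G v p hp', extend_of_mem h0 hl G v q hq']
      exact pair_evalSub_congr _ G _ _ _ _ hp.symm hq.symm
    · rcases Nat.eq_zero_or_pos (mid f) with hf0 | hf0
      -- The gluing point is the first vertex: the initial piece is degenerate on a point, and the
      -- final piece is again a restriction of the top simplex.
      · obtain ⟨f₁, f₂, h⟩ := exists_eq_tensorHom (C := 𝟙_ _) (D := N) (f ≫ (λ_ N).inv) hf0
        obtain rfl : f = (f₁ ⊗ₘ f₂) ≫ (λ_ N).hom := by
          rw [← h, Category.assoc, Iso.inv_hom_id, Category.comp_id]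
        have hq' : q.1 = (restrict f₂ (top N)).1 :=
          hq.trans ((map_map _ _ _).trans (by rw [back_comp_leftUnitor]; rfl))
        obtain rfl : vertex (topSimplex N) 0 = c := by
          rw [← q.2.1, hq']; exact (restrict f₂ (top N)).2.1.symm
        obtain rfl := quiver_ext hq'
        obtain rfl : p = restrict f₁ (point (vertex (topSimplex N) 0)) :=
          quiver_ext (hp.trans (map_comm (front_comp_leftUnitor f₁ f₂) (topSimplex N)))
        rw [extend_restrict_top h0 hl G v hv, extend_restrict h0 hl G v hv, ← push_pair_tensorHom,
          ← push_leftUnitor_δ v _ (extend_counit h0 hl G v (point (vertex (topSimplex N) 0))),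
          ← push_comp]
        exact congrArg (push v) (map_comp_δ X.functor f₁ f₂ (λ_ N).hom)
      -- The mirror case, with the gluing point at the last vertex.
      · have hfl : mid f = N.len := by
          unfold Interior at hf; omega
        obtain ⟨f₁, f₂, h⟩ := exists_eq_tensorHom (C := N) (D := 𝟙_ _) (f ≫ (ρ_ N).inv) hfl
        obtain rfl : f = (f₁ ⊗ₘ f₂) ≫ (ρ_ N).hom := by
          rw [← h, Category.assoc, Iso.inv_hom_id, Category.comp_id]
        have hp' : p.1 = (restrict f₁ (top N)).1 :=
          hp.trans ((map_map _ _ _).trans (by rw [front_comp_rightUnitor]; rfl))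
        obtain rfl : vertex (topSimplex N) (Fin.last _) = c := by
          rw [← p.2.2, hp']; exact (restrict f₁ (top N)).2.2.symm
        obtain rfl := quiver_ext hp'
        obtain rfl : q = restrict f₂ (point (vertex (topSimplex N) (Fin.last _))) :=
          quiver_ext (hq.trans (map_comm (back_comp_rightUnitor f₁ f₂) (topSimplex N)))
        rw [extend_restrict_top h0 hl G v hv, extend_restrict h0 hl G v hv, ← push_pair_tensorHom,
          ← push_rightUnitor_δ v _
            (extend_counit h0 hl G v (point (vertex (topSimplex N) (Fin.last _)))),
          ← push_comp]
        exact congrArg (push v) (map_comp_δ X.functor f₁ f₂ (ρ_ N).hom)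

/-- A templicial object of an additive category that has a nonassociative Frobenius structure is
an enriched quasi-category. -/
theorem enrichedQuasiCategory_of_naFStructure [Preadditive V] (Z : NaFStructure X.functor) :
    EnrichedQuasiCategory X := by
  intro n i h0 hl G
  -- The naF-structure and additivity enter only in the existence of `v`.
  obtain ⟨v, hc, hv⟩ := (hornData (N := ⟨n⟩) h0 hl G).exists_filler Z h0 hl
  refine ⟨homOfEval (baseMap (vertex_mem (N := ⟨n⟩) h0 hl) G)
    (fun P a b y => extend (N := ⟨n⟩) h0 hl G v y)
    (fun f _ _ y => extend_restrict (N := ⟨n⟩) h0 hl G v hv f y)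
    (fun y p q hp hq => extend_comul (N := ⟨n⟩) h0 hl G v hv hc y p q hp hq)
    (fun y => extend_counit (N := ⟨n⟩) h0 hl G v y), ?_⟩
  refine map_comp_homOfEval _ _ _ _ _ Λ[n, i].ι G rfl fun {P a b} y => ?_
  refine (Category.comp_id _).trans ?_
  exact extend_of_mem (N := ⟨n⟩) h0 hl G v (quiverMap Λ[n, i].ι y) y.1.2

end Templicial

theorem mainTheorem2 :
    (∀ (X : SSet.{u}) [SSet.Quasicategory X], Nonempty (NaFStructure (ofSSet.obj X).functor)) ∧
    (∀ (V : Type w) [Category.{u} V] [MonoidalCategory V] [TensorCocomplete V] (X : SSet.{u})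
      (Z : NaFStructure (ofSSet.obj X).functor),
      ∃ Z' : NaFStructure ((freeTemplicial V).obj X).functor, ∀ m n : FinIntᵒᵖ,
        Z'.mul m n =
          inv (δ (VQuiver.mapQuiver (freeFunctor V) (ofSSet.obj X).base)
              ((ofSSet.obj X).functor.obj m) ((ofSSet.obj X).functor.obj n)) ≫
            (VQuiver.mapQuiver (freeFunctor V) (ofSSet.obj X).base).map (Z.mul m n)) ∧
    (∀ (k : Type u) [CommRing k] (X : Templicial (ModuleCat.{u} k)),
      Nonempty (NaFStructure X.functor) → EnrichedQuasiCategory X) ∧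
    (∀ (k : Type u) [CommRing k] (X : SSet.{u}) [SSet.Quasicategory X],
      EnrichedQuasiCategory ((freeTemplicial (ModuleCat.{u} k)).obj X)) := by
  refine ⟨fun X _ => ⟨SSetTemplicial.naFStructure X⟩,
    fun V _ _ _ X Z => exists_naFStructure_freeTemplicial V X Z,
    fun k _ X ⟨Z⟩ => Templicial.enrichedQuasiCategory_of_naFStructure Z, fun k _ X _ => ?_⟩
  -- Part (d): the structure of the quasi-category passes to the free templicial module, which is
  -- then covered by the argument for (c).
  obtain ⟨Z, _⟩ := exists_naFStructure_freeTemplicial (ModuleCat.{u} k) X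
    (SSetTemplicial.naFStructure X)
  exact Templicial.enrichedQuasiCategory_of_naFStructure Z
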